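/- Let $B^4$ be the open unit ball of $\mathbb R^4$. For an $su(2)$-valued $1$-form $A=\sum_{j=1}^4A_j\,dx_j$ on $B^4$ let $F_A=dA+A\wedge A$ be its curvature, with components $(F_A)_{ij}=\partial_{x_i}A_j-\partial_{x_j}A_i+[A_i,A_j]$ (weak derivatives), and let $|F_A|^2=\sum_{i<j}|(F_A)_{ij}|^2$, where $|B|^2=-\mathrm{Tr}(B^2)$ for $B\in su(2)$. For $g\in W^{2,2}(B^4,SU(2))$ let $A^g=g^{-1}dg+g^{-1}A\,g$. Then there exist $A^k\in W^{1,2}(\wedge^1B^4,su(2))$, $k\in\mathbb N$, such that $$\limsup_{k\to+\infty}\int_{B^4}|F_{A^k}|^2\,dx^4<+\infty$$ but $$\liminf_{k\to+\infty}\ \inf\left\{\int_{B^4}\sum_{i,j=1}^4|\partial_{x_i}(A^k)^g_j|^2\,dx^4\ ;\ g\in W^{2,2}(B^4,SU(2))\right\}=+\infty .$$ Moreover, the $A^k$ can be chosen to be rescaled instantons: $A^k=A_{\lambda_k}$ for some $\lambda_k>0$ with $\lambda_k\to+\infty$, where $$A_\lambda=\lambda^2\,\frac{\Im(\mathbf x\,d\overline{\mathbf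 x})}{1+\lambda^2|\mathbf x|^2},$$ $x\in\mathbb R^4$ is identified with the quaternion $\mathbf x=x_0+x_1\mathbf i+x_2\mathbf j+x_3\mathbf k$, and the imaginary quaternions are identified with $su(2)$ by $$\mathbf i\leftrightarrow\begin{pmatrix}i&0\\0&-i\end{pmatrix},\quad \mathbf j\leftrightarrow\begin{pmatrix}0&1\\-1&0\end{pmatrix},\quad \mathbf k\leftrightarrow\begin{pmatrix}0&i\\i&0\end{pmatrix}.$$ -/

import Mathlib

open Set Filter Topology MeasureTheory
open scoped ENNReal ContDiff Matrix Quaternion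

noncomputable section

namespace YangMills

/-- The Euclidean space `ℝ⁴`, with coordinates `x 0, x 1, x 2, x 3`. -/
abbrev E4 : Type := EuclideanSpace ℝ (Fin 4)

/-- Complex `2 × 2` matrices. -/
abbrev M2 : Type := Matrix (Fin 2) (Fin 2) ℂ

/- Matrices carry the Frobenius norm `‖M‖² = ∑ |M a b|² = Tr (Mᴴ M)`; on skew-Hermitian matrices
this is the norm of the invariant scalar product `⟨B, C⟩ = - Tr (B C)`. -/
attribute [local instance] Matrix.frobeniusNormedAddCommGroup Matrix.frobeniusNormedSpace

/-- The open unit ball of `ℝ⁴`. -/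
def B4 : Set E4 := Metric.ball 0 1

/-- The `i`-th coordinate vector of `ℝ⁴`. -/
def e (i : Fin 4) : E4 := EuclideanSpace.single i 1

section Sobolev

variable {F : Type*} [NormedAddCommGroup F] [NormedSpace ℝ F]

/-- `v` is a weak partial derivative `∂u/∂xᵢ` on `B⁴`: both are locally integrable on `B⁴`, and
`∫ (∂ᵢφ) u = - ∫ φ v` for all real test functions `φ ∈ C_c^∞(B⁴)`. -/
def HasWeakPartial (i : Fin 4) (u v : E4 → F) : Prop :=
  LocallyIntegrableOn u B4 ∧ LocallyIntegrableOn v B4 ∧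
    ∀ φ : E4 → ℝ, ContDiff ℝ ∞ φ → HasCompactSupport φ → tsupport φ ⊆ B4 →
      ∫ x in B4, (fderiv ℝ φ x (e i)) • u x = - ∫ x in B4, φ x • v x

/-- Weak partial derivatives are unique almost everywhere on `B⁴`. -/
theorem HasWeakPartial.ae_eq [CompleteSpace F] {i : Fin 4} {u v w : E4 → F}
    (hv : HasWeakPartial i u v) (hw : HasWeakPartial i u w) :
    ∀ᵐ x ∂(volume.restrict B4), v x = w x := by
  obtain ⟨-, hv1, hv2⟩ := hv
  obtain ⟨-, hw1, hw2⟩ := hw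
  have hopen : IsOpen B4 := Metric.isOpen_ball
  have key := hopen.ae_eq_zero_of_integral_contDiff_smul_eq_zero (μ := (volume : Measure E4))
    (f := v - w) (hv1.sub hw1) (by
      intro φ h1 h2 h3
      have hint : ∀ f : E4 → F, LocallyIntegrableOn f B4 →
          Integrable (fun x => φ x • f x) volume := by
        intro f hf
        have hK : IntegrableOn f (tsupport φ) volume :=
          (hf.mono_set h3).integrableOn_isCompact h2
        have := hK.continuousOn_smul (f := φ) h1.continuous.continuousOn h2
        refine (integrableOn_iff_integrable_of_support_subset ?_).1 this
        intro x hx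
        by_contra hx'
        exact hx (by simp [image_eq_zero_of_notMem_tsupport hx'])
      have hset : ∀ f : E4 → F, ∫ x in B4, φ x • f x = ∫ x, φ x • f x := by
        intro f
        refine setIntegral_eq_integral_of_forall_compl_eq_zero ?_
        intro x hx
        have : x ∉ tsupport φ := fun h => hx (h3 h)
        simp [image_eq_zero_of_notMem_tsupport this]
      have e1 := hv2 φ h1 h2 h3
      have e2 := hw2 φ h1 h2 h3
      rw [hset] at e1 e2
      have e3 : ∫ x, φ x • v x = ∫ x, φ x • w x := neg_injective (e1.symm.trans e2)
      simp only [Pi.sub_apply, smul_sub]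
      rw [integral_sub (hint v hv1) (hint w hw1), e3, sub_self])
  refine (ae_restrict_iff' hopen.measurableSet).2 ?_
  filter_upwards [key] with x hx hxB
  exact sub_eq_zero.1 (hx hxB)

open scoped Classical in
/-- The weak partial derivative `∂u/∂xᵢ` on `B⁴`, unique up to a null set (and `0` if there is
none). -/
def weakPartial (i : Fin 4) (u : E4 → F) : E4 → F :=
  if h : ∃ v, HasWeakPartial i u v then h.choose else 0

/-- The Sobolev space `W^{k,2}(B⁴, F)`: `u` and its weak partial derivatives up to order `k` are
in `L²(B⁴)`. -/
def MemW2 : ℕ → (E4 → F) → Prop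
  | 0, u => MemLp u 2 (volume.restrict B4)
  | k + 1, u => MemLp u 2 (volume.restrict B4) ∧
      ∀ i : Fin 4, ∃ v : E4 → F, HasWeakPartial i u v ∧ MemW2 k v

end Sobolev

/-- The Lie algebra `su(2)`: skew-Hermitian traceless matrices. -/
def su2 : Set M2 := {M | Mᴴ = -M ∧ M.trace = 0}

/-- The group `SU(2)`. -/
abbrev SU2 : Type := Matrix.specialUnitaryGroup (Fin 2) ℂ

/-- A matrix-valued 1-form `A = ∑ⱼ Aⱼ dxⱼ`, given by its components `A j`. -/
abbrev OneForm : Type := Fin 4 → E4 → M2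

/-- `A ∈ W^{1,2}(B⁴, su(2))`: an `su(2)`-valued 1-form with components in `W^{1,2}`. -/
def IsW12Connection (A : OneForm) : Prop :=
  ∀ j, MemW2 1 (A j) ∧ ∀ x ∈ B4, A j x ∈ su2

/-- The components `(F_A)ᵢⱼ = ∂ᵢAⱼ - ∂ⱼAᵢ + [Aᵢ, Aⱼ]` of the curvature `F_A = dA + A ∧ A`. -/
def curvature (A : OneForm) (i j : Fin 4) (x : E4) : M2 :=
  weakPartial i (A j) x - weakPartial j (A i) x + ⁅A i x, A j x⁆

/-- The Yang-Mills energy `∫_{B⁴} |F_A|² = ∫_{B⁴} ∑_{i<j} |(F_A)ᵢⱼ|²`. -/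
def ymEnergy (A : OneForm) : ℝ≥0∞ :=
  ∫⁻ x in B4, ∑ i : Fin 4, ∑ j ∈ Finset.Ioi i, ‖curvature A i j x‖ₑ ^ 2

/-- The Dirichlet energy `∫_{B⁴} ∑_{i,j} |∂ᵢAⱼ|²`. -/
def dirichletEnergy (A : OneForm) : ℝ≥0∞ :=
  ∫⁻ x in B4, ∑ i : Fin 4, ∑ j : Fin 4, ‖weakPartial i (A j) x‖ₑ ^ 2

/-- `g ∈ W^{2,2}(B⁴, SU(2))`. -/
def IsW22Gauge (g : E4 → SU2) : Prop := MemW2 2 (fun x => (g x : M2))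

/-- The gauge transform `A^g = g⁻¹ dg + g⁻¹ A g`. -/
def gaugeTransform (A : OneForm) (g : E4 → SU2) : OneForm := fun j x =>
  (((g x)⁻¹ : SU2) : M2) * weakPartial j (fun y => (g y : M2)) x
    + (((g x)⁻¹ : SU2) : M2) * A j x * (g x : M2)

/-- The point `x` as the quaternion `x₀ + x₁ i + x₂ j + x₃ k`. -/
def quat (x : E4) : ℍ[ℝ] := ⟨x 0, x 1, x 2, x 3⟩

/-- The imaginary part of a quaternion as an element of `su(2)`, where `i`, `j`, `k` are identified
with `(i, 0; 0, -i)`, `(0, 1; -1, 0)`, `(0, i; i, 0)`. -/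
def imSU2 (y : ℍ[ℝ]) : M2 :=
  y.imI • !![Complex.I, 0; 0, -Complex.I] + y.imJ • !![0, 1; -1, 0]
    + y.imK • !![0, Complex.I; Complex.I, 0]

/-- The rescaled instanton `A_l = l² Im(x dx̄) / (1 + l² |x|²)`. Its `j`-th component is obtained by
evaluating `dx̄` on the `j`-th coordinate vector. -/
def instanton (l : ℝ) : OneForm := fun j x =>
  (l ^ 2 / (1 + l ^ 2 * ‖x‖ ^ 2)) • imSU2 (quat x * star (quat (e j)))

end YangMills

end

open Set Filter Topology MeasureTheory
open scoped ENNReal ContDiff Matrix Quaternion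

noncomputable section

/-! In dimension four the energy is scale invariant. The curvature of the instanton is a fixed
self-dual form times `bubble l`, whose `L²` norm on all of `ℝ⁴` does not depend on `l`, so the
Yang-Mills energies stay bounded. As `l → ∞`, a fixed amount of `Tr (F ∧ F)` concentrates at the
origin, while `F` tends to `0` uniformly away from it. Both `|F|` and `Tr (F ∧ F)` are gauge
invariant, and a connection with bounded Dirichlet energy cannot carry such a concentrated charge.

Suppose that a gauge transform `B` of the instanton had `‖∂ᵢBⱼ‖₂ ≤ M`. The derivatives control `B`
only up to constants: by Poincaré-Sobolev, `B = a + b` with `a` constant and `b` bounded in `L⁴`,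
but `a` may be large. The curvature bound limits the commutators `[aᵢ, aⱼ]`, which forces the `aᵢ`
to lie within bounded distance of a common line in `su(2)`. After moving the error into `b`, the
background `a` is constant and abelian, hence flat (`exists_smul_eLpNorm_four_le`).

Relative to a flat background, `Tr (F ∧ F)` is the exterior derivative of the Chern-Simons form `Tr
(b ∧ F - b ∧ b ∧ b / 3)`, in which `a` occurs only through `F` (`two_mul_re_wedgeSq`, extended to
`L⁴` coefficients by mollification in `integral_wedgeSq_of_hasWeakPartial`). Tested against a cutoff
at scale `r`, the charge near `0` is bounded by an integral of `|b||F| + |b|³` over an annulus,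
divided by `r`. The cubic term is controlled by the `L⁴` norm of `b` on the annulus, in a scale
invariant way, and is small on one of many disjoint annuli. The term in `F` is small for large `l`.
The charge itself is bounded below, a contradiction (`exists_forall_not_eLpNorm_le`).

The computations take place in the quaternions, with the real part as trace; `toMat` and `ofMat`
translate to and from matrices. -/

namespace YangMills

/-! ### Mollification and its convergence in `L^p` -/

section Mollification

variable {F : Type*} [NormedAddCommGroup F] [NormedSpace ℝ F]

/-- A sequence of bump functions at the origin with shrinking supports. -/
def bump (n : ℕ) : ContDiffBump (0 : E4) where
  rIn := 1 / (n + 2)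
  rOut := 1 / (n + 1)
  rIn_pos := by positivity
  rIn_lt_rOut := by
    apply one_div_lt_one_div_of_lt <;> linarith [(Nat.cast_nonneg n : (0 : ℝ) ≤ n)]

/-- Mollification of `f` at scale `1 / (n + 1)`. -/
def moll (n : ℕ) (f : E4 → F) : E4 → F :=
  convolution ((bump n).normed volume) f (ContinuousLinearMap.lsmul ℝ ℝ) volume

theorem moll_apply (n : ℕ) (f : E4 → F) (x : E4) :
    moll n f x = ∫ t, (bump n).normed volume t • f (x - t) := rfl

theorem moll_congr {f g : E4 → F} (n : ℕ) (h : f =ᵐ[volume] g) : moll n f = moll n g :=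
  convolution_congr _ (ae_eq_refl _) h

theorem moll_apply' (n : ℕ) (f : E4 → F) (x : E4) :
    moll n f x = ∫ t, (bump n).normed volume (x - t) • f t :=
  convolution_lsmul_swap

theorem contDiff_moll (n : ℕ) {f : E4 → F} (hf : LocallyIntegrable f volume) :
    ContDiff ℝ ∞ (moll n f) :=
  (bump n).hasCompactSupport_normed.contDiff_convolution_left _
    ((bump n).contDiff_normed (n := (⊤ : ℕ∞))) hf

/-- The normalized bump is the density of a probability measure, so Jensen's inequality applies at
each point; Tonelli and translation invariance then give the bound. -/
theorem eLpNorm_moll_le (n : ℕ) {f : E4 → F} (hf : AEStronglyMeasurable f volume) {p : ℝ≥0∞}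
    (hp : 1 ≤ p) (hp' : p ≠ ⊤) : eLpNorm (moll n f) p volume ≤ eLpNorm f p volume := by
  -- A strongly measurable representative makes `(x, t) ↦ f (x - t)` jointly measurable, as Tonelli
  -- requires.
  wlog hfs : StronglyMeasurable f generalizing f with H
  · rw [moll_congr n hf.ae_eq_mk, eLpNorm_congr_ae hf.ae_eq_mk]
    exact H hf.stronglyMeasurable_mk.aestronglyMeasurable hf.stronglyMeasurable_mk
  set φ := (bump n).normed volume
  have hφ0 : ∀ t, 0 ≤ φ t := fun t => (bump n).nonneg_normed t
  have hφm : Measurable fun t => ENNReal.ofReal (φ t) :=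
    ((bump n).continuous_normed).measurable.ennreal_ofReal
  set ν := (volume : Measure E4).withDensity fun t => ENNReal.ofReal (φ t)
  have hν : ν Set.univ = 1 := by
    rw [withDensity_apply _ MeasurableSet.univ, setLIntegral_univ,
      ← ofReal_integral_eq_lintegral_ofReal (bump n).integrable_normed
        (Eventually.of_forall hφ0), (bump n).integral_normed, ENNReal.ofReal_one]
  have : IsProbabilityMeasure ν := ⟨hν⟩
  have hp0 : p ≠ 0 := (zero_lt_one.trans_le hp).ne'
  have hpr : 0 < p.toReal := ENNReal.toReal_pos hp0 hp'
  have hmeas : ∀ x, StronglyMeasurable fun t => f (x - t) := fun x =>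
    hfs.comp_measurable (measurable_const.sub measurable_id)
  have hpt : ∀ x, ‖moll n f x‖ₑ ^ p.toReal ≤ ∫⁻ t, ‖f (x - t)‖ₑ ^ p.toReal ∂ν := by
    intro x
    have h1 : ‖moll n f x‖ₑ ≤ eLpNorm (fun t => f (x - t)) 1 ν := by
      rw [moll_apply, eLpNorm_one_eq_lintegral_enorm]
      refine (enorm_integral_le_lintegral_enorm _).trans ?_
      rw [lintegral_withDensity_eq_lintegral_mul _ hφm (hmeas x).enorm]
      refine lintegral_mono fun t => ?_
      simp only [Pi.mul_apply, enorm_smul]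
      rw [Real.enorm_of_nonneg (hφ0 t)]
    have h2 := h1.trans (eLpNorm_le_eLpNorm_of_exponent_le hp (hmeas x).aestronglyMeasurable)
    calc _ ≤ (eLpNorm (fun t => f (x - t)) p ν) ^ p.toReal := by gcongr
      _ = _ := by
        rw [eLpNorm_eq_lintegral_rpow_enorm_toReal hp0 hp', ← ENNReal.rpow_mul,
          one_div_mul_cancel hpr.ne', ENNReal.rpow_one]
  rw [eLpNorm_eq_lintegral_rpow_enorm_toReal hp0 hp', eLpNorm_eq_lintegral_rpow_enorm_toReal hp0 hp']
  gcongr ?_ ^ _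
  calc ∫⁻ x, ‖moll n f x‖ₑ ^ p.toReal
      ≤ ∫⁻ x, ∫⁻ t, ‖f (x - t)‖ₑ ^ p.toReal ∂ν := lintegral_mono hpt
    _ = ∫⁻ t, (∫⁻ x, ‖f (x - t)‖ₑ ^ p.toReal) ∂ν := by
        refine lintegral_lintegral_swap ?_
        refine Measurable.aemeasurable ?_
        exact ((hfs.comp_measurable measurable_sub).enorm).pow_const _
    _ = ∫⁻ _, (∫⁻ x, ‖f x‖ₑ ^ p.toReal) ∂ν := by
        refine lintegral_congr fun t => ?_
        exact lintegral_sub_right_eq_self (fun x => ‖f x‖ₑ ^ p.toReal) t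
    _ = _ := by rw [lintegral_const, hν, mul_one]

theorem moll_sub (n : ℕ) {f g : E4 → F} (hf : LocallyIntegrable f volume)
    (hg : LocallyIntegrable g volume) : moll n (f - g) = moll n f - moll n g := by
  have hex : ∀ {h : E4 → F}, LocallyIntegrable h volume → ∀ x,
      Integrable (fun t => (bump n).normed volume t • h (x - t)) volume := fun hh x =>
    (bump n).hasCompactSupport_normed.convolutionExists_left
      (ContinuousLinearMap.lsmul ℝ ℝ) (bump n).continuous_normed hh x
  ext x
  simp only [moll_apply, Pi.sub_apply, smul_sub]
  exact integral_sub (hex hf x) (hex hg x)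

/-- Uniform continuity gives convergence in sup norm. All the differences vanish outside the compact
1-thickening `K` of the support, because the bumps have radius at most `1`, so this is also
convergence in `L^p`. -/
theorem tendsto_eLpNorm_moll_sub_of_continuous [CompleteSpace F] {g : E4 → F} (hg : Continuous g)
    (hgc : HasCompactSupport g) {p : ℝ≥0∞} :
    Tendsto (fun n => eLpNorm (moll n g - g) p volume) atTop (𝓝 0) := by
  set K := Metric.cthickening 1 (tsupport g)
  have hK : IsCompact K := hgc.isCompact.cthickening
  have hvan : ∀ n x, x ∉ K → (moll n g - g) x = 0 := by
    intro n x hx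
    have hball : ∀ y ∈ Metric.closedBall x 1, g y = 0 := by
      intro y hy
      by_contra hne
      refine hx (Metric.mem_cthickening_of_dist_le x y 1 _ (subset_tsupport _ hne) ?_)
      rw [dist_comm]; exact hy
    have hgx : g x = 0 := hball x (Metric.mem_closedBall_self zero_le_one)
    have : moll n g x = g x := by
      refine (bump n).normed_convolution_eq_right fun y hy => ?_
      rw [hgx]
      refine hball y (Metric.ball_subset_closedBall (Metric.ball_subset_ball ?_ hy))
      change (1 : ℝ) / (n + 1) ≤ 1
      rw [div_le_one (by positivity)]; linarith [(Nat.cast_nonneg n : (0 : ℝ) ≤ n)]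
    simp [this]
  have hunif := hgc.uniformContinuous_of_continuous hg
  have hKfin : volume K < ⊤ := hK.measure_lt_top
  set V : ℝ≥0∞ := volume K ^ (p.toReal⁻¹)
  have hV : V ≠ ⊤ := ENNReal.rpow_ne_top_of_nonneg (by positivity) hKfin.ne
  have hbound : ∀ ε : ℝ, 0 < ε → ∀ᶠ n in atTop,
      eLpNorm (moll n g - g) p volume ≤ V * ENNReal.ofReal ε := by
    intro ε hε
    obtain ⟨δ, hδ, hδ'⟩ := Metric.uniformContinuous_iff.1 hunif ε hε
    obtain ⟨N, hN⟩ := exists_nat_one_div_lt hδ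
    filter_upwards [eventually_ge_atTop N] with n hn
    have hpt : ∀ x, ‖(moll n g - g) x‖ ≤ ε := by
      intro x
      rw [Pi.sub_apply, ← dist_eq_norm]
      refine (bump n).dist_normed_convolution_le hg.aestronglyMeasurable fun y hy => ?_
      refine (hδ' (lt_of_lt_of_le hy ?_)).le
      refine le_trans ?_ hN.le
      change (1 : ℝ) / (n + 1) ≤ 1 / (N + 1)
      gcongr
    have hsupp : Function.support (moll n g - g) ⊆ K := fun x hx => by
      by_contra h; exact hx (hvan n x h)
    have h2 := eLpNorm_restrict_eq_of_support_subset (p := p) (μ := volume) hsupp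
    rw [← h2]
    refine (eLpNorm_le_of_ae_bound (p := p) (Eventually.of_forall hpt)).trans ?_
    rw [Measure.restrict_apply_univ]
  refine ENNReal.tendsto_nhds_zero.2 fun ε hε => ?_
  obtain ⟨δ, hδ, hδ'⟩ : ∃ δ : ℝ, 0 < δ ∧ V * ENNReal.ofReal δ ≤ ε := by
    have : Tendsto (fun δ : ℝ => V * ENNReal.ofReal δ) (𝓝[>] 0) (𝓝 (V * ENNReal.ofReal 0)) :=
      (ENNReal.Tendsto.const_mul (ENNReal.tendsto_ofReal tendsto_id) (Or.inr hV)).mono_left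
        nhdsWithin_le_nhds
    rw [ENNReal.ofReal_zero, mul_zero] at this
    obtain ⟨δ, h1, h2⟩ := ((ENNReal.tendsto_nhds_zero.1 this ε hε).and
      (self_mem_nhdsWithin)).exists
    exact ⟨δ, h2, h1⟩
  filter_upwards [hbound δ hδ] with n hn using hn.trans hδ'

/-- Mollifications converge in `L^p`. -/
theorem tendsto_eLpNorm_moll_sub [CompleteSpace F] {f : E4 → F} {p : ℝ≥0∞} (hp : 1 ≤ p)
    (hp' : p ≠ ⊤) (hf : MemLp f p volume) :
    Tendsto (fun n => eLpNorm (moll n f - f) p volume) atTop (𝓝 0) := by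
  refine ENNReal.tendsto_nhds_zero.2 fun ε hε => ?_
  have hε3 : ε / 3 ≠ 0 := (ENNReal.div_pos hε.ne' (by norm_num)).ne'
  obtain ⟨g, hgc, hfg, hg, hgp⟩ := hf.exists_hasCompactSupport_eLpNorm_sub_le hp' hε3
  filter_upwards [ENNReal.tendsto_nhds_zero.1
    (tendsto_eLpNorm_moll_sub_of_continuous hg hgc) (ε / 3) (pos_iff_ne_zero.2 hε3)] with n hn
  have hfl := hf.locallyIntegrable hp
  have hgl := hgp.locallyIntegrable hp
  have hdec : moll n f - f = moll n (f - g) + (moll n g - g) + (g - f) := by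
    rw [moll_sub n hfl hgl]; abel
  have hm : ∀ {h : E4 → F}, LocallyIntegrable h volume → AEStronglyMeasurable (moll n h) volume :=
    fun hh => (contDiff_moll n hh).continuous.aestronglyMeasurable
  rw [hdec]
  have h1 := hm (hfl.sub hgl)
  have h2 := (hm hgl).sub hgp.1
  calc _ ≤ eLpNorm (moll n (f - g) + (moll n g - g)) p volume + eLpNorm (g - f) p volume :=
        eLpNorm_add_le (h1.add h2) (hgp.1.sub hf.1) hp
    _ ≤ eLpNorm (moll n (f - g)) p volume + eLpNorm (moll n g - g) p volume
        + eLpNorm (g - f) p volume := by gcongr; exact eLpNorm_add_le h1 h2 hp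
    _ ≤ ε / 3 + ε / 3 + ε / 3 := by
        gcongr
        · exact (eLpNorm_moll_le n (hf.1.sub hgp.1) hp hp').trans hfg
        · rw [eLpNorm_sub_comm]; exact hfg
    _ = ε := ENNReal.add_thirds ε

end Mollification

/-! ### Calculus of weak derivatives -/

theorem locallyIntegrableOn_of_memLp {F : Type*} [NormedAddCommGroup F] {p : ℝ≥0∞} (hp : 1 ≤ p)
    {u : E4 → F} {s : Set E4} (hs : MeasurableSet s) (hu : MemLp u p (volume.restrict s)) :
    LocallyIntegrableOn u s := by
  have h := ((memLp_indicator_iff_restrict hs).2 hu).locallyIntegrable hp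
  refine LocallyIntegrableOn.congr ?_ (h.locallyIntegrableOn s)
  filter_upwards [ae_restrict_mem hs] with x hx using indicator_of_mem hx u

theorem memLp_indicator_ball {F : Type*} [NormedAddCommGroup F] {p : ℝ≥0∞} 
    {u : E4 → F} {R : ℝ} (hu : MemLp u p (volume.restrict (Metric.ball 0 R))) :
    MemLp (indicator (Metric.ball 0 R) u) p volume :=
  (memLp_indicator_iff_restrict Metric.isOpen_ball.measurableSet).2 hu

section WeakCalculus

variable {F G : Type*} [NormedAddCommGroup F] [NormedSpace ℝ F] [NormedAddCommGroup G]
  [NormedSpace ℝ G]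

theorem isOpen_B4 : IsOpen B4 := Metric.isOpen_ball

theorem measurableSet_B4 : MeasurableSet B4 := isOpen_B4.measurableSet

theorem integrable_test_smul {φ : E4 → ℝ} (hφ : Continuous φ) (hc : HasCompactSupport φ)
    (hs : tsupport φ ⊆ B4) {f : E4 → F} (hf : LocallyIntegrableOn f B4) :
    Integrable (fun x => φ x • f x) volume := by
  have hK : IntegrableOn f (tsupport φ) volume := (hf.mono_set hs).integrableOn_isCompact hc
  refine (integrableOn_iff_integrable_of_support_subset ?_).1
    (hK.continuousOn_smul (f := φ) hφ.continuousOn hc)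
  intro x hx
  by_contra hx'
  exact hx (by simp [image_eq_zero_of_notMem_tsupport hx'])

theorem fderiv_apply_eq_zero_of_notMem_tsupport {φ : E4 → F} {x v : E4} (h : x ∉ tsupport φ) :
    fderiv ℝ φ x v = 0 := by
  have : fderiv ℝ φ x = 0 := image_eq_zero_of_notMem_tsupport fun hx =>
    h (tsupport_fderiv_subset ℝ hx)
  simp [this]

theorem tsupport_fderiv_apply_subset (φ : E4 → F) (v : E4) :
    tsupport (fun x => fderiv ℝ φ x v) ⊆ tsupport φ := by
  refine closure_minimal (fun x hx => ?_) (isClosed_tsupport φ)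
  by_contra h
  exact hx (fderiv_apply_eq_zero_of_notMem_tsupport h)

theorem hasCompactSupport_fderiv_apply {φ : E4 → F} (hc : HasCompactSupport φ) (v : E4) :
    HasCompactSupport fun x => fderiv ℝ φ x v :=
  hc.of_isClosed_subset (isClosed_tsupport _) (tsupport_fderiv_apply_subset φ v)

theorem contDiff_fderiv_apply {φ : E4 → F} (hφ : ContDiff ℝ ∞ φ) (v : E4) :
    ContDiff ℝ ∞ fun x => fderiv ℝ φ x v :=
  (hφ.fderiv_right (m := ∞) (by simp)).clm_apply contDiff_const

theorem HasWeakPartial.clm_comp [CompleteSpace F] [CompleteSpace G] {i : Fin 4} {u v : E4 → F}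
    (h : HasWeakPartial i u v) (L : F →L[ℝ] G) :
    HasWeakPartial i (fun x => L (u x)) fun x => L (v x) := by
  obtain ⟨hu, hv, h⟩ := h
  have hl : ∀ {w : E4 → F}, LocallyIntegrableOn w B4 →
      LocallyIntegrableOn (fun x => L (w x)) B4 := fun hw x hx => by
    obtain ⟨s, hs, hs'⟩ := hw x hx
    exact ⟨s, hs, L.integrable_comp hs'⟩
  refine ⟨hl hu, hl hv, fun φ h1 h2 h3 => ?_⟩
  have hL := congrArg L (h φ h1 h2 h3)
  have i1 := integrable_test_smul (contDiff_fderiv_apply h1 (e i)).continuous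
    (hasCompactSupport_fderiv_apply h2 _) ((tsupport_fderiv_apply_subset _ _).trans h3) hu
  have i2 := integrable_test_smul h1.continuous h2 h3 hv
  rw [map_neg, ← L.integral_comp_comm i1.restrict, ← L.integral_comp_comm i2.restrict] at hL
  simpa using hL

theorem HasWeakPartial.add {i : Fin 4} {u v u' v' : E4 → F}
    (h : HasWeakPartial i u v) (h' : HasWeakPartial i u' v') :
    HasWeakPartial i (fun x => u x + u' x) fun x => v x + v' x := by
  refine ⟨h.1.add h'.1, h.2.1.add h'.2.1, fun φ h1 h2 h3 => ?_⟩
  have i1 : ∀ {w : E4 → F}, LocallyIntegrableOn w B4 →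
      Integrable (fun x => fderiv ℝ φ x (e i) • w x) (volume.restrict B4) := fun hw =>
    (integrable_test_smul (contDiff_fderiv_apply h1 (e i)).continuous
    (hasCompactSupport_fderiv_apply h2 _) ((tsupport_fderiv_apply_subset _ _).trans h3)
      hw).restrict (s := B4)
  have i2 : ∀ {w : E4 → F}, LocallyIntegrableOn w B4 →
      Integrable (fun x => φ x • w x) (volume.restrict B4) := fun hw =>
    (integrable_test_smul h1.continuous h2 h3 hw).restrict (s := B4)
  simp only [smul_add]
  rw [integral_add (i1 h.1) (i1 h'.1), integral_add (i2 h.2.1) (i2 h'.2.1),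
    h.2.2 φ h1 h2 h3, h'.2.2 φ h1 h2 h3, neg_add]

theorem HasWeakPartial.congr {i : Fin 4} {u v u' v' : E4 → F}
    (h : HasWeakPartial i u v) (hu : u =ᵐ[volume.restrict B4] u')
    (hv : v =ᵐ[volume.restrict B4] v') : HasWeakPartial i u' v' := by
  refine ⟨LocallyIntegrableOn.congr hu h.1, LocallyIntegrableOn.congr hv h.2.1, fun φ h1 h2 h3 => ?_⟩
  have e1 : ∫ x in B4, fderiv ℝ φ x (e i) • u x = ∫ x in B4, fderiv ℝ φ x (e i) • u' x :=
    integral_congr_ae (hu.mono fun x hx => by simp only [hx])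
  have e2 : ∫ x in B4, φ x • v x = ∫ x in B4, φ x • v' x :=
    integral_congr_ae (hv.mono fun x hx => by simp only [hx])
  rw [← e1, ← e2, h.2.2 φ h1 h2 h3]

theorem HasWeakPartial.hasWeakPartial_weakPartial {i : Fin 4} {u v : E4 → F}
    (h : HasWeakPartial i u v) : HasWeakPartial i u (weakPartial i u) := by
  have hex : ∃ v, HasWeakPartial i u v := ⟨v, h⟩
  rw [weakPartial, dif_pos hex]
  exact hex.choose_spec

theorem HasWeakPartial.weakPartial_ae_eq [CompleteSpace F] {i : Fin 4} {u v : E4 → F}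
    (h : HasWeakPartial i u v) : weakPartial i u =ᵐ[volume.restrict B4] v :=
  h.hasWeakPartial_weakPartial.ae_eq h

theorem setIntegral_eq_of_tsupport_subset {φ : E4 → ℝ} {s : Set E4} (hs : tsupport φ ⊆ s)
    (f : E4 → F) : ∫ x in s, φ x • f x = ∫ x, φ x • f x := by
  refine setIntegral_eq_integral_of_forall_compl_eq_zero fun x hx => ?_
  rw [image_eq_zero_of_notMem_tsupport fun h => hx (hs h), zero_smul]

/-- A `C¹` function is weakly differentiable. -/
theorem hasWeakPartial_of_contDiff {i : Fin 4} {f : E4 → F} (hf : ContDiff ℝ 1 f) :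
    HasWeakPartial i f fun x => fderiv ℝ f x (e i) := by
  have hcf : Continuous fun x => fderiv ℝ f x (e i) :=
    (hf.continuous_fderiv one_ne_zero).clm_apply continuous_const
  have l1 := hf.continuous.locallyIntegrable (μ := volume).locallyIntegrableOn B4
  have l2 := hcf.locallyIntegrable (μ := volume).locallyIntegrableOn B4
  refine ⟨l1, l2, fun φ h1 h2 h3 => ?_⟩
  have hs := (tsupport_fderiv_apply_subset φ (e i)).trans h3
  rw [setIntegral_eq_of_tsupport_subset hs, setIntegral_eq_of_tsupport_subset h3,
    integral_smul_fderiv_eq_neg_fderiv_smul_of_integrable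
      (integrable_test_smul (contDiff_fderiv_apply h1 (e i)).continuous
        (hasCompactSupport_fderiv_apply h2 _) hs l1)
      (integrable_test_smul h1.continuous h2 h3 l2)
      (integrable_test_smul h1.continuous h2 h3 l1)
      (fun x _ => (h1.differentiable (by simp)) x)
      (fun x _ => (hf.differentiable one_ne_zero) x), neg_neg]

/-- In the interior, mollification commutes with weak differentiation. -/
theorem fderiv_moll_indicator {i : Fin 4} {u v : E4 → F} (h : HasWeakPartial i u v) {R : ℝ}
    (hR : R ≤ 1) (hu : LocallyIntegrable (indicator (Metric.ball 0 R) u) volume) (n : ℕ)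
    {x : E4} (hx : ‖x‖ + 1 / (n + 1) < R) :
    fderiv ℝ (moll n (indicator (Metric.ball 0 R) u)) x (e i)
      = moll n (indicator (Metric.ball 0 R) v) x := by
  set φ := (bump n).normed (volume : Measure E4)
  have hφ : ContDiff ℝ ∞ φ := (bump n).contDiff_normed (n := (⊤ : ℕ∞))
  have hφc : HasCompactSupport φ := (bump n).hasCompactSupport_normed
  have hd := hφc.hasFDerivAt_convolution_left (ContinuousLinearMap.lsmul ℝ ℝ)
    (hφ.of_le (by simp)) hu x
  have hex : ConvolutionExistsAt (fderiv ℝ φ) (indicator (Metric.ball 0 R) u) x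
      (ContinuousLinearMap.precompL E4 (ContinuousLinearMap.lsmul ℝ ℝ)) volume :=
    (hφc.fderiv ℝ).convolutionExists_left _ (hφ.continuous_fderiv (by simp)) hu x
  have e1 : fderiv ℝ (moll n (indicator (Metric.ball 0 R) u)) x (e i)
      = ∫ t, fderiv ℝ φ (x - t) (e i) • indicator (Metric.ball 0 R) u t := by
    rw [show fderiv ℝ (moll n (indicator (Metric.ball 0 R) u)) x = _ from hd.fderiv,
      convolution_def, ContinuousLinearMap.integral_apply hex]
    simp only [ContinuousLinearMap.precompL_apply, ContinuousLinearMap.lsmul_apply]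
    rw [← integral_sub_left_eq_self _ volume x]
    simp
  -- The reflected translate of the bump is supported in the ball of radius `1 / (n + 1)` about `x`,
  -- which `hx` places inside the ball of radius `R`; hence it is an admissible test function for
  -- the weak derivative.
  set ψ : E4 → ℝ := fun t => φ (x - t)
  have hψ : ContDiff ℝ ∞ ψ := hφ.comp (contDiff_const.sub contDiff_id)
  have hsub : tsupport ψ ⊆ Metric.closedBall x (1 / (n + 1)) := by
    refine closure_minimal (fun t ht => ?_) Metric.isClosed_closedBall
    have : x - t ∈ Function.support φ := ht
    rw [(bump n).support_normed_eq] at this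
    rw [Metric.mem_closedBall, dist_comm, dist_eq_norm]
    exact (mem_ball_zero_iff.1 this).le
  have hball : Metric.closedBall x (1 / ((n : ℝ) + 1)) ⊆ Metric.ball 0 R := fun t ht => by
    rw [mem_ball_zero_iff]
    rw [Metric.mem_closedBall, dist_eq_norm] at ht
    have : ‖t‖ ≤ ‖t - x‖ + ‖x‖ := by simpa using norm_add_le (t - x) x
    linarith
  have hψc : HasCompactSupport ψ :=
    (isCompact_closedBall x _).of_isClosed_subset (isClosed_tsupport _) hsub
  have hψR : tsupport ψ ⊆ Metric.ball 0 R := hsub.trans hball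
  have hψB : tsupport ψ ⊆ B4 := hψR.trans (Metric.ball_subset_ball hR)
  have hdψ : ∀ t, fderiv ℝ ψ t (e i) = - fderiv ℝ φ (x - t) (e i) := fun t => by
    have h1 : HasFDerivAt (fun t : E4 => x - t) (-ContinuousLinearMap.id ℝ E4) t :=
      (hasFDerivAt_id t).const_sub x
    have h2 := ((hφ.differentiable (by simp)) (x - t)).hasFDerivAt.comp t h1
    rw [show fderiv ℝ ψ t = _ from h2.fderiv]
    simp
  have key := h.2.2 ψ hψ hψc hψB
  have hs := tsupport_fderiv_apply_subset ψ (e i)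
  rw [setIntegral_eq_of_tsupport_subset (hs.trans hψB), setIntegral_eq_of_tsupport_subset hψB,
    ← setIntegral_eq_of_tsupport_subset (hs.trans hψR),
    ← setIntegral_eq_of_tsupport_subset hψR] at key
  have aux : ∀ (η : E4 → ℝ) (w : E4 → F), tsupport η ⊆ Metric.ball 0 R →
      ∫ t, η t • indicator (Metric.ball 0 R) w t = ∫ t in Metric.ball 0 R, η t • w t := by
    intro η w _
    rw [← integral_indicator Metric.isOpen_ball.measurableSet]
    refine integral_congr_ae (Eventually.of_forall fun t => ?_)
    by_cases ht : t ∈ Metric.ball (0 : E4) R <;> simp [ht]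
  rw [e1, moll_apply', aux ψ v hψR, ← neg_neg (∫ t in _, ψ t • v t), ← key, ← aux _ u (hs.trans hψR),
    ← integral_neg]
  refine integral_congr_ae (Eventually.of_forall fun t => ?_)
  simp [hdψ]

theorem tendsto_eLpNorm_moll_indicator_sub [CompleteSpace F] {p : ℝ≥0∞} (hp : 1 ≤ p)
    (hp' : p ≠ ⊤) {u : E4 → F} {r R : ℝ} (hr : r ≤ R)
    (hu : MemLp u p (volume.restrict (Metric.ball 0 R))) :
    Tendsto (fun n => eLpNorm (moll n (indicator (Metric.ball 0 R) u) - u) p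
      (volume.restrict (Metric.ball 0 r))) atTop (𝓝 0) := by
  refine tendsto_of_tendsto_of_tendsto_of_le_of_le tendsto_const_nhds
    (tendsto_eLpNorm_moll_sub hp hp' (memLp_indicator_ball hu)) (fun _ => zero_le) fun n => ?_
  calc _ = eLpNorm (moll n (indicator (Metric.ball 0 R) u) - indicator (Metric.ball 0 R) u) p
          (volume.restrict (Metric.ball 0 r)) := by
        refine eLpNorm_congr_ae ?_
        filter_upwards [ae_restrict_mem Metric.isOpen_ball.measurableSet] with x hx
        simp [indicator_of_mem (Metric.ball_subset_ball hr hx)]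
    _ ≤ _ := eLpNorm_mono_measure _ Measure.restrict_le_self

theorem tendsto_eLpNorm_fderiv_moll_indicator_sub [CompleteSpace F] {p : ℝ≥0∞} (hp : 1 ≤ p)
    (hp' : p ≠ ⊤) {i : Fin 4} {u v : E4 → F} (h : HasWeakPartial i u v) {r R : ℝ} (hr : r < R)
    (hR : R ≤ 1) (hu : LocallyIntegrable (indicator (Metric.ball 0 R) u) volume)
    (hv : MemLp v p (volume.restrict (Metric.ball 0 R))) :
    Tendsto (fun n => eLpNorm ((fun x => fderiv ℝ (moll n (indicator (Metric.ball 0 R) u)) x (e i))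
      - v) p (volume.restrict (Metric.ball 0 r))) atTop (𝓝 0) := by
  refine (tendsto_eLpNorm_moll_indicator_sub hp hp' hr.le hv).congr' ?_
  obtain ⟨N, hN⟩ := exists_nat_one_div_lt (sub_pos.2 hr)
  filter_upwards [eventually_ge_atTop N] with n hn
  refine eLpNorm_congr_ae ?_
  filter_upwards [ae_restrict_mem Metric.isOpen_ball.measurableSet] with x hx
  have : (1 : ℝ) / (n + 1) ≤ 1 / (N + 1) := by gcongr
  simp only [Pi.sub_apply]
  rw [fderiv_moll_indicator h hR hu n]
  linarith [mem_ball_zero_iff.1 hx]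

theorem integrable_smul_of_memLp_two {μ : Measure E4} {f : E4 → ℝ} {u : E4 → F}
    (hf : MemLp f 2 μ) (hu : MemLp u 2 μ) : Integrable (fun x => f x • u x) μ :=
  memLp_one_iff_integrable.1 (hu.smul hf)

/-- Products with a bounded factor pass to the limit under `L² × L²` convergence. -/
theorem tendsto_integral_smul_smul {μ : Measure E4} {φ : E4 → ℝ} (hφ : Continuous φ) {C : ℝ}
    (hC : ∀ x, ‖φ x‖ ≤ C) {f : E4 → ℝ} {fs : ℕ → E4 → ℝ} {u : E4 → F} (hf : MemLp f 2 μ)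
    (hfs : ∀ n, AEStronglyMeasurable (fs n) μ) (hu : MemLp u 2 μ)
    (h : Tendsto (fun n => eLpNorm (fs n - f) 2 μ) atTop (𝓝 0)) :
    Tendsto (fun n => ∫ x, φ x • fs n x • u x ∂μ) atTop (𝓝 (∫ x, φ x • f x • u x ∂μ)) := by
  have hφu : MemLp (fun x => φ x • u x) 2 μ :=
    MemLp.of_le_mul (c := C) hu (hφ.aestronglyMeasurable.smul hu.1)
      (Eventually.of_forall fun x => by rw [norm_smul]; gcongr; exact hC x)
  have hev : ∀ᶠ n in atTop, MemLp (fs n) 2 μ := by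
    filter_upwards [(ENNReal.tendsto_nhds_zero.1 h 1 one_pos)] with n hn
    have : MemLp (fs n - f) 2 μ := ⟨(hfs n).sub hf.1, hn.trans_lt ENNReal.one_lt_top⟩
    simpa using this.add hf
  have hmul : ∀ {g : E4 → ℝ}, MemLp g 2 μ → Integrable (fun x => φ x • g x • u x) μ := by
    intro g hg
    refine (integrable_smul_of_memLp_two hg hφu).congr (Eventually.of_forall fun x => ?_)
    simp [smul_smul, mul_comm]
  refine tendsto_integral_of_L1 _ (hmul hf).1 (hev.mono fun n hn => hmul hn) ?_
  have hz : Tendsto (fun n => eLpNorm (fs n - f) 2 μ * eLpNorm (fun x => φ x • u x) 2 μ) atTop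
      (𝓝 0) := by
    simpa using ENNReal.Tendsto.mul_const h (Or.inr hφu.2.ne)
  refine tendsto_of_tendsto_of_tendsto_of_le_of_le tendsto_const_nhds hz (fun _ => zero_le)
    fun n => ?_
  refine le_trans (le_of_eq ?_) (eLpNorm_smul_le_mul_eLpNorm (r := 1) hφu.1 ((hfs n).sub hf.1))
  rw [eLpNorm_one_eq_lintegral_enorm]
  refine lintegral_congr fun x => congrArg _ ?_
  simp only [Pi.smul_apply', Pi.sub_apply, smul_smul, ← sub_smul]
  congr 1; ring

theorem exists_ball_of_isCompact_subset_B4 {K : Set E4} (hK : IsCompact K) (h : K ⊆ B4) :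
    ∃ r, 0 < r ∧ r < 1 ∧ K ⊆ Metric.ball 0 r := by
  rcases K.eq_empty_or_nonempty with rfl | hne
  · exact ⟨1 / 2, by norm_num, by norm_num, empty_subset _⟩
  obtain ⟨x, hx, hmax⟩ := hK.exists_isMaxOn hne continuous_norm.continuousOn
  have h1 : ‖x‖ < 1 := mem_ball_zero_iff.1 (h hx)
  refine ⟨(‖x‖ + 1) / 2, by positivity, by linarith, fun y hy => ?_⟩
  have : ‖y‖ ≤ ‖x‖ := hmax hy
  rw [mem_ball_zero_iff]; linarith

/-- The Leibniz rule for the product of two functions in `W^{1,2}`. -/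
theorem HasWeakPartial.smul [CompleteSpace F] {i : Fin 4} {f f' : E4 → ℝ} {u u' : E4 → F}
    (hf : HasWeakPartial i f f') (hu : HasWeakPartial i u u')
    (f2 : MemLp f 2 (volume.restrict B4)) (f2' : MemLp f' 2 (volume.restrict B4))
    (u2 : MemLp u 2 (volume.restrict B4)) (u2' : MemLp u' 2 (volume.restrict B4)) :
    HasWeakPartial i (fun x => f x • u x) fun x => f' x • u x + f x • u' x := by
  have hli : ∀ {g : E4 → ℝ} {w : E4 → F}, MemLp g 2 (volume.restrict B4) →
      MemLp w 2 (volume.restrict B4) → LocallyIntegrableOn (fun x => g x • w x) B4 :=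
    fun hg hw => locallyIntegrableOn_of_memLp le_rfl measurableSet_B4
      (memLp_one_iff_integrable.2 (integrable_smul_of_memLp_two hg hw))
  refine ⟨hli f2 u2, (hli f2' u2).add (hli f2 u2'), fun φ h1 h2 h3 => ?_⟩
  obtain ⟨r, hr0, hr1, hKr⟩ := exists_ball_of_isCompact_subset_B4 h2 h3
  have hrB : Metric.ball (0 : E4) r ⊆ B4 := Metric.ball_subset_ball hr1.le
  set μ := (volume : Measure E4).restrict (Metric.ball 0 r)
  have hμ : μ ≤ volume.restrict B4 := Measure.restrict_mono hrB le_rfl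
  have hfl : LocallyIntegrable (indicator (Metric.ball 0 1) f) volume :=
    (memLp_indicator_ball f2).locallyIntegrable (by norm_num)
  -- Only the scalar factor is smoothed: `φ * fs n` is then a test function for the weak derivative
  -- of `u`, and the resulting identity passes to the limit in `L² × L²`.
  set fs : ℕ → E4 → ℝ := fun n => moll n (indicator (Metric.ball 0 1) f)
  have hfs : ∀ n, ContDiff ℝ ∞ (fs n) := fun n => contDiff_moll n hfl
  have t1 := tendsto_eLpNorm_moll_indicator_sub (p := 2) (by norm_num) (by norm_num) hr1.le f2
  have t2 := tendsto_eLpNorm_fderiv_moll_indicator_sub (p := 2) (by norm_num) (by norm_num) hf hr1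
    le_rfl hfl f2'
  obtain ⟨C, hC⟩ := h1.continuous.bounded_above_of_compact_support h2
  have hdc := contDiff_fderiv_apply h1 (e i)
  have hdcs := hasCompactSupport_fderiv_apply h2 (e i)
  obtain ⟨C', hC'⟩ := hdc.continuous.bounded_above_of_compact_support hdcs
  have hdfs : ∀ n, Continuous fun x => fderiv ℝ (fs n) x (e i) := fun n =>
    (contDiff_fderiv_apply (hfs n) (e i)).continuous
  have l1 := tendsto_integral_smul_smul hdc.continuous hC' (f2.mono_measure hμ)
    (fun n => (hfs n).continuous.aestronglyMeasurable) (u2.mono_measure hμ) t1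
  have l2 := tendsto_integral_smul_smul h1.continuous hC (f2'.mono_measure hμ)
    (fun n => (hdfs n).aestronglyMeasurable) (u2.mono_measure hμ) t2
  have l3 := tendsto_integral_smul_smul h1.continuous hC (f2.mono_measure hμ)
    (fun n => (hfs n).continuous.aestronglyMeasurable) (u2'.mono_measure hμ) t1
  have hdK : tsupport (fun x => fderiv ℝ φ x (e i)) ⊆ Metric.ball 0 r :=
    (tsupport_fderiv_apply_subset φ (e i)).trans hKr
  have hn : ∀ n, ∫ x, fderiv ℝ φ x (e i) • fs n x • u x ∂μ =
      -∫ x, φ x • fderiv ℝ (fs n) x (e i) • u x ∂μ - ∫ x, φ x • fs n x • u' x ∂μ := by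
    intro n
    have hψ : ContDiff ℝ ∞ fun x => φ x * fs n x := h1.mul (hfs n)
    have hψs : tsupport (fun x => φ x * fs n x) ⊆ tsupport φ := tsupport_mul_subset_left
    have hψc : HasCompactSupport fun x => φ x * fs n x := h2.mul_right
    have key := hu.2.2 _ hψ hψc (hψs.trans h3)
    rw [setIntegral_eq_of_tsupport_subset ((tsupport_fderiv_apply_subset _ _).trans (hψs.trans h3)),
      setIntegral_eq_of_tsupport_subset (hψs.trans h3)] at key
    have hd : ∀ x, fderiv ℝ (fun x => φ x * fs n x) x (e i) • u x =
        fderiv ℝ φ x (e i) • fs n x • u x + φ x • fderiv ℝ (fs n) x (e i) • u x := by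
      intro x
      rw [fderiv_fun_mul (h1.differentiable (by simp) x) ((hfs n).differentiable (by simp) x)]
      simp only [add_apply, smul_apply, smul_eq_mul,
        add_smul, smul_smul]
      rw [add_comm, mul_comm (fs n x)]
    have hcs : ∀ {g : E4 → ℝ} {w : E4 → F}, Continuous g → MemLp w 2 (volume.restrict B4) →
        LocallyIntegrableOn (fun x => g x • w x) B4 := fun {g w} hg hw =>
      (locallyIntegrableOn_of_memLp (by norm_num) measurableSet_B4 hw).continuousOn_smul
        isOpen_B4.isLocallyClosed hg.continuousOn
    have i1 := integrable_test_smul hdc.continuous hdcs (hdK.trans hrB)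
      (hcs (hfs n).continuous u2)
    have i2 := integrable_test_smul h1.continuous h2 h3 (hcs (hdfs n) u2)
    simp only [hd] at key
    rw [integral_add i1 i2] at key
    simp only [μ]
    rw [setIntegral_eq_of_tsupport_subset hdK, setIntegral_eq_of_tsupport_subset hKr,
      setIntegral_eq_of_tsupport_subset hKr, eq_sub_of_add_eq key]
    simp only [smul_smul]
    abel
  have lim := tendsto_nhds_unique l1 ((l2.neg.sub l3).congr fun n => (hn n).symm)
  have j1 := integrable_test_smul h1.continuous h2 h3 (hli f2' u2)
  have j2 := integrable_test_smul h1.continuous h2 h3 (hli f2 u2')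
  simp only [μ] at lim
  rw [setIntegral_eq_of_tsupport_subset hdK, setIntegral_eq_of_tsupport_subset hKr,
      setIntegral_eq_of_tsupport_subset hKr] at lim
  rw [setIntegral_eq_of_tsupport_subset (hdK.trans hrB), setIntegral_eq_of_tsupport_subset h3, lim]
  simp only [smul_add]
  rw [integral_add j1 j2]
  abel

end WeakCalculus

/-! ### Poincaré and Sobolev inequalities -/

section Sobolev

variable {F : Type*} [NormedAddCommGroup F] [NormedSpace ℝ F]

theorem lintegral_sq_le_of_isProbabilityMeasure {α : Type*} [MeasurableSpace α] {μ : Measure α}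
    [IsProbabilityMeasure μ] {h : α → ℝ≥0∞} (hh : AEMeasurable h μ) :
    (∫⁻ t, h t ∂μ) ^ 2 ≤ ∫⁻ t, h t ^ 2 ∂μ := by
  have h1 := eLpNorm_le_eLpNorm_of_exponent_le (μ := μ) (p := 1) (q := 2) (by norm_num)
    hh.aestronglyMeasurable
  rw [eLpNorm_one_eq_lintegral_enorm,
    eLpNorm_eq_lintegral_rpow_enorm_toReal (by norm_num) (by norm_num)] at h1
  simp only [enorm_eq_self, ENNReal.toReal_ofNat, ENNReal.rpow_ofNat] at h1
  calc _ ≤ ((∫⁻ t, h t ^ 2 ∂μ) ^ (1 / 2 : ℝ)) ^ 2 := by gcongr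
    _ = _ := by
      rw [← ENNReal.rpow_natCast, ← ENNReal.rpow_mul]; norm_num

/-- The fundamental theorem of calculus along the segment from `x` to `y`, followed by
Cauchy-Schwarz on `[0, 1]`. -/
theorem enorm_sub_sq_le [CompleteSpace F] {v : E4 → F} (hv : ContDiff ℝ 1 v) (x y : E4) :
    ‖v x - v y‖ₑ ^ 2 ≤
      ‖y - x‖ₑ ^ 2 * ∫⁻ t in Ioc (0 : ℝ) 1, ‖fderiv ℝ v ((1 - t) • x + t • y)‖ₑ ^ 2 := by
  have hc : ∀ t : ℝ, HasDerivAt (fun t : ℝ => (1 - t) • x + t • y) (y - x) t := fun t => by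
    have h1 := ((hasDerivAt_id t).const_sub 1).smul_const x
    have h2 := (hasDerivAt_id t).smul_const y
    have := h1.add h2
    simp only [neg_smul, one_smul] at this
    rw [neg_add_eq_sub] at this
    exact this
  have hcc : Continuous fun t : ℝ => (1 - t) • x + t • y := by fun_prop
  have hdc : Continuous fun t : ℝ => fderiv ℝ v ((1 - t) • x + t • y) :=
    (hv.continuous_fderiv one_ne_zero).comp hcc
  have hcomp : ∀ t : ℝ, HasDerivAt (fun t : ℝ => v ((1 - t) • x + t • y))
      (fderiv ℝ v ((1 - t) • x + t • y) (y - x)) t := fun t =>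
    ((hv.differentiable one_ne_zero) _).hasFDerivAt.comp_hasDerivAt t (hc t)
  have hint := intervalIntegral.integral_eq_sub_of_hasDerivAt (a := 0) (b := 1)
    (fun t _ => hcomp t) ((hdc.clm_apply continuous_const).intervalIntegrable _ _)
  simp only [sub_zero, one_smul, zero_smul, add_zero, sub_self, zero_add] at hint
  rw [← enorm_neg, neg_sub, ← hint, intervalIntegral.integral_of_le zero_le_one]
  have : IsProbabilityMeasure ((volume : Measure ℝ).restrict (Ioc 0 1)) :=
    ⟨by rw [Measure.restrict_apply_univ, Real.volume_Ioc]; simp⟩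
  calc _ ≤ (∫⁻ t in Ioc (0 : ℝ) 1, ‖y - x‖ₑ * ‖fderiv ℝ v ((1 - t) • x + t • y)‖ₑ) ^ 2 := by
        gcongr
        refine (enorm_integral_le_lintegral_enorm _).trans (lintegral_mono fun t => ?_)
        rw [mul_comm]
        exact ContinuousLinearMap.le_opENorm _ _
    _ = ‖y - x‖ₑ ^ 2 * (∫⁻ t in Ioc (0 : ℝ) 1, ‖fderiv ℝ v ((1 - t) • x + t • y)‖ₑ) ^ 2 := by
        rw [lintegral_const_mul _ hdc.enorm.measurable, mul_pow]
    _ ≤ _ := by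
        gcongr
        exact lintegral_sq_le_of_isProbabilityMeasure hdc.enorm.measurable.aemeasurable

/-- The substitution `z = (1 - t) c + t y` maps `U` into itself by convexity and has Jacobian factor
`t⁻⁴ ≤ 16`. -/
theorem lintegral_comp_add_smul_le {g : E4 → ℝ≥0∞} (hg : Measurable g) {U : Set E4}
    (hU : MeasurableSet U) (hconv : Convex ℝ U) {c : E4} (hc : c ∈ U) {t : ℝ} (ht : 1 / 2 ≤ t)
    (ht1 : t ≤ 1) : ∫⁻ y in U, g ((1 - t) • c + t • y) ≤ 16 * ∫⁻ y in U, g y := by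
  have ht0 : 0 < t := by linarith
  calc ∫⁻ y in U, g ((1 - t) • c + t • y)
      ≤ ∫⁻ y in U, indicator U g ((1 - t) • c + t • y) := by
        refine setLIntegral_mono_ae' hU (Eventually.of_forall fun y hy => ?_)
        rw [indicator_of_mem (hconv hc hy (by linarith) ht0.le (by ring))]
    _ ≤ ∫⁻ y, indicator U g ((1 - t) • c + t • y) := setLIntegral_le_lintegral _ _
    _ = ∫⁻ z, indicator U g ((1 - t) • c + z) ∂(Measure.map (fun y : E4 => t • y) volume) := by
        rw [lintegral_map (f := fun z => indicator U g ((1 - t) • c + z))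
          ((hg.indicator hU).comp (measurable_const_add _)) (measurable_const_smul t)]
    _ = ENNReal.ofReal |(t ^ 4)⁻¹| * ∫⁻ z, indicator U g z := by
        rw [Measure.map_addHaar_smul _ ht0.ne', lintegral_smul_measure,
          lintegral_add_left_eq_self (fun z => indicator U g z), finrank_euclideanSpace,
          Fintype.card_fin, smul_eq_mul]
    _ ≤ 16 * ∫⁻ y in U, g y := by
        rw [lintegral_indicator hU]
        gcongr
        rw [abs_of_pos (by positivity)]
        have : (t ^ 4)⁻¹ ≤ 16 := by
          rw [inv_le_comm₀ (by positivity) (by norm_num)]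
          calc (16 : ℝ)⁻¹ = (1 / 2) ^ 4 := by norm_num
            _ ≤ t ^ 4 := by gcongr
        calc ENNReal.ofReal (t ^ 4)⁻¹ ≤ ENNReal.ofReal 16 := ENNReal.ofReal_le_ofReal this
          _ = 16 := by norm_num

theorem lintegral_swap_right_left {α β γ : Type*} [MeasurableSpace α] [MeasurableSpace β]
    [MeasurableSpace γ] {μ : Measure α} {ν : Measure β} {τ : Measure γ} [SFinite μ] [SFinite ν]
    [SFinite τ] {f : α → β → γ → ℝ≥0∞}
    (hf : Measurable fun p : (α × γ) × β => f p.1.1 p.2 p.1.2) :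
    ∫⁻ x, ∫⁻ y, ∫⁻ t, f x y t ∂τ ∂ν ∂μ = ∫⁻ t, ∫⁻ x, ∫⁻ y, f x y t ∂ν ∂μ ∂τ := by
  have hinner : ∀ x, ∫⁻ y, ∫⁻ t, f x y t ∂τ ∂ν = ∫⁻ t, ∫⁻ y, f x y t ∂ν ∂τ := fun x => by
    refine lintegral_lintegral_swap (Measurable.aemeasurable ?_)
    have : Measurable fun p : β × γ => (((x, p.2), p.1) : (α × γ) × β) := by fun_prop
    exact hf.comp this
  rw [lintegral_congr hinner]
  refine lintegral_lintegral_swap (Measurable.aemeasurable ?_)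
  exact hf.lintegral_prod_right'

/-- Poincaré's inequality in double integral form. -/
theorem lintegral_lintegral_enorm_sub_sq_le [CompleteSpace F] {v : E4 → F}
    (hv : ContDiff ℝ 1 v) (ρ : ℝ) :
    ∫⁻ x in Metric.ball 0 ρ, ∫⁻ y in Metric.ball 0 ρ, ‖v x - v y‖ₑ ^ 2 ≤
      ENNReal.ofReal (2 * ρ) ^ 2 * (16 * volume (Metric.ball (0 : E4) ρ) *
        ∫⁻ x in Metric.ball 0 ρ, ‖fderiv ℝ v x‖ₑ ^ 2) := by
  set U := Metric.ball (0 : E4) ρ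
  have hU : MeasurableSet U := Metric.isOpen_ball.measurableSet
  have hconv : Convex ℝ U := convex_ball _ _
  set g : E4 → ℝ≥0∞ := fun x => ‖fderiv ℝ v x‖ₑ ^ 2
  have hg : Continuous fun x => ‖fderiv ℝ v x‖ₑ ^ 2 :=
    (ENNReal.continuous_pow 2).comp (hv.continuous_fderiv one_ne_zero).enorm
  set J := ∫⁻ x in U, g x
  have hH : ∀ t ∈ Ioc (0 : ℝ) 1,
      ∫⁻ x in U, ∫⁻ y in U, g ((1 - t) • x + t • y) ≤ 16 * volume U * J := by
    intro t ht
    -- The substitution degenerates as `t → 0`. For `t ≤ 1 / 2` the roles of `x` and `y` are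
    -- exchanged, so that the scaling factor is `1 - t ≥ 1 / 2`.
    rcases le_total (1 / 2) t with h | h
    · calc _ ≤ ∫⁻ _ in U, 16 * J := setLIntegral_mono_ae' hU
            (Eventually.of_forall fun x hx => lintegral_comp_add_smul_le hg.measurable hU hconv hx h ht.2)
        _ = _ := by rw [setLIntegral_const]; ring
    · rw [lintegral_lintegral_swap (Continuous.measurable (by
        have : Continuous fun p : E4 × E4 => (1 - t) • p.1 + t • p.2 := by fun_prop
        exact hg.comp this)).aemeasurable]
      calc _ ≤ ∫⁻ _ in U, 16 * J := setLIntegral_mono_ae' hU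
            (Eventually.of_forall fun y hy => by
              have := lintegral_comp_add_smul_le hg.measurable hU hconv hy (t := 1 - t)
                (by linarith) (by linarith [ht.1])
              simpa [add_comm] using this)
        _ = _ := by rw [setLIntegral_const]; ring
  calc _ ≤ ∫⁻ x in U, ∫⁻ y in U, ENNReal.ofReal (2 * ρ) ^ 2 *
          ∫⁻ t in Ioc (0 : ℝ) 1, g ((1 - t) • x + t • y) := by
        refine setLIntegral_mono_ae' hU (Eventually.of_forall fun x hx => ?_)
        refine setLIntegral_mono_ae' hU (Eventually.of_forall fun y hy => ?_)
        refine (enorm_sub_sq_le hv x y).trans ?_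
        gcongr
        rw [← ofReal_norm]
        refine ENNReal.ofReal_le_ofReal ((norm_sub_le _ _).trans ?_)
        linarith [mem_ball_zero_iff.1 hx, mem_ball_zero_iff.1 hy]
    _ = ENNReal.ofReal (2 * ρ) ^ 2 * ∫⁻ x in U, ∫⁻ y in U,
          ∫⁻ t in Ioc (0 : ℝ) 1, g ((1 - t) • x + t • y) := by
        have hfin : ENNReal.ofReal (2 * ρ) ^ 2 ≠ ⊤ := by finiteness
        rw [← lintegral_const_mul' _ _ hfin]
        refine lintegral_congr fun x => ?_
        rw [← lintegral_const_mul' _ _ hfin]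
    _ = ENNReal.ofReal (2 * ρ) ^ 2 * ∫⁻ t in Ioc (0 : ℝ) 1, ∫⁻ x in U, ∫⁻ y in U,
          g ((1 - t) • x + t • y) := by
        congr 1
        refine lintegral_swap_right_left (f := fun x y t => g ((1 - t) • x + t • y)) ?_
        have : Continuous fun p : (E4 × ℝ) × E4 => (1 - p.1.2) • p.1.1 + p.1.2 • p.2 := by fun_prop
        exact (hg.comp this).measurable
    _ ≤ ENNReal.ofReal (2 * ρ) ^ 2 * ∫⁻ _ in Ioc (0 : ℝ) 1, 16 * volume U * J := by
        exact mul_le_mul' le_rfl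
          (setLIntegral_mono_ae' measurableSet_Ioc (Eventually.of_forall hH))
    _ = _ := by rw [setLIntegral_const, Real.volume_Ioc]; simp

/-- The constant is a value `v y` at a point where the inner integral is at most its average over
the ball. The factor `8ρ` is the square root of `16 (2ρ)²`. -/
theorem exists_eLpNorm_sub_le [CompleteSpace F] {v : E4 → F} (hv : ContDiff ℝ 1 v) {ρ : ℝ}
    (hρ : 0 < ρ) :
    ∃ a : F, eLpNorm (fun x => v x - a) 2 (volume.restrict (Metric.ball 0 ρ)) ≤
      ENNReal.ofReal (8 * ρ) * eLpNorm (fderiv ℝ v) 2 (volume.restrict (Metric.ball 0 ρ)) := by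
  set U := Metric.ball (0 : E4) ρ
  have hU0 : volume U ≠ 0 := (Metric.measure_ball_pos volume _ hρ).ne'
  have hU1 : volume U ≠ ⊤ := measure_ball_lt_top.ne
  have hm : Continuous fun p : E4 × E4 => ‖v p.2 - v p.1‖ₑ ^ 2 := by
    have := hv.continuous
    exact (ENNReal.continuous_pow 2).comp (by fun_prop)
  obtain ⟨y, -, hy⟩ := exists_le_setLAverage (f := fun y => ∫⁻ x in U, ‖v x - v y‖ₑ ^ 2) hU0 hU1
    (Measurable.lintegral_prod_right' (f := fun p : E4 × E4 => ‖v p.2 - v p.1‖ₑ ^ 2)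
      hm.measurable).aemeasurable
  refine ⟨v y, ?_⟩
  have h1 : ∫⁻ x in U, ‖v x - v y‖ₑ ^ 2 ≤
      ENNReal.ofReal (8 * ρ) ^ 2 * ∫⁻ x in U, ‖fderiv ℝ v x‖ₑ ^ 2 := by
    refine hy.trans ?_
    rw [setLAverage_eq]
    refine ENNReal.div_le_of_le_mul ?_
    have h2 := lintegral_lintegral_enorm_sub_sq_le hv ρ
    calc _ = ∫⁻ y in U, ∫⁻ x in U, ‖v y - v x‖ₑ ^ 2 := by
          refine lintegral_congr fun y => lintegral_congr fun x => ?_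
          rw [← enorm_neg, neg_sub]
      _ ≤ _ := h2
      _ = _ := by
        rw [show 8 * ρ = 4 * (2 * ρ) by ring, ENNReal.ofReal_mul (p := 4) (by norm_num), mul_pow]
        rw [show ENNReal.ofReal 4 ^ 2 = 16 by
          rw [← ENNReal.ofReal_pow (by norm_num)]; norm_num]
        ring
  rw [eLpNorm_eq_lintegral_rpow_enorm_toReal (by norm_num) (by norm_num),
    eLpNorm_eq_lintegral_rpow_enorm_toReal (by norm_num) (by norm_num)]
  simp only [ENNReal.toReal_ofNat, ENNReal.rpow_ofNat]
  calc _ ≤ (ENNReal.ofReal (8 * ρ) ^ 2 * ∫⁻ x in U, ‖fderiv ℝ v x‖ₑ ^ 2) ^ (1 / 2 : ℝ) := by gcongr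
    _ = _ := by
      rw [ENNReal.mul_rpow_of_nonneg _ _ (by norm_num), ← ENNReal.rpow_natCast,
        ← ENNReal.rpow_mul]
      norm_num

/-- The Poincaré–Sobolev inequality for smooth functions. -/
theorem exists_eLpNorm_four_sub_le (F : Type*) [NormedAddCommGroup F] [NormedSpace ℝ F]
    [FiniteDimensional ℝ F] :
    ∃ C : ℝ≥0∞, C ≠ ⊤ ∧ ∀ v : E4 → F, ContDiff ℝ 1 v → ∃ a : F,
      eLpNorm (fun x => v x - a) 2 (volume.restrict (Metric.ball 0 (3 / 4))) ≤
        C * eLpNorm (fderiv ℝ v) 2 (volume.restrict (Metric.ball 0 (3 / 4))) ∧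
      eLpNorm (fun x => v x - a) 4 (volume.restrict (Metric.ball 0 (1 / 2))) ≤
        C * eLpNorm (fderiv ℝ v) 2 (volume.restrict (Metric.ball 0 (3 / 4))) := by
  have : CompleteSpace F := FiniteDimensional.complete ℝ F
  -- The cutoff localizes the Sobolev inequality for compactly supported functions, with exponents
  -- `2` and `4` in dimension four; the term where it is differentiated is absorbed by the Poincaré
  -- inequality.
  let χ : ContDiffBump (0 : E4) := ⟨1 / 2, 3 / 4, by norm_num, by norm_num⟩
  have hχ : ContDiff ℝ 1 χ := χ.contDiff
  obtain ⟨D, hD⟩ := (hχ.continuous_fderiv one_ne_zero).bounded_above_of_compact_support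
    (χ.hasCompactSupport.fderiv ℝ)
  have hD0 : 0 ≤ D := (norm_nonneg _).trans (hD 0)
  set U := Metric.ball (0 : E4) (3 / 4)
  set S := SNormLESNormFDerivOfEqConst F (volume : Measure E4) (2 : NNReal)
  set C1 : ℝ≥0∞ := ENNReal.ofReal (8 * (3 / 4))
  refine ⟨C1 + S * (1 + ENNReal.ofReal D * C1), by finiteness, fun v hv => ?_⟩
  obtain ⟨a, ha⟩ := exists_eLpNorm_sub_le hv (ρ := 3 / 4) (by norm_num)
  refine ⟨a, ha.trans (by gcongr; exact le_self_add), ?_⟩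
  set w : E4 → F := fun x => χ x • (v x - a)
  have hva : ContDiff ℝ 1 fun x => v x - a := hv.sub contDiff_const
  have hw : ContDiff ℝ 1 w := hχ.smul hva
  have hwc : HasCompactSupport w := χ.hasCompactSupport.smul_right
  have hsob := eLpNorm_le_eLpNorm_fderiv_of_eq (F := F) (volume : Measure E4) hw hwc
    (p := 2) (p' := 4) (by norm_num) (by simp) (by simp; norm_num)
  have hfd : ∀ x, ‖fderiv ℝ w x‖ ≤ ‖fderiv ℝ v x‖ + D * ‖v x - a‖ := by
    intro x
    rw [show fderiv ℝ w x = _ from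
      fderiv_fun_smul (hχ.differentiable one_ne_zero x) (hva.differentiable one_ne_zero x)]
    refine (norm_add_le _ _).trans ?_
    gcongr
    · rw [norm_smul, fderiv_sub_const, Real.norm_of_nonneg χ.nonneg]
      exact mul_le_of_le_one_left (norm_nonneg _) χ.le_one
    · rw [ContinuousLinearMap.norm_smulRight_apply]
      gcongr; exact hD x
  have hsupp : Function.support (fderiv ℝ w) ⊆ U := by
    intro x hx
    by_contra hxU
    refine hx ?_
    have h0 : ∀ y, χ y = 0 → w y = 0 := fun y hy => by simp [w, hy]
    -- The support has to lie in the open ball. On the sphere `‖x‖ = 3 / 4` the cutoff attains its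
    -- minimum `0`, so its derivative vanishes there too.
    rcases lt_or_eq_of_le (show 3 / 4 ≤ ‖x‖ by simpa [U] using hxU) with h | h
    · have hev : w =ᶠ[𝓝 x] fun _ => 0 := by
        filter_upwards [(isOpen_lt continuous_const continuous_norm).mem_nhds h] with y hy
        exact h0 y (χ.zero_of_le_dist (by rw [dist_zero_right]; exact le_of_lt hy))
      rw [hev.fderiv_eq]; simp
    · have hχ0 : χ x = 0 := χ.zero_of_le_dist (by rw [dist_zero_right]; exact h.le)
      have hχd : fderiv ℝ χ x = 0 := by
        refine IsLocalMin.fderiv_eq_zero (Eventually.of_forall fun y => ?_)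
        rw [hχ0]; exact χ.nonneg
      rw [show fderiv ℝ w x = _ from
        fderiv_fun_smul (hχ.differentiable one_ne_zero x) (hva.differentiable one_ne_zero x),
        hχ0, hχd]
      simp
  calc eLpNorm (fun x => v x - a) 4 (volume.restrict (Metric.ball 0 (1 / 2)))
      = eLpNorm w 4 (volume.restrict (Metric.ball 0 (1 / 2))) := by
        refine eLpNorm_congr_ae ?_
        filter_upwards [ae_restrict_mem Metric.isOpen_ball.measurableSet] with x hx
        simp only [w]
        rw [χ.one_of_mem_closedBall (Metric.ball_subset_closedBall hx), one_smul]
    _ ≤ eLpNorm w 4 volume := eLpNorm_mono_measure _ Measure.restrict_le_self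
    _ ≤ S * eLpNorm (fderiv ℝ w) 2 volume := by exact_mod_cast hsob
    _ = S * eLpNorm (fderiv ℝ w) 2 (volume.restrict U) := by
        have h := eLpNorm_restrict_eq_of_support_subset (ε := E4 →L[ℝ] F) (f := fderiv ℝ w) (p := 2)
          (μ := (volume : Measure E4)) (s := U) hsupp
        exact congrArg _ h.symm
    _ ≤ S * eLpNorm (fun x => ‖fderiv ℝ v x‖ + D * ‖v x - a‖) 2 (volume.restrict U) := by
        gcongr
        exact eLpNorm_mono fun x => (hfd x).trans (le_abs_self _)
    _ ≤ S * (eLpNorm (fderiv ℝ v) 2 (volume.restrict U)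
          + ENNReal.ofReal D * eLpNorm (fun x => v x - a) 2 (volume.restrict U)) := by
        gcongr
        refine (eLpNorm_add_le (hv.continuous_fderiv one_ne_zero).norm.aestronglyMeasurable
          (continuous_const.mul hva.continuous.norm).aestronglyMeasurable (by norm_num)).trans ?_
        gcongr
        · rw [eLpNorm_norm]
        · refine (eLpNorm_const_smul_le (c := D) (f := fun x => ‖v x - a‖)).trans ?_
          rw [eLpNorm_norm, Real.enorm_of_nonneg hD0]
    _ ≤ S * (eLpNorm (fderiv ℝ v) 2 (volume.restrict U)
          + ENNReal.ofReal D * (C1 * eLpNorm (fderiv ℝ v) 2 (volume.restrict U))) := by gcongr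
    _ = S * (1 + ENNReal.ofReal D * C1) * eLpNorm (fderiv ℝ v) 2 (volume.restrict U) := by ring
    _ ≤ _ := by gcongr; exact le_add_self

theorem norm_clm_le_sum (L : E4 →L[ℝ] F) : ‖L‖ ≤ ∑ i, ‖L (e i)‖ := by
  refine L.opNorm_le_bound (Finset.sum_nonneg fun _ _ => norm_nonneg _) fun x => ?_
  have hx : x = ∑ i, x i • e i := by
    have := ((EuclideanSpace.basisFun (Fin 4) ℝ).sum_repr x).symm
    simpa [e] using this
  calc ‖L x‖ = ‖∑ i, x i • L (e i)‖ := by conv_lhs => rw [hx, map_sum]; simp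
    _ ≤ ∑ i, ‖x i • L (e i)‖ := norm_sum_le _ _
    _ ≤ ∑ i, ‖L (e i)‖ * ‖x‖ := by
        refine Finset.sum_le_sum fun i _ => ?_
        rw [norm_smul, mul_comm]
        gcongr
        exact PiLp.norm_apply_le x i
    _ = _ := by rw [Finset.sum_mul]

theorem eLpNorm_fderiv_le_sum {v : E4 → F} (hv : ContDiff ℝ 1 v) {p : ℝ≥0∞} (hp : 1 ≤ p)
    (μ : Measure E4) :
    eLpNorm (fderiv ℝ v) p μ ≤ ∑ i, eLpNorm (fun x => fderiv ℝ v x (e i)) p μ := by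
  have hc : ∀ i, Continuous fun x => ‖fderiv ℝ v x (e i)‖ := fun i =>
    ((hv.continuous_fderiv one_ne_zero).clm_apply continuous_const).norm
  calc _ ≤ eLpNorm (∑ i, fun x => ‖fderiv ℝ v x (e i)‖) p μ := by
        refine eLpNorm_mono fun x => (norm_clm_le_sum _).trans ?_
        rw [Finset.sum_apply]; exact le_abs_self _
    _ ≤ ∑ i, eLpNorm (fun x => ‖fderiv ℝ v x (e i)‖) p μ :=
        eLpNorm_sum_le (fun i _ => (hc i).aestronglyMeasurable) hp
    _ = _ := by simp only [eLpNorm_norm]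

end Sobolev

/-- The Poincaré–Sobolev inequality for weakly differentiable functions. -/
theorem exists_eLpNorm_four_sub_le_of_hasWeakPartial (F : Type*) [NormedAddCommGroup F]
    [NormedSpace ℝ F] [FiniteDimensional ℝ F] :
    ∃ C : ℝ≥0∞, C ≠ ⊤ ∧ ∀ (u : E4 → F) (d : Fin 4 → E4 → F), (∀ i, HasWeakPartial i u (d i)) →
      MemLp u 2 (volume.restrict B4) → (∀ i, MemLp (d i) 2 (volume.restrict B4)) → ∃ a : F,
      eLpNorm (fun x => u x - a) 4 (volume.restrict (Metric.ball 0 (1 / 2))) ≤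
        C * ∑ i, eLpNorm (d i) 2 (volume.restrict B4) := by
  have : CompleteSpace F := FiniteDimensional.complete ℝ F
  have : ProperSpace F := FiniteDimensional.proper ℝ F
  obtain ⟨C, hC, hCv⟩ := exists_eLpNorm_four_sub_le F
  refine ⟨C, hC, fun u d hd hu hd2 => ?_⟩
  set μ := (volume : Measure E4).restrict (Metric.ball 0 (3 / 4)) with hμ
  set μ' := (volume : Measure E4).restrict (Metric.ball 0 (1 / 2))
  have hμB : μ ≤ volume.restrict B4 :=
    Measure.restrict_mono (Metric.ball_subset_ball (by norm_num)) le_rfl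
  have hμμ' : μ' ≤ μ := Measure.restrict_mono (Metric.ball_subset_ball (by norm_num)) le_rfl
  have hul : LocallyIntegrable (indicator (Metric.ball 0 1) u) volume :=
    (memLp_indicator_ball hu).locallyIntegrable (by norm_num)
  set v : ℕ → E4 → F := fun n => moll n (indicator (Metric.ball 0 1) u)
  have hv : ∀ n, ContDiff ℝ ∞ (v n) := fun n => contDiff_moll n hul
  have hv1 : ∀ n, ContDiff ℝ 1 (v n) := fun n => (hv n).of_le (by simp)
  choose a ha2 ha4 using fun n => hCv (v n) (hv1 n)
  have t0 : Tendsto (fun n => eLpNorm (v n - u) 2 μ) atTop (𝓝 0) :=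
    tendsto_eLpNorm_moll_indicator_sub (by norm_num) (by norm_num) (by norm_num) hu
  have td : ∀ i, Tendsto (fun n => eLpNorm ((fun x => fderiv ℝ (v n) x (e i)) - d i) 2 μ)
      atTop (𝓝 0) := fun i =>
    tendsto_eLpNorm_fderiv_moll_indicator_sub (by norm_num) (by norm_num) (hd i)
      (by norm_num) le_rfl hul (hd2 i)
  set S : ℝ≥0∞ := ∑ i, eLpNorm (d i) 2 (volume.restrict B4)
  have hS : S ≠ ⊤ := (ENNReal.sum_lt_top.2 fun i _ => (hd2 i).2).ne
  set ε : ℕ → ℝ≥0∞ := fun n => ∑ i, eLpNorm ((fun x => fderiv ℝ (v n) x (e i)) - d i) 2 μ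
  have hε : Tendsto ε atTop (𝓝 0) := by
    simpa using tendsto_finsetSum Finset.univ fun i _ => td i
  have hfd : ∀ n, eLpNorm (fderiv ℝ (v n)) 2 μ ≤ S + ε n := by
    intro n
    refine (eLpNorm_fderiv_le_sum (hv1 n) (by norm_num) μ).trans ?_
    rw [← Finset.sum_add_distrib]
    refine Finset.sum_le_sum fun i _ => ?_
    have hm : AEStronglyMeasurable (fun x => fderiv ℝ (v n) x (e i)) μ :=
      (contDiff_fderiv_apply (hv n) (e i)).continuous.aestronglyMeasurable
    have hdm := ((hd2 i).mono_measure hμB).1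
    calc _ = eLpNorm (d i + ((fun x => fderiv ℝ (v n) x (e i)) - d i)) 2 μ := by
          rw [add_sub_cancel]
      _ ≤ _ := eLpNorm_add_le hdm (hm.sub hdm) (by norm_num)
      _ ≤ _ := by gcongr
  -- the constants stay bounded
  set V : ℝ≥0∞ := μ univ ^ (1 / (2 : ℝ≥0∞).toReal)
  have hμuniv : μ univ = volume (Metric.ball (0 : E4) (3 / 4)) := Measure.restrict_apply_univ _
  have hμpos : μ univ ≠ 0 := by
    rw [hμuniv]; exact (Metric.measure_ball_pos volume _ (by norm_num)).ne'
  have hμfin : μ univ ≠ ⊤ := by rw [hμuniv]; exact measure_ball_lt_top.ne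
  have hμ0 : μ ≠ 0 := fun h => hμpos (by simp [h])
  have hV0 : V ≠ 0 := (ENNReal.rpow_pos (pos_iff_ne_zero.2 hμpos) hμfin).ne'
  have hVt : V ≠ ⊤ := ENNReal.rpow_ne_top_of_nonneg (by positivity) hμfin
  have hu2 := hu.mono_measure hμB
  set K : ℝ≥0∞ := (C * (S + 1) + (eLpNorm u 2 μ + 1)) / V
  have hK : K ≠ ⊤ := ENNReal.div_ne_top (by have := hu2.2.ne; finiteness) hV0
  have hab : ∀ᶠ n in atTop, ‖a n‖ ≤ K.toReal := by
    filter_upwards [ENNReal.tendsto_nhds_zero.1 hε 1 one_pos,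
      ENNReal.tendsto_nhds_zero.1 t0 1 one_pos] with n h1 h2
    have hvm := (hv n).continuous.aestronglyMeasurable (μ := μ)
    have h3 : ‖a n‖ₑ * V ≤ C * (S + 1) + (eLpNorm u 2 μ + 1) := by
      calc ‖a n‖ₑ * V = eLpNorm (fun _ : E4 => a n) 2 μ :=
            (eLpNorm_const _ (by norm_num) hμ0).symm
        _ = eLpNorm (v n - fun x => v n x - a n) 2 μ := by
            congr 1; ext x; simp
        _ ≤ eLpNorm (v n) 2 μ + eLpNorm (fun x => v n x - a n) 2 μ :=
            eLpNorm_sub_le hvm (hvm.sub aestronglyMeasurable_const) (by norm_num)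
        _ = eLpNorm (fun x => v n x - a n) 2 μ + eLpNorm (u + (v n - u)) 2 μ := by
            rw [add_comm, add_sub_cancel]
        _ ≤ C * (S + 1) + (eLpNorm u 2 μ + 1) := by
            refine add_le_add ((ha2 n).trans ?_) ((eLpNorm_add_le hu2.1 (hvm.sub hu2.1)
              (by norm_num)).trans ?_)
            · gcongr; exact (hfd n).trans (by gcongr)
            · gcongr
    have h4 : ‖a n‖ₑ ≤ K := (ENNReal.le_div_iff_mul_le (Or.inl hV0) (Or.inl hVt)).2 h3
    simpa using ENNReal.toReal_mono hK h4
  -- Along a subsequence the mollifications converge almost everywhere and the bounded constants `a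
  -- n` converge; Fatou's lemma then carries the `L⁴` bound to the limit.
  obtain ⟨ns, hns, hae⟩ := (tendstoInMeasure_of_tendsto_eLpNorm (by norm_num)
    (fun n => (hv n).continuous.aestronglyMeasurable) hu2.1 t0).exists_seq_tendsto_ae
  obtain ⟨a₀, -, ms, hms, hlim⟩ := tendsto_subseq_of_frequently_bounded
    (Metric.isBounded_closedBall (x := (0 : F)) (r := K.toReal)) (x := a ∘ ns)
    (((hns.tendsto_atTop.eventually hab).mono fun n hn =>
      mem_closedBall_zero_iff.2 hn).frequently)
  refine ⟨a₀, ?_⟩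
  have hsub := hns.tendsto_atTop.comp hms.tendsto_atTop
  have hfatou := Lp.eLpNorm_lim_le_liminf_eLpNorm (p := 4) (μ := μ')
    (f := fun k x => v (ns (ms k)) x - a (ns (ms k)))
    (fun k => ((hv _).continuous.sub continuous_const).aestronglyMeasurable)
    (fun x => u x - a₀) (by
      filter_upwards [ae_mono hμμ' hae] with x hx
      exact (hx.comp hms.tendsto_atTop).sub hlim)
  have hbd : ∀ k, eLpNorm (fun x => v (ns (ms k)) x - a (ns (ms k))) 4 μ' ≤
      C * (S + ε (ns (ms k))) := fun k => (ha4 _).trans (by gcongr; exact hfd _)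
  have hlimC : Tendsto (fun k => C * (S + ε (ns (ms k)))) atTop (𝓝 (C * S)) := by
    have := (tendsto_const_nhds (x := S)).add (hε.comp hsub)
    rw [add_zero] at this
    exact ENNReal.Tendsto.const_mul this (Or.inr hC)
  calc _ ≤ _ := hfatou
    _ ≤ liminf (fun k => C * (S + ε (ns (ms k)))) atTop :=
        liminf_le_liminf (Eventually.of_forall hbd)
    _ = C * S := hlimC.liminf_eq

/-! ### Convergence of products of quaternion-valued functions in `L^p` -/

section Convergence

variable {μ : Measure E4}

/-- Convergence in `L^p`, including membership of all the functions. -/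
def TendstoLp (p : ℝ≥0∞) (μ : Measure E4) (fs : ℕ → E4 → ℍ[ℝ]) (f : E4 → ℍ[ℝ]) : Prop :=
  (∀ n, MemLp (fs n) p μ) ∧ MemLp f p μ ∧ Tendsto (fun n => eLpNorm (fs n - f) p μ) atTop (𝓝 0)

variable {p q r : ℝ≥0∞} {fs gs : ℕ → E4 → ℍ[ℝ]} {f g : E4 → ℍ[ℝ]}

theorem TendstoLp.const [IsFiniteMeasure μ] (c : ℍ[ℝ]) :
    TendstoLp p μ (fun _ _ => c) fun _ => c :=
  ⟨fun _ => memLp_const c, memLp_const c, by simp⟩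

theorem TendstoLp.add (hp : 1 ≤ p) (hf : TendstoLp p μ fs f) (hg : TendstoLp p μ gs g) :
    TendstoLp p μ (fun n x => fs n x + gs n x) fun x => f x + g x := by
  refine ⟨fun n => (hf.1 n).add (hg.1 n), hf.2.1.add hg.2.1, ?_⟩
  refine tendsto_of_tendsto_of_tendsto_of_le_of_le tendsto_const_nhds
    (by simpa using hf.2.2.add hg.2.2) (fun _ => zero_le) fun n => ?_
  refine le_trans (le_of_eq ?_) (eLpNorm_add_le ((hf.1 n).1.sub hf.2.1.1)
    ((hg.1 n).1.sub hg.2.1.1) hp)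
  congr 1; ext1 x; simp only [Pi.sub_apply, Pi.add_apply]; abel

theorem TendstoLp.neg (hf : TendstoLp p μ fs f) :
    TendstoLp p μ (fun n x => -fs n x) fun x => -f x := by
  refine ⟨fun n => (hf.1 n).neg, hf.2.1.neg, hf.2.2.congr fun n => ?_⟩
  rw [← eLpNorm_neg]
  congr 1; ext1 x; simp only [Pi.sub_apply, Pi.neg_apply]; abel

theorem TendstoLp.sub (hp : 1 ≤ p) (hf : TendstoLp p μ fs f) (hg : TendstoLp p μ gs g) :
    TendstoLp p μ (fun n x => fs n x - gs n x) fun x => f x - g x := by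
  simpa only [sub_eq_add_neg] using hf.add hp hg.neg

theorem TendstoLp.mono_exponent [IsFiniteMeasure μ] (hf : TendstoLp q μ fs f) (hpq : p ≤ q) :
    TendstoLp p μ fs f := by
  refine ⟨fun n => (hf.1 n).mono_exponent hpq, hf.2.1.mono_exponent hpq, ?_⟩
  rcases eq_or_ne p 0 with rfl | hp0
  · simp
  have hz := ENNReal.Tendsto.mul_const hf.2.2
    (Or.inr (ENNReal.rpow_ne_top_of_nonneg (y := 1 / p.toReal - 1 / q.toReal) ?_
      (measure_ne_top μ univ)))
  · rw [zero_mul] at hz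
    exact tendsto_of_tendsto_of_tendsto_of_le_of_le tendsto_const_nhds hz (fun _ => zero_le)
      fun n => eLpNorm_le_eLpNorm_mul_rpow_measure_univ hpq ((hf.1 n).1.sub hf.2.1.1)
  · rcases eq_or_ne q ⊤ with rfl | hq
    · simp
    · have := ENNReal.toReal_pos hp0 (hpq.trans_lt (lt_top_iff_ne_top.2 hq)).ne
      rw [sub_nonneg]
      exact one_div_le_one_div_of_le this (ENNReal.toReal_mono hq hpq)

theorem eLpNorm_mul_quaternion_le (hpqr : p.HolderTriple q r) (hf : AEStronglyMeasurable f μ)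
    (hg : AEStronglyMeasurable g μ) :
    eLpNorm (fun x => f x * g x) r μ ≤ eLpNorm f p μ * eLpNorm g q μ := by
  have h := eLpNorm_le_eLpNorm_mul_eLpNorm'_of_norm (p := p) (q := q) (r := r) hf hg
    (fun x y => x * y) 1
    (Eventually.of_forall fun x => by rw [norm_mul, NNReal.coe_one, one_mul])
  rwa [ENNReal.coe_one, one_mul] at h

theorem memLp_mul_quaternion (hpqr : p.HolderTriple q r) (hf : MemLp f p μ) (hg : MemLp g q μ) :
    MemLp (fun x => f x * g x) r μ :=
  ⟨hf.1.mul hg.1, (eLpNorm_mul_quaternion_le hpqr hf.1 hg.1).trans_lt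
    (ENNReal.mul_lt_top hf.2 hg.2)⟩

/-- The difference of products splits as `(fs n - f) gs n + f (gs n - g)`, and Hölder applies to
each part since the quaternion norm is multiplicative. -/
theorem TendstoLp.mul (hr : 1 ≤ r) (hq : 1 ≤ q) (hpqr : p.HolderTriple q r)
    (hf : TendstoLp p μ fs f) (hg : TendstoLp q μ gs g) :
    TendstoLp r μ (fun n x => fs n x * gs n x) fun x => f x * g x := by
  have hlim : Tendsto (fun n => eLpNorm (fs n - f) p μ * (eLpNorm (gs n - g) q μ + eLpNorm g q μ)
      + eLpNorm f p μ * eLpNorm (gs n - g) q μ) atTop (𝓝 0) := by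
    have h0 : Tendsto (fun n => eLpNorm (gs n - g) q μ + eLpNorm g q μ) atTop
        (𝓝 (0 + eLpNorm g q μ)) := hg.2.2.add tendsto_const_nhds
    rw [zero_add] at h0
    have h1 := ENNReal.Tendsto.mul hf.2.2 (Or.inr hg.2.1.2.ne) h0 (Or.inr ENNReal.zero_ne_top)
    have h2 := ENNReal.Tendsto.const_mul hg.2.2 (Or.inr hf.2.1.2.ne)
    have h3 := h1.add h2
    rw [zero_mul, mul_zero, zero_add] at h3
    exact h3
  refine ⟨fun n => memLp_mul_quaternion hpqr (hf.1 n) (hg.1 n),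
    memLp_mul_quaternion hpqr hf.2.1 hg.2.1, ?_⟩
  refine tendsto_of_tendsto_of_tendsto_of_le_of_le tendsto_const_nhds hlim (fun _ => zero_le)
    fun n => ?_
  have hdf := (hf.1 n).1.sub hf.2.1.1
  have hdg := (hg.1 n).1.sub hg.2.1.1
  have e1 : ((fun x => fs n x * gs n x) - fun x => f x * g x) =
      (fun x => (fs n - f) x * gs n x) + fun x => f x * (gs n - g) x := by
    ext1 x; simp only [Pi.sub_apply, Pi.add_apply, sub_mul, mul_sub]; abel
  have e2 : eLpNorm (gs n) q μ ≤ eLpNorm (gs n - g) q μ + eLpNorm g q μ := by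
    have := eLpNorm_add_le hdg hg.2.1.1 hq
    rwa [sub_add_cancel] at this
  have m1 : AEStronglyMeasurable (fun x => (fs n - f) x * gs n x) μ := hdf.mul (hg.1 n).1
  have m2 : AEStronglyMeasurable (fun x => f x * (gs n - g) x) μ := hf.2.1.1.mul hdg
  rw [e1]
  refine (eLpNorm_add_le m1 m2 hr).trans ?_
  exact add_le_add ((eLpNorm_mul_quaternion_le hpqr hdf (hg.1 n).1).trans (mul_le_mul' le_rfl e2))
    (eLpNorm_mul_quaternion_le hpqr hf.2.1.1 hdg)
/-- The real part of a quaternion as a continuous linear map. -/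
def reL : ℍ[ℝ] →L[ℝ] ℝ where
  toFun x := x.re
  map_add' _ _ := rfl
  map_smul' _ _ := rfl
  cont := Quaternion.continuous_re

theorem norm_sq_quaternion (x : ℍ[ℝ]) :
    ‖x‖ ^ 2 = x.re ^ 2 + x.imI ^ 2 + x.imJ ^ 2 + x.imK ^ 2 := by
  rw [sq, ← Quaternion.normSq_eq_norm_mul_self, Quaternion.normSq_def']

theorem norm_re_le_norm (x : ℍ[ℝ]) : ‖x.re‖ ≤ ‖x‖ := by
  refine abs_le_of_sq_le_sq ?_ (norm_nonneg x)
  rw [norm_sq_quaternion]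
  nlinarith [sq_nonneg x.imI, sq_nonneg x.imJ, sq_nonneg x.imK]

theorem TendstoLp.tendsto_integral_mul_re {φ : E4 → ℝ} (hφ : Continuous φ) {C : ℝ}
    (hC : ∀ x, ‖φ x‖ ≤ C) (hf : TendstoLp 1 μ fs f) :
    Tendsto (fun n => ∫ x, φ x * (fs n x).re ∂μ) atTop (𝓝 (∫ x, φ x * (f x).re ∂μ)) := by
  have hint : ∀ {g : E4 → ℍ[ℝ]}, MemLp g 1 μ → Integrable (fun x => φ x * (g x).re) μ := by
    intro g hg
    exact (reL.integrable_comp (memLp_one_iff_integrable.1 hg)).bdd_mul hφ.aestronglyMeasurable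
      (Eventually.of_forall hC)
  refine tendsto_integral_of_L1 _ (hint hf.2.1).1 (Eventually.of_forall fun n => hint (hf.1 n)) ?_
  have hC0 : 0 ≤ C := (norm_nonneg _).trans (hC 0)
  have hz : Tendsto (fun n => ENNReal.ofReal C * eLpNorm (fs n - f) 1 μ) atTop (𝓝 0) := by
    have := ENNReal.Tendsto.const_mul hf.2.2 (a := ENNReal.ofReal C) (Or.inr ENNReal.ofReal_ne_top)
    rwa [mul_zero] at this
  refine tendsto_of_tendsto_of_tendsto_of_le_of_le tendsto_const_nhds hz (fun _ => zero_le)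
    fun n => ?_
  rw [eLpNorm_one_eq_lintegral_enorm, ← lintegral_const_mul' _ _ ENNReal.ofReal_ne_top]
  refine lintegral_mono fun x => ?_
  have h1 : ‖φ x * (fs n x).re - φ x * (f x).re‖ ≤ C * ‖(fs n - f) x‖ := by
    rw [← mul_sub, norm_mul, ← Quaternion.re_sub]
    gcongr
    · exact hC x
    · exact norm_re_le_norm _
  rw [← ofReal_norm, ← ofReal_norm, ← ENNReal.ofReal_mul hC0]
  exact ENNReal.ofReal_le_ofReal h1

end Convergence

/-! ### The transgression formula for `F ∧ F` -/

section ChernSimons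

/-- The curvature components of a connection with value `A` and derivatives `d i j = ∂ᵢAⱼ`. -/
def curvH (A : Fin 4 → ℍ[ℝ]) (d : Fin 4 → Fin 4 → ℍ[ℝ]) (i j : Fin 4) : ℍ[ℝ] :=
  d i j - d j i + (A i * A j - A j * A i)

/-- The density of `F ∧ F`, up to a factor `2`. -/
def wedgeSq (F : Fin 4 → Fin 4 → ℍ[ℝ]) : ℍ[ℝ] :=
  F 0 1 * F 2 3 - F 0 2 * F 1 3 + F 0 3 * F 1 2

/-- Components of a 3-form with the same real part as `b ∧ F - b ∧ b ∧ b / 3`. -/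
def transgression (b : Fin 4 → ℍ[ℝ]) (F : Fin 4 → Fin 4 → ℍ[ℝ]) (i j k : Fin 4) : ℍ[ℝ] :=
  b i * F j k + b j * F k i + b k * F i j - b i * (b j * b k - b k * b j)

/-- The derivative of `curvH` in direction `l`, where `h l i j = ∂ₗ∂ᵢAⱼ`. -/
def curvHDeriv (A : Fin 4 → ℍ[ℝ]) (d : Fin 4 → Fin 4 → ℍ[ℝ]) (h : Fin 4 → Fin 4 → Fin 4 → ℍ[ℝ])
    (l i j : Fin 4) : ℍ[ℝ] :=
  h l i j - h l j i + ((d l i * A j + A i * d l j) - (d l j * A i + A j * d l i))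

/-- The derivative of `transgression` in direction `l`. -/
def transgressionDeriv (b : Fin 4 → ℍ[ℝ]) (d : Fin 4 → Fin 4 → ℍ[ℝ]) (F : Fin 4 → Fin 4 → ℍ[ℝ])
    (F' : Fin 4 → Fin 4 → Fin 4 → ℍ[ℝ]) (l i j k : Fin 4) : ℍ[ℝ] :=
  d l i * F j k + b i * F' l j k + (d l j * F k i + b j * F' l k i) +
    (d l k * F i j + b k * F' l i j) - (d l i * (b j * b k - b k * b j) +
    b i * ((d l j * b k + b j * d l k) - (d l k * b j + b k * d l j)))

-- The background `a` takes values in one real line, so `[aᵢ, aⱼ] = 0` and `a` is flat; this is what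
-- makes `F ∧ F` the derivative of the relative Chern-Simons form. By `hs` the second derivatives
-- cancel in the alternating sum, as in the Bianchi identity, and the real part serves as a cyclic
-- trace. The `2` on the left counts the six terms of `F ∧ F` of which `wedgeSq` keeps three. In
-- components all of this is a polynomial identity.
set_option maxHeartbeats 4000000 in
theorem two_mul_re_wedgeSq (a b : Fin 4 → ℍ[ℝ]) (d : Fin 4 → Fin 4 → ℍ[ℝ])
    (h : Fin 4 → Fin 4 → Fin 4 → ℍ[ℝ]) (hs : ∀ l i j, h l i j = h i l j) (ξ : ℍ[ℝ]) (c : Fin 4 → ℝ)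
    (ha : ∀ i, a i = c i • ξ) :
    2 * (wedgeSq (curvH (fun i => a i + b i) d)).re =
      (transgressionDeriv b d (curvH (fun i => a i + b i) d)
        (curvHDeriv (fun i => a i + b i) d h) 0 1 2 3).re
      - (transgressionDeriv b d (curvH (fun i => a i + b i) d)
        (curvHDeriv (fun i => a i + b i) d h) 1 0 2 3).re
      + (transgressionDeriv b d (curvH (fun i => a i + b i) d)
        (curvHDeriv (fun i => a i + b i) d h) 2 0 1 3).re
      - (transgressionDeriv b d (curvH (fun i => a i + b i) d)
        (curvHDeriv (fun i => a i + b i) d h) 3 0 1 2).re := by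
  simp only [wedgeSq, transgressionDeriv, curvH, curvHDeriv, hs 1 0, hs 2 0, hs 3 0, hs 2 1, hs 3 1,
    hs 3 2, ha]
  generalize ξ = y, b 0 = b0, b 1 = b1, b 2 = b2, b 3 = b3
  generalize c 0 = c0, c 1 = c1, c 2 = c2, c 3 = c3
  generalize d 0 0 = d00, d 0 1 = d01, d 0 2 = d02, d 0 3 = d03
  generalize d 1 0 = d10, d 1 1 = d11, d 1 2 = d12, d 1 3 = d13
  generalize d 2 0 = d20, d 2 1 = d21, d 2 2 = d22, d 2 3 = d23
  generalize d 3 0 = d30, d 3 1 = d31, d 3 2 = d32, d 3 3 = d33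
  simp only [Quaternion.re_mul, Quaternion.imI_mul, Quaternion.imJ_mul, Quaternion.imK_mul,
    Quaternion.re_add, Quaternion.imI_add, Quaternion.imJ_add, Quaternion.imK_add,
    Quaternion.re_sub, Quaternion.imI_sub, Quaternion.imJ_sub, Quaternion.imK_sub,
    Quaternion.re_smul, Quaternion.imI_smul, Quaternion.imJ_smul, Quaternion.imK_smul, smul_eq_mul]
  ring

theorem hasDerivAt_line {F : Type*} [NormedAddCommGroup F] [NormedSpace ℝ F] {f : E4 → F}
    (hf : ContDiff ℝ 1 f) (x v : E4) :
    HasDerivAt (fun t : ℝ => f (x + t • v)) (fderiv ℝ f x v) 0 :=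
  ((hf.differentiable one_ne_zero x).hasFDerivAt.hasLineDerivAt v)

/-- The curvature field of the connection `a + b`, where `d i j` stands for `∂ᵢbⱼ`. -/
def curvField (a : Fin 4 → ℍ[ℝ]) (b : Fin 4 → E4 → ℍ[ℝ]) (d : Fin 4 → Fin 4 → E4 → ℍ[ℝ]) (x : E4) :
    Fin 4 → Fin 4 → ℍ[ℝ] :=
  curvH (fun i => a i + b i x) fun i j => d i j x

/-- The transgression field of the connection `a + b`, where `d i j` stands for `∂ᵢbⱼ`. -/
def transField (a : Fin 4 → ℍ[ℝ]) (b : Fin 4 → E4 → ℍ[ℝ]) (d : Fin 4 → Fin 4 → E4 → ℍ[ℝ])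
    (i j k : Fin 4) (x : E4) : ℍ[ℝ] :=
  transgression (fun i => b i x) (curvField a b d x) i j k

variable {a : Fin 4 → ℍ[ℝ]} {b : Fin 4 → E4 → ℍ[ℝ]} {d : Fin 4 → Fin 4 → E4 → ℍ[ℝ]}

theorem contDiff_curvField (hb : ∀ j, ContDiff ℝ 1 (b j)) (hd : ∀ i j, ContDiff ℝ 1 (d i j))
    (i j : Fin 4) : ContDiff ℝ 1 fun x => curvField a b d x i j := by
  unfold curvField curvH
  fun_prop

theorem contDiff_transField (hb : ∀ j, ContDiff ℝ 1 (b j)) (hd : ∀ i j, ContDiff ℝ 1 (d i j))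
    (i j k : Fin 4) : ContDiff ℝ 1 (transField a b d i j k) := by
  have := contDiff_curvField (a := a) hb hd
  unfold transField transgression
  fun_prop

theorem fderiv_transField (hb : ∀ j, ContDiff ℝ 1 (b j)) (hd : ∀ i j, ContDiff ℝ 1 (d i j))
    (hbd : ∀ i j x, fderiv ℝ (b j) x (e i) = d i j x) (i j k l : Fin 4) (x : E4) :
    fderiv ℝ (transField a b d i j k) x (e l) =
      transgressionDeriv (fun i => b i x) (fun i j => d i j x) (curvField a b d x)
        (curvHDeriv (fun i => a i + b i x) (fun i j => d i j x)
          fun l i j => fderiv ℝ (d i j) x (e l)) l i j k := by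
  have Db : ∀ j, HasDerivAt (fun t : ℝ => b j (x + t • e l)) (d l j x) 0 := fun j => by
    rw [← hbd l j x]; exact hasDerivAt_line (hb j) x (e l)
  have DA : ∀ j, HasDerivAt (fun t : ℝ => a j + b j (x + t • e l)) (d l j x) 0 := fun j =>
    (Db j).const_add _
  have Dd : ∀ i j, HasDerivAt (fun t : ℝ => d i j (x + t • e l)) (fderiv ℝ (d i j) x (e l)) 0 :=
    fun i j => hasDerivAt_line (hd i j) x (e l)
  have DF : ∀ i j, HasDerivAt (fun t : ℝ => curvField a b d (x + t • e l) i j)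
      (curvHDeriv (fun i => a i + b i x) (fun i j => d i j x)
          (fun l i j => fderiv ℝ (d i j) x (e l)) l i j) 0 := fun i j => by
    have := ((Dd i j).sub (Dd j i)).add (((DA i).mul (DA j)).sub ((DA j).mul (DA i)))
    simp only [zero_smul, add_zero] at this
    exact this
  have DT := (((((Db i).mul (DF j k)).add ((Db j).mul (DF k i))).add ((Db k).mul (DF i j))).sub
    ((Db i).mul (((Db j).mul (Db k)).sub ((Db k).mul (Db j)))))
  simp only [zero_smul, add_zero, Pi.sub_apply, Pi.mul_apply] at DT
  exact (hasDerivAt_line (contDiff_transField hb hd i j k) x (e l)).unique DT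

theorem integral_mul_re_fderiv {f : E4 → ℍ[ℝ]} (hf : ContDiff ℝ 1 f) {φ : E4 → ℝ}
    (hφ : ContDiff ℝ ∞ φ) (hc : HasCompactSupport φ) (l : Fin 4) :
    Integrable (fun x => φ x * (fderiv ℝ f x (e l)).re) volume ∧
    ∫ x, φ x * (fderiv ℝ f x (e l)).re = - ∫ x, fderiv ℝ φ x (e l) * (f x).re := by
  set g : E4 → ℝ := fun x => (f x).re
  have hg : ContDiff ℝ 1 g := reL.contDiff.comp hf
  have hgd : ∀ x, fderiv ℝ g x (e l) = (fderiv ℝ f x (e l)).re := fun x => by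
    have := (reL.hasFDerivAt (x := f x)).comp x (hf.differentiable one_ne_zero x).hasFDerivAt
    rw [show fderiv ℝ g x = _ from this.fderiv]; rfl
  simp only [← hgd]
  have hgc : Continuous fun x => fderiv ℝ g x (e l) :=
    (hg.continuous_fderiv one_ne_zero).clm_apply continuous_const
  have hφd := contDiff_fderiv_apply hφ (e l)
  have hφdc := hasCompactSupport_fderiv_apply hc (e l)
  have i1 : Integrable (fun x => fderiv ℝ φ x (e l) * g x) volume :=
    (hφd.continuous.mul hg.continuous).integrable_of_hasCompactSupport hφdc.mul_right
  have i2 : Integrable (fun x => φ x * fderiv ℝ g x (e l)) volume :=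
    (hφ.continuous.mul hgc).integrable_of_hasCompactSupport hc.mul_right
  have i3 : Integrable (fun x => φ x * g x) volume :=
    (hφ.continuous.mul hg.continuous).integrable_of_hasCompactSupport hc.mul_right
  exact ⟨i2, integral_mul_fderiv_eq_neg_fderiv_mul_of_integrable i1 i2 i3
    (fun x _ => hφ.differentiable (by simp) x) (fun x _ => hg.differentiable one_ne_zero x)⟩

theorem integral_sub_add_sub {μ : Measure E4} {f₀ f₁ f₂ f₃ : E4 → ℝ} (h₀ : Integrable f₀ μ)
    (h₁ : Integrable f₁ μ) (h₂ : Integrable f₂ μ) (h₃ : Integrable f₃ μ) :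
    ∫ x, (f₀ x - f₁ x + f₂ x - f₃ x) ∂μ =
      ∫ x, f₀ x ∂μ - ∫ x, f₁ x ∂μ + ∫ x, f₂ x ∂μ - ∫ x, f₃ x ∂μ := by
  have e1 := integral_sub ((h₀.sub h₁).add h₂) h₃
  have e2 := integral_add (h₀.sub h₁) h₂
  have e3 := integral_sub h₀ h₁
  simp only [Pi.sub_apply, Pi.add_apply] at e1 e2 e3
  rw [e1, e2, e3]

/-- The transgression formula for smooth connections. -/
theorem integral_wedgeSq_of_contDiff (hb : ∀ j, ContDiff ℝ ∞ (b j))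
    (hbd : ∀ i j x, fderiv ℝ (b j) x (e i) = d i j x) {ξ : ℍ[ℝ]} {c : Fin 4 → ℝ}
    (ha : ∀ i, a i = c i • ξ) {φ : E4 → ℝ} (hφ : ContDiff ℝ ∞ φ) (hc : HasCompactSupport φ) :
    2 * ∫ x, φ x * (wedgeSq (curvField a b d x)).re =
      - (∫ x, fderiv ℝ φ x (e 0) * (transField a b d 1 2 3 x).re)
      + (∫ x, fderiv ℝ φ x (e 1) * (transField a b d 0 2 3 x).re)
      - (∫ x, fderiv ℝ φ x (e 2) * (transField a b d 0 1 3 x).re)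
      + ∫ x, fderiv ℝ φ x (e 3) * (transField a b d 0 1 2 x).re := by
  have hdd : ∀ i j, d i j = fun x => fderiv ℝ (b j) x (e i) := fun i j => by
    ext1 x; exact (hbd i j x).symm
  have hd : ∀ i j, ContDiff ℝ ∞ (d i j) := fun i j => by
    rw [hdd]; exact contDiff_fderiv_apply (hb j) (e i)
  have hb1 : ∀ j, ContDiff ℝ 1 (b j) := fun j => (hb j).of_le (by simp)
  have hd1 : ∀ i j, ContDiff ℝ 1 (d i j) := fun i j => (hd i j).of_le (by simp)
  have hsym : ∀ x l i j, fderiv ℝ (d i j) x (e l) = fderiv ℝ (d l j) x (e i) := by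
    intro x l i j
    have hs := ((hb j).contDiffAt (x := x)).isSymmSndFDerivAt (by
      rw [minSmoothness_of_isRCLikeNormedField]; exact ENat.LEInfty.out)
    have hd2 : DifferentiableAt ℝ (fderiv ℝ (b j)) x :=
      ((hb j).fderiv_right (m := ∞) (by simp)).differentiable (by simp) x
    have : ∀ i l, fderiv ℝ (d i j) x (e l) = fderiv ℝ (fderiv ℝ (b j)) x (e l) (e i) := by
      intro i l
      rw [hdd i j, fderiv_clm_apply hd2 (differentiableAt_const _)]
      simp
    rw [this, this]
    exact hs.eq (e l) (e i)
  have T := fun i j k => contDiff_transField (a := a) hb1 hd1 i j k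
  obtain ⟨i0, e0⟩ := integral_mul_re_fderiv (T 1 2 3) hφ hc 0
  obtain ⟨i1, e1⟩ := integral_mul_re_fderiv (T 0 2 3) hφ hc 1
  obtain ⟨i2, e2⟩ := integral_mul_re_fderiv (T 0 1 3) hφ hc 2
  obtain ⟨i3, e3⟩ := integral_mul_re_fderiv (T 0 1 2) hφ hc 3
  have key : ∫ x, 2 * (φ x * (wedgeSq (curvField a b d x)).re) =
      ∫ x, (φ x * (fderiv ℝ (transField a b d 1 2 3) x (e 0)).re
        - φ x * (fderiv ℝ (transField a b d 0 2 3) x (e 1)).re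
        + φ x * (fderiv ℝ (transField a b d 0 1 3) x (e 2)).re
        - φ x * (fderiv ℝ (transField a b d 0 1 2) x (e 3)).re) := by
    refine integral_congr_ae (Eventually.of_forall fun x => ?_)
    have h := two_mul_re_wedgeSq a (fun i => b i x) (fun i j => d i j x)
      (fun l i j => fderiv ℝ (d i j) x (e l)) (hsym x) ξ c ha
    simp only [fderiv_transField hb1 hd1 hbd]
    simp only [curvField] at *
    linear_combination φ x * h
  rw [integral_const_mul] at key
  rw [key, integral_sub_add_sub i0 i1 i2 i3, e0, e1, e2, e3]
  ring

theorem memLp_ball_of_continuous {F : Type*} [NormedAddCommGroup F] {f : E4 → F}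
    (hf : Continuous f) (p : ℝ≥0∞) (r : ℝ) : MemLp f p (volume.restrict (Metric.ball 0 r)) := by
  obtain ⟨C, hC⟩ := (isCompact_closedBall (0 : E4) r).exists_bound_of_continuousOn hf.continuousOn
  have : IsFiniteMeasure ((volume : Measure E4).restrict (Metric.ball 0 r)) :=
    ⟨by rw [Measure.restrict_apply_univ]; exact measure_ball_lt_top⟩
  refine MemLp.of_bound hf.aestronglyMeasurable C ?_
  filter_upwards [ae_restrict_mem Metric.isOpen_ball.measurableSet] with x hx
  exact hC x (Metric.ball_subset_closedBall hx)

theorem holderTriple_four_four_two : (4 : ℝ≥0∞).HolderTriple 4 2 := by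
  refine ENNReal.HolderTriple.of_toReal ⟨?_, ?_, ?_⟩ <;> norm_num

theorem tendstoLp_mul_two {μ : Measure E4} {fs gs : ℕ → E4 → ℍ[ℝ]} {f g : E4 → ℍ[ℝ]}
    (hf : TendstoLp 2 μ fs f) (hg : TendstoLp 2 μ gs g) :
    TendstoLp 1 μ (fun n x => fs n x * gs n x) fun x => f x * g x :=
  hf.mul le_rfl (by norm_num) inferInstance hg

section Limits

variable {μ : Measure E4} [IsFiniteMeasure μ] {bs : ℕ → Fin 4 → E4 → ℍ[ℝ]}
  {ds : ℕ → Fin 4 → Fin 4 → E4 → ℍ[ℝ]}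

/-- Since `L⁴ · L⁴ ⊆ L²`, the quadratic part of the curvature is as good as its derivative part. For
the same reason `F ∧ F`, `b ∧ F` and `b ∧ b ∧ b` pass to the limit in `L¹` below. -/
theorem tendstoLp_curvField (hb : ∀ j, TendstoLp 4 μ (fun n => bs n j) (b j))
    (hd : ∀ i j, TendstoLp 2 μ (fun n => ds n i j) (d i j)) (i j : Fin 4) :
    TendstoLp 2 μ (fun n x => curvField a (bs n) (ds n) x i j) fun x => curvField a b d x i j := by
  have hA : ∀ j, TendstoLp 4 μ (fun n x => a j + bs n j x) fun x => a j + b j x := fun j =>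
    (TendstoLp.const (a j)).add (by norm_num) (hb j)
  have hAA : ∀ i j, TendstoLp 2 μ (fun n x => (a i + bs n i x) * (a j + bs n j x))
      fun x => (a i + b i x) * (a j + b j x) := fun i j =>
    (hA i).mul (by norm_num) (by norm_num) holderTriple_four_four_two (hA j)
  exact ((hd i j).sub (by norm_num) (hd j i)).add (by norm_num)
    ((hAA i j).sub (by norm_num) (hAA j i))

theorem tendstoLp_wedgeSq (hb : ∀ j, TendstoLp 4 μ (fun n => bs n j) (b j))
    (hd : ∀ i j, TendstoLp 2 μ (fun n => ds n i j) (d i j)) :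
    TendstoLp 1 μ (fun n x => wedgeSq (curvField a (bs n) (ds n) x))
      fun x => wedgeSq (curvField a b d x) := by
  have hF := tendstoLp_curvField (a := a) hb hd
  exact ((tendstoLp_mul_two (hF 0 1) (hF 2 3)).sub le_rfl (tendstoLp_mul_two (hF 0 2) (hF 1 3))).add
    le_rfl (tendstoLp_mul_two (hF 0 3) (hF 1 2))

theorem tendstoLp_transField (hb : ∀ j, TendstoLp 4 μ (fun n => bs n j) (b j))
    (hd : ∀ i j, TendstoLp 2 μ (fun n => ds n i j) (d i j)) (i j k : Fin 4) :
    TendstoLp 1 μ (fun n => transField a (bs n) (ds n) i j k) (transField a b d i j k) := by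
  have hF := tendstoLp_curvField (a := a) hb hd
  have hb2 : ∀ j, TendstoLp 2 μ (fun n => bs n j) (b j) := fun j =>
    (hb j).mono_exponent (by norm_num)
  have hbb : ∀ i j, TendstoLp 2 μ (fun n x => bs n i x * bs n j x) fun x => b i x * b j x :=
    fun i j => (hb i).mul (by norm_num) (by norm_num) holderTriple_four_four_two (hb j)
  exact (((tendstoLp_mul_two (hb2 i) (hF j k)).add le_rfl
    (tendstoLp_mul_two (hb2 j) (hF k i))).add le_rfl (tendstoLp_mul_two (hb2 k) (hF i j))).sub le_rfl
    (tendstoLp_mul_two (hb2 i) ((hbb j k).sub (by norm_num) (hbb k j)))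

end Limits

/-- The transgression formula for connections with `L⁴` coefficients and `L²` derivatives. -/
theorem integral_wedgeSq_of_hasWeakPartial {r R : ℝ} (hr : r < R) (hR : R ≤ 1)
    (hb : ∀ j, MemLp (b j) 4 (volume.restrict (Metric.ball 0 R)))
    (hd : ∀ i j, MemLp (d i j) 2 (volume.restrict (Metric.ball 0 R)))
    (hw : ∀ i j, HasWeakPartial i (b j) (d i j)) {ξ : ℍ[ℝ]} {c : Fin 4 → ℝ}
    (ha : ∀ i, a i = c i • ξ) {φ : E4 → ℝ} (hφ : ContDiff ℝ ∞ φ) (hc : HasCompactSupport φ)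
    (hs : tsupport φ ⊆ Metric.ball 0 r) :
    2 * ∫ x in Metric.ball 0 r, φ x * (wedgeSq (curvField a b d x)).re =
      - (∫ x in Metric.ball 0 r, fderiv ℝ φ x (e 0) * (transField a b d 1 2 3 x).re)
      + (∫ x in Metric.ball 0 r, fderiv ℝ φ x (e 1) * (transField a b d 0 2 3 x).re)
      - (∫ x in Metric.ball 0 r, fderiv ℝ φ x (e 2) * (transField a b d 0 1 3 x).re)
      + ∫ x in Metric.ball 0 r, fderiv ℝ φ x (e 3) * (transField a b d 0 1 2 x).re := by
  set μ := (volume : Measure E4).restrict (Metric.ball 0 r)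
  have : IsFiniteMeasure μ :=
    ⟨by rw [Measure.restrict_apply_univ]; exact measure_ball_lt_top⟩
  have hμ : μ ≤ volume.restrict (Metric.ball 0 R) :=
    Measure.restrict_mono (Metric.ball_subset_ball hr.le) le_rfl
  have hbl : ∀ j, LocallyIntegrable (indicator (Metric.ball 0 R) (b j)) volume := fun j =>
    (memLp_indicator_ball (hb j)).locallyIntegrable (by norm_num)
  set bs : ℕ → Fin 4 → E4 → ℍ[ℝ] := fun n j => moll n (indicator (Metric.ball 0 R) (b j))
  set ds : ℕ → Fin 4 → Fin 4 → E4 → ℍ[ℝ] := fun n i j x => fderiv ℝ (bs n j) x (e i)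
  have hbs : ∀ n j, ContDiff ℝ ∞ (bs n j) := fun n j => contDiff_moll n (hbl j)
  have tb : ∀ j, TendstoLp 4 μ (fun n => bs n j) (b j) := fun j =>
    ⟨fun n => memLp_ball_of_continuous (hbs n j).continuous _ _, (hb j).mono_measure hμ,
      tendsto_eLpNorm_moll_indicator_sub (by norm_num) (by norm_num) hr.le (hb j)⟩
  have td : ∀ i j, TendstoLp 2 μ (fun n => ds n i j) (d i j) := fun i j =>
    ⟨fun n => memLp_ball_of_continuous (contDiff_fderiv_apply (hbs n j) _).continuous _ _,
      (hd i j).mono_measure hμ, tendsto_eLpNorm_fderiv_moll_indicator_sub (by norm_num)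
        (by norm_num) (hw i j) hr hR (hbl j) (hd i j)⟩
  obtain ⟨C, hC⟩ := hφ.continuous.bounded_above_of_compact_support hc
  have hds : ∀ l, Continuous fun x => fderiv ℝ φ x (e l) := fun l =>
    (contDiff_fderiv_apply hφ (e l)).continuous
  choose D hD using fun l => (hds l).bounded_above_of_compact_support
    (hasCompactSupport_fderiv_apply hc (e l))
  have lim0 := (tendstoLp_wedgeSq (a := a) tb td).tendsto_integral_mul_re hφ.continuous hC
  have limT := fun l i j k =>
    (tendstoLp_transField (a := a) tb td i j k).tendsto_integral_mul_re (hds l) (hD l)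
  have hset : ∀ (ψ : E4 → ℝ) (g : E4 → ℝ), tsupport ψ ⊆ Metric.ball 0 r →
      ∫ x, ψ x * g x ∂μ = ∫ x, ψ x * g x := fun ψ g hψ => by
    simpa only [smul_eq_mul] using setIntegral_eq_of_tsupport_subset hψ g
  have hsl : ∀ l, tsupport (fun x => fderiv ℝ φ x (e l)) ⊆ Metric.ball 0 r := fun l =>
    (tsupport_fderiv_apply_subset φ (e l)).trans hs
  -- Both sides of the smooth formula for the mollified coefficients converge, and the background
  -- `a` is left unmollified, so it remains abelian.
  refine tendsto_nhds_unique (lim0.const_mul 2) (Tendsto.congr (fun n => ?_)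
    ((((limT 0 1 2 3).neg.add (limT 1 0 2 3)).sub (limT 2 0 1 3)).add (limT 3 0 1 2)))
  rw [hset _ _ hs, hset _ _ (hsl 0), hset _ _ (hsl 1), hset _ _ (hsl 2), hset _ _ (hsl 3)]
  exact (integral_wedgeSq_of_contDiff (hbs n) (fun _ _ _ => rfl) ha hφ hc).symm

end ChernSimons

/-! ### Reduction to an abelian constant background -/

section Core

/-- The commutator of imaginary quaternions is twice their cross product, so this is Lagrange's
identity. -/
theorem norm_sq_commutator_quaternion {x y : ℍ[ℝ]} (hx : x.re = 0) (hy : y.re = 0) :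
    ‖x * y - y * x‖ ^ 2 =
      4 * (‖x‖ ^ 2 * ‖y‖ ^ 2 - (x.imI * y.imI + x.imJ * y.imJ + x.imK * y.imK) ^ 2) := by
  simp only [norm_sq_quaternion, Quaternion.re_sub, Quaternion.imI_sub, Quaternion.imJ_sub,
    Quaternion.imK_sub, Quaternion.re_mul, Quaternion.imI_mul, Quaternion.imJ_mul,
    Quaternion.imK_mul, hx, hy]
  ring

/-- The left side is the distance from `y` to the line `ℝ x`, which equals `‖[x, y]‖ / (2 ‖x‖)`; and
`1 + ‖x‖ ≤ 2 ‖x‖`. -/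
theorem norm_sub_smul_le_of_commutator {x y : ℍ[ℝ]} (hx : x.re = 0) (hy : y.re = 0)
    (hx1 : 1 ≤ ‖x‖) {K : ℝ} (hK : 0 ≤ K) (h : ‖x * y - y * x‖ ≤ K * (1 + ‖x‖)) :
    ‖y - ((x.imI * y.imI + x.imJ * y.imJ + x.imK * y.imK) / ‖x‖ ^ 2) • x‖ ≤ K := by
  set p := x.imI * y.imI + x.imJ * y.imJ + x.imK * y.imK with hp
  set s := ‖x‖ with hs
  have hs2 : s ^ 2 = x.re ^ 2 + x.imI ^ 2 + x.imJ ^ 2 + x.imK ^ 2 := norm_sq_quaternion x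
  have hs0 : 0 < s := by linarith
  refine abs_le_of_sq_le_sq' (b := K) ?_ hK |>.2
  have h1 : ‖y - (p / s ^ 2) • x‖ ^ 2 * (4 * s ^ 2) = ‖x * y - y * x‖ ^ 2 := by
    rw [norm_sq_commutator_quaternion hx hy, ← hs, ← hp]
    have h2 : ∀ k : ℝ, ‖y - k • x‖ ^ 2 = ‖y‖ ^ 2 - 2 * k * p + k ^ 2 * s ^ 2 := fun k => by
      rw [norm_sq_quaternion, norm_sq_quaternion y, hs2]
      simp only [Quaternion.re_sub, Quaternion.imI_sub, Quaternion.imJ_sub,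
        Quaternion.imK_sub, Quaternion.re_smul, Quaternion.imI_smul, Quaternion.imJ_smul,
        Quaternion.imK_smul, smul_eq_mul, hx, hy]
      rw [hp]; ring
    rw [h2]; field_simp; ring
  have h3 : ‖x * y - y * x‖ ^ 2 ≤ K ^ 2 * (4 * s ^ 2) := by
    calc _ ≤ (K * (1 + s)) ^ 2 := by gcongr
      _ ≤ (K * (2 * s)) ^ 2 := by gcongr; linarith
      _ = _ := by ring
  rw [← h1] at h3
  exact le_of_mul_le_mul_right h3 (by positivity)

/-- Almost commuting imaginary quaternions are close to a common line. -/
theorem exists_smul_approx {a : Fin 4 → ℍ[ℝ]} (hre : ∀ i, (a i).re = 0) {K : ℝ} (hK : 0 ≤ K)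
    (h : ∀ m, (∀ k, ‖a k‖ ≤ ‖a m‖) → ∀ i, ‖a m * a i - a i * a m‖ ≤ K * (1 + ‖a m‖)) :
    ∃ (ξ : ℍ[ℝ]) (c : Fin 4 → ℝ), ∀ i, ‖a i - c i • ξ‖ ≤ max 1 K := by
  obtain ⟨m, -, hm⟩ := Finset.exists_max_image Finset.univ (fun k => ‖a k‖) Finset.univ_nonempty
  have hm' : ∀ k, ‖a k‖ ≤ ‖a m‖ := fun k => hm k (Finset.mem_univ k)
  -- If the longest vector has length at most `1`, all of them are near `0` and `ξ = 0` serves.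
  -- Otherwise its own direction is taken as the line.
  rcases le_total ‖a m‖ 1 with h1 | h1
  · exact ⟨0, 0, fun i => by simpa using Or.inl ((hm' i).trans h1)⟩
  · exact ⟨a m, _, fun i => (norm_sub_smul_le_of_commutator (hre m) (hre i) h1 hK
      (h m hm' i)).trans (le_max_right _ _)⟩

theorem norm_sub_im_le {x y : ℍ[ℝ]} (hx : x.re = 0) : ‖x - y.im‖ ≤ ‖x - y‖ := by
  refine (abs_le_of_sq_le_sq' ?_ (norm_nonneg _)).2
  rw [norm_sq_quaternion, norm_sq_quaternion]
  simp [hx, sq_nonneg]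

/-- A connection with bounded Dirichlet and curvature energy is `L⁴`-close to a constant abelian
connection. -/
theorem exists_smul_eLpNorm_four_le {M C₀ : ℝ≥0∞} (hM : M ≠ ⊤) (hC₀ : C₀ ≠ ⊤) :
    ∃ K : ℝ≥0∞, K ≠ ⊤ ∧ ∀ (B : Fin 4 → E4 → ℍ[ℝ]) (d : Fin 4 → Fin 4 → E4 → ℍ[ℝ]),
      (∀ i j, HasWeakPartial i (B j) (d i j)) → (∀ j, MemLp (B j) 2 (volume.restrict B4)) →
      (∀ j, ∀ᵐ x ∂(volume.restrict B4), (B j x).re = 0) →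
      (∀ i j, MemLp (d i j) 2 (volume.restrict B4)) →
      (∀ i j, eLpNorm (d i j) 2 (volume.restrict B4) ≤ M) →
      (∀ i j, eLpNorm (fun x => curvH (fun i => B i x) (fun i j => d i j x) i j) 2
        (volume.restrict B4) ≤ C₀) →
      ∃ (ξ : ℍ[ℝ]) (c : Fin 4 → ℝ), ∀ j,
        eLpNorm (fun x => B j x - c j • ξ) 4 (volume.restrict (Metric.ball 0 (1 / 2))) ≤ K := by
  obtain ⟨C, hC, hSob⟩ := exists_eLpNorm_four_sub_le_of_hasWeakPartial ℍ[ℝ]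
  set μ := (volume : Measure E4).restrict (Metric.ball 0 (1 / 2)) with hμdef
  have hμB : μ ≤ volume.restrict B4 :=
    Measure.restrict_mono (Metric.ball_subset_ball (by norm_num)) le_rfl
  have hμuniv : μ univ = volume (Metric.ball (0 : E4) (1 / 2)) := Measure.restrict_apply_univ _
  have hμpos : μ univ ≠ 0 := by
    rw [hμuniv]; exact (Metric.measure_ball_pos volume _ (by norm_num)).ne'
  have hμfin : IsFiniteMeasure μ := ⟨by rw [hμuniv]; exact measure_ball_lt_top⟩
  have hμ0 : μ ≠ 0 := fun h => hμpos (by simp [h])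
  have hμt : μ univ ≠ ⊤ := measure_ne_top _ _
  set V : ℝ≥0∞ := μ univ ^ (1 / (2 : ℝ≥0∞).toReal)
  have hV0 : V ≠ 0 := (ENNReal.rpow_pos (pos_iff_ne_zero.2 hμpos) hμt).ne'
  have hVt : V ≠ ⊤ := ENNReal.rpow_ne_top_of_nonneg (by positivity) hμt
  set W : ℝ≥0∞ := μ univ ^ (1 / (2 : ℝ≥0∞).toReal - 1 / (4 : ℝ≥0∞).toReal)
  have hWt : W ≠ ⊤ := ENNReal.rpow_ne_top_of_nonneg (by norm_num) hμt
  set X : ℝ≥0∞ := μ univ ^ (1 / (4 : ℝ≥0∞).toReal)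
  have hXt : X ≠ ⊤ := ENNReal.rpow_ne_top_of_nonneg (by norm_num) hμt
  set K₁ : ℝ≥0∞ := C * (4 * M)
  -- This comes from solving `F = dB + [B, B]`, with `B = a + b`, for `[aₘ, aᵢ]` and taking `L²`
  -- norms. The curvature gives `C₀`, the derivatives `2M`, the term `[b, b]` gives `2K₁²`, and the
  -- mixed terms give `4 ‖aₘ‖ W K₁`, with `W` the embedding constant of `L⁴` in `L²`. Dividing by
  -- `V`, the `L²` norm of the constant `1`, turns this into a bound on the constant commutator.
  set K₂ : ℝ≥0∞ := (C₀ + 2 * M + 2 * K₁ ^ 2 + 4 * (W * K₁)) / V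
  have hK₂ : K₂ ≠ ⊤ := ENNReal.div_ne_top (by finiteness) hV0
  set K₃ : ℝ := max 1 K₂.toReal
  refine ⟨K₁ + ENNReal.ofReal K₃ * X, by finiteness, fun B d hw hB hre hd2 hdM hF => ?_⟩
  choose a₀ ha₀ using fun j => hSob (B j) (fun i => d i j) (fun i => hw i j) (hB j)
    fun i => hd2 i j
  -- As `B` is imaginary almost everywhere, projecting the Sobolev constants to their imaginary
  -- parts does not increase the distance to `B`, and it makes the cross product picture available.
  set a : Fin 4 → ℍ[ℝ] := fun j => (a₀ j).im
  have hare : ∀ j, (a j).re = 0 := fun j => Quaternion.re_im _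
  set b : Fin 4 → E4 → ℍ[ℝ] := fun j x => B j x - a j
  have hbm : ∀ j, AEStronglyMeasurable (b j) μ := fun j =>
    (((hB j).mono_measure hμB).1).sub aestronglyMeasurable_const
  have hb4 : ∀ j, eLpNorm (b j) 4 μ ≤ K₁ := fun j => by
    calc _ ≤ eLpNorm (fun x => B j x - a₀ j) 4 μ := by
          refine eLpNorm_mono_ae ?_
          filter_upwards [ae_mono hμB (hre j)] with x hx using norm_sub_im_le hx
      _ ≤ C * ∑ i, eLpNorm (d i j) 2 (volume.restrict B4) := ha₀ j
      _ ≤ C * ∑ _i : Fin 4, M := by gcongr with i; exact hdM i j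
      _ = K₁ := by simp [K₁]
  have hb2 : ∀ j, eLpNorm (b j) 2 μ ≤ W * K₁ := fun j => by
    refine (eLpNorm_le_eLpNorm_mul_rpow_measure_univ (q := 4) (by norm_num) (hbm j)).trans ?_
    rw [mul_comm]
    gcongr; exact hb4 j
  have hcomm : ∀ m, (∀ k, ‖a k‖ ≤ ‖a m‖) → ∀ i,
      ‖a m * a i - a i * a m‖ ≤ K₂.toReal * (1 + ‖a m‖) := by
    intro m hm i
    set F := fun x => curvH (fun i => B i x) (fun i j => d i j x) m i
    have hFm : AEStronglyMeasurable F μ := by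
      have hBm := fun j => ((hB j).mono_measure hμB).1
      have hdm := fun i j => ((hd2 i j).mono_measure hμB).1
      exact ((hdm m i).sub (hdm i m)).add (((hBm m).mul (hBm i)).sub ((hBm i).mul (hBm m)))
    have hF2 : eLpNorm F 2 μ ≤ C₀ := (eLpNorm_mono_measure _ hμB).trans (hF m i)
    have hd2' : ∀ i j, eLpNorm (d i j) 2 μ ≤ M := fun i j =>
      (eLpNorm_mono_measure _ hμB).trans (hdM i j)
    have hdm := fun i j => ((hd2 i j).mono_measure hμB).1
    set s : ℝ := ‖a m‖
    -- the pointwise bound for the commutator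
    have hpt : ∀ x, ‖a m * a i - a i * a m‖ ≤ ‖F x‖ + ‖d m i x‖ + ‖d i m x‖ + 2 * ‖b m x * b i x‖
        + 2 * s * ‖b i x‖ + 2 * s * ‖b m x‖ := by
      intro x
      have e1 : a m * a i - a i * a m = F x - d m i x + d i m x - (b m x * b i x - b i x * b m x)
          - (a m * b i x - b i x * a m) - (b m x * a i - a i * b m x) := by
        simp only [F, curvH, b]; noncomm_ring
      have hc : ∀ u v : ℍ[ℝ], ‖u * v - v * u‖ ≤ 2 * (‖u‖ * ‖v‖) := fun u v => by
        refine (norm_sub_le _ _).trans ?_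
        rw [norm_mul, norm_mul]; linarith
      have t1 := norm_sub_le (F x - d m i x + d i m x - (b m x * b i x - b i x * b m x)
          - (a m * b i x - b i x * a m)) (b m x * a i - a i * b m x)
      have t2 := norm_sub_le (F x - d m i x + d i m x - (b m x * b i x - b i x * b m x))
        (a m * b i x - b i x * a m)
      have t3 := norm_sub_le (F x - d m i x + d i m x) (b m x * b i x - b i x * b m x)
      have t4 := norm_add_le (F x - d m i x) (d i m x)
      have t5 := norm_sub_le (F x) (d m i x)
      have c1 := hc (b m x) (b i x)
      have c2 := hc (a m) (b i x)
      have c3 := hc (b m x) (a i)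
      have c4 : ‖b m x‖ * ‖a i‖ ≤ ‖b m x‖ * s := by gcongr; exact hm i
      rw [e1, norm_mul]
      linarith
    have hs0 : 0 ≤ s := norm_nonneg _
    set S : ℝ≥0∞ := ENNReal.ofReal s
    have hN : ∀ {u : E4 → ℍ[ℝ]}, AEStronglyMeasurable u μ →
        AEStronglyMeasurable (fun x => ‖u x‖) μ := fun hu => hu.norm
    have hbb : eLpNorm (fun x => b m x * b i x) 2 μ ≤ K₁ ^ 2 := by
      rw [sq]
      exact (eLpNorm_mul_quaternion_le holderTriple_four_four_two (hbm m) (hbm i)).trans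
        (mul_le_mul' (hb4 m) (hb4 i))
    have hbbm : AEStronglyMeasurable (fun x => b m x * b i x) μ := (hbm m).mul (hbm i)
    have hnorm : ∀ (t : ℝ), 0 ≤ t → ∀ (u : E4 → ℍ[ℝ]),
        eLpNorm (fun x => t * ‖u x‖) 2 μ ≤ ENNReal.ofReal t * eLpNorm u 2 μ := fun t ht u => by
      refine (eLpNorm_const_smul_le (c := t) (f := fun x => ‖u x‖)).trans ?_
      rw [eLpNorm_norm, Real.enorm_of_nonneg ht]
    have htot : ‖a m * a i - a i * a m‖ₑ * V ≤
        C₀ + M + M + 2 * K₁ ^ 2 + 2 * S * (W * K₁) + 2 * S * (W * K₁) := by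
      calc _ = eLpNorm (fun _ : E4 => a m * a i - a i * a m) 2 μ :=
            (eLpNorm_const _ (by norm_num) hμ0).symm
        _ ≤ eLpNorm ((((((fun x => ‖F x‖) + fun x => ‖d m i x‖) + fun x => ‖d i m x‖) +
            fun x => 2 * ‖b m x * b i x‖) + fun x => 2 * s * ‖b i x‖) + fun x => 2 * s * ‖b m x‖)
            2 μ := eLpNorm_mono fun x => (hpt x).trans (le_abs_self _)
        _ ≤ _ := by
            have m1 := hN hFm
            have m2 := m1.add (hN (hdm m i))
            have m3 := m2.add (hN (hdm i m))
            have m4 := m3.add ((hN hbbm).const_mul 2)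
            have m5 := m4.add ((hN (hbm i)).const_mul (2 * s))
            have h2S : ENNReal.ofReal (2 * s) = 2 * S := by
              rw [ENNReal.ofReal_mul (by norm_num), ENNReal.ofReal_ofNat]
            refine (eLpNorm_add_le m5 ((hN (hbm m)).const_mul (2 * s)) (by norm_num)).trans ?_
            refine add_le_add ((eLpNorm_add_le m4 ((hN (hbm i)).const_mul (2 * s))
              (by norm_num)).trans ?_) ?_
            · refine add_le_add ((eLpNorm_add_le m3 ((hN hbbm).const_mul 2)
                (by norm_num)).trans ?_) ?_
              · refine add_le_add ((eLpNorm_add_le m2 (hN (hdm i m)) (by norm_num)).trans ?_) ?_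
                · refine add_le_add ((eLpNorm_add_le m1 (hN (hdm m i)) (by norm_num)).trans ?_) ?_
                  · refine add_le_add ?_ ?_
                    · rw [eLpNorm_norm]; exact hF2
                    · rw [eLpNorm_norm]; exact hd2' m i
                  · rw [eLpNorm_norm]; exact hd2' i m
                · refine (hnorm 2 (by norm_num) _).trans ?_
                  rw [ENNReal.ofReal_ofNat]
                  gcongr
              · refine (hnorm (2 * s) (by positivity) _).trans ?_
                rw [h2S]; gcongr; exact hb2 i
            · refine (hnorm (2 * s) (by positivity) _).trans ?_
              rw [h2S]; gcongr; exact hb2 m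
    have hle : ‖a m * a i - a i * a m‖ₑ ≤ K₂ * (1 + S) := by
      rw [show K₂ * (1 + S) = (C₀ + 2 * M + 2 * K₁ ^ 2 + 4 * (W * K₁)) * (1 + S) / V by
        simp only [K₂, div_eq_mul_inv]; ring]
      refine (ENNReal.le_div_iff_mul_le (Or.inl hV0) (Or.inl hVt)).2 (htot.trans ?_)
      calc C₀ + M + M + 2 * K₁ ^ 2 + 2 * S * (W * K₁) + 2 * S * (W * K₁)
          = (C₀ + 2 * M + 2 * K₁ ^ 2) + 4 * (W * K₁) * S := by ring
        _ ≤ (C₀ + 2 * M + 2 * K₁ ^ 2) + 4 * (W * K₁) * S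
            + ((C₀ + 2 * M + 2 * K₁ ^ 2) * S + 4 * (W * K₁)) := le_self_add
        _ = _ := by ring
    have := ENNReal.toReal_mono (by finiteness) hle
    rwa [toReal_enorm, ENNReal.toReal_mul, ENNReal.toReal_add (by simp) (by simp [S]),
      ENNReal.toReal_one, ENNReal.toReal_ofReal hs0] at this
  obtain ⟨ξ, c, hξ⟩ := exists_smul_approx hare ENNReal.toReal_nonneg hcomm
  refine ⟨ξ, c, fun j => ?_⟩
  calc eLpNorm (fun x => B j x - c j • ξ) 4 μ
      = eLpNorm (b j + fun _ => a j - c j • ξ) 4 μ := by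
        congr 1; ext1 x; simp [b]
    _ ≤ eLpNorm (b j) 4 μ + eLpNorm (fun _ : E4 => a j - c j • ξ) 4 μ :=
        eLpNorm_add_le (hbm j) aestronglyMeasurable_const (by norm_num)
    _ ≤ K₁ + ENNReal.ofReal K₃ * X := by
        rw [eLpNorm_const _ (by norm_num) hμ0]
        gcongr
        · exact hb4 j
        · rw [← ofReal_norm]; exact ENNReal.ofReal_le_ofReal (hξ j)

end Core

/-! ### Cutoffs, choice of an annulus and boundary estimates -/

section Concentration

/-- The closed annulus with radii `r` and `2r`. -/
def annulus (r : ℝ) : Set E4 := {x | r ≤ ‖x‖ ∧ ‖x‖ ≤ 2 * r}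

theorem measurableSet_annulus (r : ℝ) : MeasurableSet (annulus r) :=
  ((isClosed_le continuous_const continuous_norm).inter
    (isClosed_le continuous_norm continuous_const)).measurableSet

/-- Cutoff functions at all scales with scale invariant gradient bounds. -/
theorem exists_cutoff : ∃ D : ℝ, 0 ≤ D ∧ ∀ r : ℝ, 0 < r → ∃ φ : E4 → ℝ, ContDiff ℝ ∞ φ ∧
    tsupport φ ⊆ Metric.closedBall 0 (2 * r) ∧ (∀ x, 0 ≤ φ x) ∧ (∀ x, φ x ≤ 1) ∧
    (∀ x, ‖x‖ ≤ r → φ x = 1) ∧ (∀ x l, |fderiv ℝ φ x (e l)| ≤ D / r) ∧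
    ∀ x, x ∉ annulus r → fderiv ℝ φ x = 0 := by
  let ψ : ContDiffBump (0 : E4) := ⟨1, 2, one_pos, one_lt_two⟩
  have hψ : ContDiff ℝ ∞ ψ := ψ.contDiff (n := (⊤ : ℕ∞))
  obtain ⟨D, hD⟩ := (hψ.continuous_fderiv (by simp)).bounded_above_of_compact_support
    (ψ.hasCompactSupport.fderiv ℝ)
  have hD0 : 0 ≤ D := (norm_nonneg _).trans (hD 0)
  refine ⟨D, hD0, fun r hr => ?_⟩
  have hr' : 0 < r⁻¹ := inv_pos.2 hr
  set φ : E4 → ℝ := fun x => ψ (r⁻¹ • x)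
  have hn : ∀ x : E4, ‖r⁻¹ • x‖ = ‖x‖ / r := fun x => by
    rw [norm_smul, Real.norm_of_nonneg hr'.le]; ring
  have h1 : ∀ x, ‖x‖ ≤ r → φ x = 1 := fun x hx => ψ.one_of_mem_closedBall (by
    rw [mem_closedBall_zero_iff, hn]; exact (div_le_one hr).2 hx)
  have h0 : ∀ x, 2 * r ≤ ‖x‖ → φ x = 0 := fun x hx => ψ.zero_of_le_dist (by
    rw [dist_zero_right, hn]; exact (le_div_iff₀ hr).2 hx)
  have hder : ∀ x, HasFDerivAt φ ((fderiv ℝ ψ (r⁻¹ • x)).comp (r⁻¹ • ContinuousLinearMap.id ℝ E4)) x :=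
    fun x => (hψ.differentiable (by simp) _).hasFDerivAt.comp x ((hasFDerivAt_id x).const_smul r⁻¹)
  refine ⟨φ, hψ.comp (contDiff_const_smul _), ?_, fun x => ψ.nonneg, fun x => ψ.le_one, h1,
    fun x l => ?_, fun x hx => ?_⟩
  · refine closure_minimal (fun x hx => ?_) Metric.isClosed_closedBall
    rw [mem_closedBall_zero_iff]
    by_contra h
    exact hx (h0 x (not_le.1 h).le)
  · rw [(hder x).fderiv]
    have : ‖e l‖ = 1 := by simp [e]
    calc _ = ‖r⁻¹ • fderiv ℝ ψ (r⁻¹ • x) (e l)‖ := by simp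
      _ ≤ r⁻¹ * (‖fderiv ℝ ψ (r⁻¹ • x)‖ * ‖e l‖) := by
        rw [norm_smul, Real.norm_of_nonneg hr'.le]
        gcongr
        exact ContinuousLinearMap.le_opNorm _ _
      _ ≤ r⁻¹ * (D * 1) := by rw [this]; gcongr; exact hD _
      _ = D / r := by ring
  · have hx' : ‖x‖ < r ∨ 2 * r < ‖x‖ := by
      by_contra h
      push Not at h
      exact hx h
    rcases hx' with h | h
    · have hev : φ =ᶠ[𝓝 x] fun _ => 1 := by
        filter_upwards [(isOpen_lt continuous_norm continuous_const).mem_nhds h] with y hy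
        exact h1 y (le_of_lt hy)
      rw [hev.fderiv_eq]; simp
    · have hev : φ =ᶠ[𝓝 x] fun _ => 0 := by
        filter_upwards [(isOpen_lt continuous_const continuous_norm).mem_nhds h] with y hy
        exact h0 y (le_of_lt hy)
      rw [hev.fderiv_eq]; simp

/-- Among `N` disjoint annuli, one carries at most the average of an integral. -/
theorem exists_annulus_lintegral_le {f : E4 → ℝ≥0∞} {K : ℝ≥0∞}
    (hf : ∫⁻ x in Metric.ball (0 : E4) (1 / 2), f x ≤ K) {N : ℕ} (hN : 0 < N) :
    ∃ n < N, ∫⁻ x in annulus ((1 / 4) ^ (n + 2)), f x ≤ K / N := by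
  by_contra! h
  -- Successive radii differ by a factor `4` but each annulus has ratio `2`, which gives
  -- disjointness; the largest outer radius is `1 / 8`.
  have hdisj : (↑(Finset.range N) : Set ℕ).PairwiseDisjoint
      fun n => annulus ((1 / 4) ^ (n + 2)) := by
    have key : ∀ m n : ℕ, m < n → Disjoint (annulus ((1 / 4) ^ (m + 2)))
        (annulus ((1 / 4) ^ (n + 2))) := by
      intro m n hmn
      refine Set.disjoint_left.2 fun x hx hx' => ?_
      have h1 : ((1 : ℝ) / 4) ^ (n + 2) ≤ (1 / 4) ^ (m + 2 + 1) :=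
        pow_le_pow_of_le_one (by norm_num) (by norm_num) (by omega)
      have h2 := hx.1
      have h3 := hx'.2
      have h4 : (0 : ℝ) < (1 / 4) ^ (m + 2) := by positivity
      rw [pow_succ _ (m + 2)] at h1
      linarith
    intro m _ n _ hmn
    rcases lt_or_gt_of_ne hmn with h | h
    · exact key m n h
    · exact (key n m h).symm
  have hsum := lintegral_biUnion_finset (μ := volume) hdisj
    (fun n _ => measurableSet_annulus _) f
  have hsub : (⋃ n ∈ Finset.range N, annulus ((1 / 4) ^ (n + 2))) ⊆ Metric.ball 0 (1 / 2) := by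
    refine iUnion₂_subset fun n _ x hx => mem_ball_zero_iff.2 (hx.2.trans_lt ?_)
    have : ((1 : ℝ) / 4) ^ (n + 2) ≤ (1 / 4) ^ 2 :=
      pow_le_pow_of_le_one (by norm_num) (by norm_num) (by omega)
    linarith
  have hle := (lintegral_mono_set (μ := volume) (f := f) hsub).trans hf
  rw [hsum] at hle
  have hlt : ∑ n ∈ Finset.range N, K / N < ∑ n ∈ Finset.range N,
      ∫⁻ x in annulus ((1 / 4) ^ (n + 2)), f x := by
    refine ENNReal.sum_lt_sum_of_nonempty (Finset.nonempty_range_iff.2 hN.ne') fun n hn => ?_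
    exact h n (Finset.mem_range.1 hn)
  rw [Finset.sum_const, Finset.card_range, nsmul_eq_mul,
    ENNReal.mul_div_cancel (by exact_mod_cast hN.ne') (by simp)] at hlt
  exact absurd hle (not_le.2 hlt)

theorem norm_transgression_le {b : Fin 4 → ℍ[ℝ]} {F : Fin 4 → Fin 4 → ℍ[ℝ]} {δ β : ℝ}
    (hF : ∀ i j, ‖F i j‖ ≤ δ) (hb : ∀ j, ‖b j‖ ≤ β) (i j k : Fin 4) :
    ‖transgression b F i j k‖ ≤ 3 * (β * δ) + 2 * β ^ 3 := by
  have hβ : 0 ≤ β := (norm_nonneg _).trans (hb 0)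
  have h1 : ∀ m i j, ‖b m * F i j‖ ≤ β * δ := fun m i j => by
    rw [norm_mul]; exact mul_le_mul (hb m) (hF i j) (norm_nonneg _) hβ
  have h2 : ∀ j k, ‖b j * b k‖ ≤ β * β := fun j k => by
    rw [norm_mul]; exact mul_le_mul (hb j) (hb k) (norm_nonneg _) hβ
  have h3 : ‖b i * (b j * b k - b k * b j)‖ ≤ β * (β * β + β * β) := by
    rw [norm_mul]
    exact mul_le_mul (hb i) ((norm_sub_le _ _).trans (add_le_add (h2 j k) (h2 k j)))
      (norm_nonneg _) hβ
  unfold transgression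
  have t1 := norm_sub_le (b i * F j k + b j * F k i + b k * F i j) (b i * (b j * b k - b k * b j))
  have t2 := norm_add_le (b i * F j k + b j * F k i) (b k * F i j)
  have t3 := norm_add_le (b i * F j k) (b j * F k i)
  have := h1 i j k
  have := h1 j k i
  have := h1 k i j
  nlinarith

/-- The two cases are `s β ≥ 1` and `s β ≤ 1`. With `s` proportional to the radius `r`, integration
over an annulus of volume of order `r⁴` and division by `r` make both contributions scale invariant.
-/
theorem cube_le_mul_add {β s : ℝ} (hβ : 0 ≤ β) (hs : 0 < s) :
    β ^ 3 ≤ s * β ^ 4 + (s ^ 3)⁻¹ := by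
  rcases le_total 1 (s * β) with h | h
  · have h1 : β ^ 3 ≤ s * β ^ 4 := by
      calc β ^ 3 = 1 * β ^ 3 := (one_mul _).symm
        _ ≤ (s * β) * β ^ 3 := by gcongr
        _ = _ := by ring
    have : 0 < (s ^ 3)⁻¹ := by positivity
    linarith
  · have h1 : β ^ 3 ≤ (s ^ 3)⁻¹ := by
      rw [← one_div, le_div_iff₀ (by positivity), ← mul_pow, mul_comm]
      exact pow_le_one₀ (by positivity) h
    have : 0 ≤ s * β ^ 4 := by positivity
    linarith

/-- A crude bound suffices for the term linear in `b`: its coefficient is the size of the curvature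
on the annulus, which tends to `0` as `l → ∞`. -/
theorem le_one_add_pow_four {β : ℝ} : β ≤ 1 + β ^ 4 := by
  nlinarith [sq_nonneg (β ^ 2 - 1), sq_nonneg (β - 1)]

/-- The curvature density of the instanton. -/
def bubble (l : ℝ) (x : E4) : ℝ := l ^ 2 / (1 + l ^ 2 * ‖x‖ ^ 2) ^ 2

theorem volume_real_ball {r : ℝ} (hr : 0 ≤ r) :
    (volume (Metric.ball (0 : E4) r)).toReal = r ^ 4 * (volume (Metric.ball (0 : E4) 1)).toReal := by
  rw [Measure.addHaar_ball _ _ hr, ENNReal.toReal_mul, finrank_euclideanSpace, Fintype.card_fin,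
    ENNReal.toReal_ofReal (by positivity)]

variable {b : Fin 4 → E4 → ℍ[ℝ]}

/-- The boundary term of the transgression formula at scale `r`. -/
theorem abs_integral_fderiv_mul_re_le {T : E4 → ℍ[ℝ]} {φ : E4 → ℝ} {r D δ s : ℝ} (hr : 0 < r)
    (hr' : r ≤ 1 / 16) (hD : 0 ≤ D) (hδ : 0 ≤ δ) (hs : 0 < s)
    (hφ : ∀ x l, |fderiv ℝ φ x (e l)| ≤ D / r) (hφ' : ∀ x, x ∉ annulus r → fderiv ℝ φ x = 0)
    {β : E4 → ℝ} (hβ0 : ∀ x, 0 ≤ β x)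
    (hβ : IntegrableOn (fun x => β x ^ 4) (Metric.ball 0 (1 / 4)))
    (hT : ∀ᵐ x ∂(volume.restrict (Metric.ball (0 : E4) (1 / 4))), x ∈ annulus r →
      ‖T x‖ ≤ 3 * (β x * δ) + 2 * β x ^ 3) (l : Fin 4) :
    |∫ x in Metric.ball 0 (1 / 4), fderiv ℝ φ x (e l) * (T x).re| ≤
      D / r * ((3 * δ + 2 * (s ^ 3)⁻¹) * (16 * r ^ 4 * (volume (Metric.ball (0 : E4) 1)).toReal)
        + (3 * δ + 2 * s) * ∫ x in annulus r, β x ^ 4) := by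
  set g : E4 → ℝ := indicator (annulus r) fun x =>
    D / r * ((3 * δ + 2 * (s ^ 3)⁻¹) + (3 * δ + 2 * s) * β x ^ 4)
  have hsub : annulus r ⊆ Metric.ball 0 (1 / 4) := fun x hx => by
    rw [mem_ball_zero_iff]; linarith [hx.2]
  have hfin : volume (annulus r) ≠ ⊤ := ((measure_mono hsub).trans_lt measure_ball_lt_top).ne
  have hβA : IntegrableOn (fun x => β x ^ 4) (annulus r) := hβ.mono_set hsub
  have hcA : Integrable (fun _ : E4 => 3 * δ + 2 * (s ^ 3)⁻¹) (volume.restrict (annulus r)) :=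
    integrableOn_const hfin
  have hgA : IntegrableOn (fun x => D / r * ((3 * δ + 2 * (s ^ 3)⁻¹) + (3 * δ + 2 * s) * β x ^ 4))
      (annulus r) := by
    refine Integrable.const_mul (Integrable.add ?_ (hβA.const_mul _)) _
    exact integrableOn_const hfin
  have hg : Integrable g (volume.restrict (Metric.ball 0 (1 / 4))) :=
    ((integrable_indicator_iff (measurableSet_annulus r)).2 hgA).restrict
  have hDr : 0 ≤ D / r := by positivity
  have hfg : ∀ᵐ x ∂(volume.restrict (Metric.ball (0 : E4) (1 / 4))),
      ‖fderiv ℝ φ x (e l) * (T x).re‖ ≤ g x := by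
    filter_upwards [hT] with x hx
    by_cases hxA : x ∈ annulus r
    · simp only [g, indicator_of_mem hxA]
      rw [norm_mul]
      refine mul_le_mul (hφ x l) ((norm_re_le_norm _).trans ((hx hxA).trans ?_)) (norm_nonneg _) hDr
      have h1 := cube_le_mul_add (hβ0 x) hs
      have h2 : β x * δ ≤ (1 + β x ^ 4) * δ := by gcongr; exact le_one_add_pow_four
      linarith
    · simp [g, hxA, hφ' x hxA]
  refine (norm_integral_le_of_norm_le hg hfg).trans ?_
  have hvol : (volume (annulus r)).toReal ≤
        16 * r ^ 4 * (volume (Metric.ball (0 : E4) 1)).toReal := by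
      have h1 : volume (annulus r) ≤ volume (Metric.closedBall (0 : E4) (2 * r)) :=
        measure_mono fun x hx => mem_closedBall_zero_iff.2 hx.2
      rw [Measure.addHaar_closedBall_eq_addHaar_ball] at h1
      have h2 := ENNReal.toReal_mono measure_ball_lt_top.ne h1
      rw [volume_real_ball (by positivity)] at h2
      calc _ ≤ _ := h2
        _ = _ := by ring
  rw [setIntegral_indicator (measurableSet_annulus r), inter_eq_right.2 hsub, integral_const_mul,
    integral_add hcA (hβA.const_mul _), integral_const_mul,
    setIntegral_const, smul_eq_mul, mul_comm (volume.real _)]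
  gcongr
  exact hvol

end Concentration

/-! ### Concentrated curvature contradicts bounded Dirichlet energy -/

section Core

theorem bubble_nonneg (l : ℝ) (x : E4) : 0 ≤ bubble l x := by unfold bubble; positivity

theorem continuous_bubble (l : ℝ) : Continuous (bubble l) := by
  unfold bubble
  refine continuous_const.div (by fun_prop) fun x => ?_
  positivity

/-- The curvature density concentrates at least a fixed amount of energy at the origin. -/
theorem le_integral_mul_bubble_sq {l r : ℝ} (hl : 0 < l) (hr : 1 / l ≤ r) (hr' : r ≤ 1 / 4)
    {φ : E4 → ℝ} (hφ : Continuous φ) (hφ0 : ∀ x, 0 ≤ φ x) (hφ1 : ∀ x, ‖x‖ ≤ r → φ x = 1) :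
    (volume (Metric.ball (0 : E4) 1)).toReal / 16 ≤
      ∫ x in Metric.ball 0 (1 / 4), φ x * bubble l x ^ 2 := by
  have hl' : 0 < 1 / l := by positivity
  have hsub : Metric.ball (0 : E4) (1 / l) ⊆ Metric.ball 0 (1 / 4) :=
    Metric.ball_subset_ball (hr.trans hr')
  have hint : IntegrableOn (fun x => φ x * bubble l x ^ 2) (Metric.ball 0 (1 / 4)) :=
    memLp_one_iff_integrable.1 (memLp_ball_of_continuous (hφ.mul ((continuous_bubble l).pow 2)) 1 _)
  -- On the ball of radius `1 / l` the bubble is at least `l² / 4`, and this ball has volume `l⁻⁴`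
  -- times that of the unit ball, so the powers of `l` cancel.
  calc (volume (Metric.ball (0 : E4) 1)).toReal / 16
      = ∫ _ in Metric.ball (0 : E4) (1 / l), l ^ 4 / 16 := by
        rw [setIntegral_const, smul_eq_mul, Measure.real, volume_real_ball hl'.le]
        field_simp
    _ ≤ ∫ x in Metric.ball (0 : E4) (1 / l), φ x * bubble l x ^ 2 := by
        refine setIntegral_mono_on (integrableOn_const measure_ball_lt_top.ne)
          (hint.mono_set hsub) Metric.isOpen_ball.measurableSet fun x hx => ?_
        have hx' := mem_ball_zero_iff.1 hx
        rw [hφ1 x (hx'.le.trans hr), one_mul]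
        have h1 : l ^ 2 * ‖x‖ ^ 2 ≤ 1 := by
          rw [← mul_pow]
          refine pow_le_one₀ (by positivity) ?_
          rw [lt_div_iff₀ hl] at hx'
          linarith
        have h2 : l ^ 2 / 4 ≤ bubble l x := by
          unfold bubble
          gcongr
          have : 0 ≤ l ^ 2 * ‖x‖ ^ 2 := by positivity
          nlinarith
        calc l ^ 4 / 16 = (l ^ 2 / 4) ^ 2 := by ring
          _ ≤ _ := by gcongr
    _ ≤ _ := setIntegral_mono_set hint (Eventually.of_forall fun x => mul_nonneg (hφ0 x)
          (sq_nonneg _)) (Eventually.of_forall hsub)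

theorem bubble_le {l r : ℝ} (hl : 0 < l) (hr : 0 < r) {x : E4} (hx : r ≤ ‖x‖) :
    bubble l x ≤ 1 / (l ^ 2 * r ^ 4) := by
  unfold bubble
  calc l ^ 2 / (1 + l ^ 2 * ‖x‖ ^ 2) ^ 2 ≤ l ^ 2 / (l ^ 2 * r ^ 2) ^ 2 := by
        gcongr
        nlinarith [mul_le_mul_of_nonneg_left (pow_le_pow_left₀ hr.le hx 2) (sq_nonneg l)]
    _ = _ := by field_simp

theorem sum_norm_pow_four_integrable {b : Fin 4 → E4 → ℍ[ℝ]} {K : ℝ≥0∞} (hK : K ≠ ⊤) {μ : Measure E4}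
    (hb : ∀ j, AEStronglyMeasurable (b j) μ) (hb4 : ∀ j, eLpNorm (b j) 4 μ ≤ K) :
    Integrable (fun x => (∑ j, ‖b j x‖) ^ 4) μ ∧
      ∫⁻ x, ENNReal.ofReal ((∑ j, ‖b j x‖) ^ 4) ∂μ ≤ (4 * K) ^ 4 := by
  have hm : AEStronglyMeasurable (fun x => (∑ j, ‖b j x‖)) μ :=
    Finset.aestronglyMeasurable_fun_sum _ fun j _ => (hb j).norm
  have h1 : eLpNorm (fun x => ∑ j, ‖b j x‖) 4 μ ≤ 4 * K := by
    calc _ = eLpNorm (∑ j, fun x => ‖b j x‖) 4 μ := by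
          congr 1
      _ ≤ ∑ j, eLpNorm (fun x => ‖b j x‖) 4 μ :=
          eLpNorm_sum_le (fun j _ => (hb j).norm) (by norm_num)
      _ ≤ ∑ _j : Fin 4, K := by
          refine Finset.sum_le_sum fun j _ => ?_
          rw [eLpNorm_norm]; exact hb4 j
      _ = 4 * K := by simp
  have h2 : ∫⁻ x, ENNReal.ofReal ((∑ j, ‖b j x‖) ^ 4) ∂μ ≤ (4 * K) ^ 4 := by
    calc _ = ∫⁻ x, ‖∑ j, ‖b j x‖‖ₑ ^ 4 ∂μ := by
          refine lintegral_congr fun x => ?_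
          have : 0 ≤ ∑ j, ‖b j x‖ := Finset.sum_nonneg fun _ _ => norm_nonneg _
          rw [ENNReal.ofReal_pow this, Real.enorm_of_nonneg this]
      _ = (eLpNorm (fun x => ∑ j, ‖b j x‖) 4 μ) ^ 4 := by
          rw [eLpNorm_eq_lintegral_rpow_enorm_toReal (by norm_num) (by norm_num)]
          simp only [ENNReal.toReal_ofNat, ENNReal.rpow_ofNat]
          rw [← ENNReal.rpow_natCast, ← ENNReal.rpow_mul]
          norm_num
      _ ≤ _ := by gcongr
  refine ⟨⟨hm.pow 4, ?_⟩, h2⟩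
  rw [hasFiniteIntegral_iff_ofReal (Eventually.of_forall fun x => by positivity)]
  exact h2.trans_lt (by finiteness)

/-- A connection with the curvature of a concentrated instanton has large Dirichlet energy. -/
theorem exists_forall_not_eLpNorm_le {M C₀ : ℝ≥0∞} (hM : M ≠ ⊤) (hC₀ : C₀ ≠ ⊤) :
    ∃ L : ℝ, ∀ l : ℝ, L ≤ l → ∀ (B : Fin 4 → E4 → ℍ[ℝ]) (d : Fin 4 → Fin 4 → E4 → ℍ[ℝ]),
      (∀ i j, HasWeakPartial i (B j) (d i j)) → (∀ j, MemLp (B j) 2 (volume.restrict B4)) →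
      (∀ j, ∀ᵐ x ∂(volume.restrict B4), (B j x).re = 0) →
      (∀ i j, MemLp (d i j) 2 (volume.restrict B4)) →
      (∀ i j, eLpNorm (fun x => curvH (fun i => B i x) (fun i j => d i j x) i j) 2
        (volume.restrict B4) ≤ C₀) →
      (∀ i j, ∀ᵐ x ∂(volume.restrict B4),
        ‖curvH (fun i => B i x) (fun i j => d i j x) i j‖ ≤ 2 * bubble l x) →
      (∀ᵐ x ∂(volume.restrict B4),
        (wedgeSq (curvH (fun i => B i x) fun i j => d i j x)).re = -(12 * bubble l x ^ 2)) →
      ¬ ∀ i j, eLpNorm (d i j) 2 (volume.restrict B4) ≤ M := by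
  obtain ⟨K, hK, hKB⟩ := exists_smul_eLpNorm_four_le hM hC₀
  obtain ⟨D, hD, hcut⟩ := exists_cutoff
  set v₀ := (volume (Metric.ball (0 : E4) 1)).toReal
  have hv0 : 0 < v₀ := ENNReal.toReal_pos (Metric.measure_ball_pos volume _ one_pos).ne'
    measure_ball_lt_top.ne
  set K' : ℝ := ((4 * K) ^ 4).toReal
  have hK'0 : 0 ≤ K' := ENNReal.toReal_nonneg
  -- With `s = t r`, the boundary terms contribute `128 D t⁻³ v₀` independently of `r`; since `t³ ≥
  -- t ≥ 512 D`, this is at most `v₀ / 4`.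
  set t : ℝ := 1 + 512 * D
  have ht1 : 1 ≤ t := by simp only [t]; linarith
  have ht : 128 * D * (t ^ 3)⁻¹ ≤ 1 / 4 := by
    have : t ≤ t ^ 3 := le_self_pow₀ ht1 (by norm_num)
    rw [← div_eq_mul_inv, div_le_div_iff₀ (by positivity) (by norm_num)]
    simp only [t] at *
    linarith
  -- Enough annuli that the best one carries at most `K' / N` of the `L⁴` mass, making `8 D t κ` at
  -- most `v₀ / 4`.
  obtain ⟨N, hN⟩ := exists_nat_gt (32 * D * t * K' / v₀)
  have hN0 : 0 < N := by
    have : 0 ≤ 32 * D * t * K' / v₀ := by positivity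
    exact_mod_cast this.trans_lt hN
  have hNr : (0 : ℝ) < N := by exact_mod_cast hN0
  rw [div_lt_iff₀ hv0] at hN
  -- The annulus chosen later depends on `B`, but its inner radius is always at least `ρ`. This
  -- allows the threshold `L` to be fixed before `B` is given.
  set ρ : ℝ := (1 / 4) ^ (N + 2)
  have hρ : 0 < ρ := by positivity
  set G : ℝ := 4 * D * (3 * (16 * v₀ + K' / ρ))
  have hG : 0 ≤ G := by positivity
  have hlim : Tendsto (fun l : ℝ => G * (2 * (1 / (l ^ 2 * ρ ^ 4)))) atTop (𝓝 0) := by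
    have h1 : Tendsto (fun l : ℝ => l ^ 2 * ρ ^ 4) atTop atTop :=
      (tendsto_pow_atTop (by norm_num)).atTop_mul_const (by positivity)
    have h2 := ((tendsto_inv_atTop_zero.comp h1).const_mul 2).const_mul G
    simpa using h2
  -- Beyond `L` the curvature contribution `G δ` is below `v₀ / 4`, and `1 / l ≤ ρ` puts the core of
  -- the bubble where the cutoff equals `1`.
  obtain ⟨L, hL⟩ := eventually_atTop.1 ((hlim.eventually (gt_mem_nhds (show (0 : ℝ) < v₀ / 4 by
    positivity))).and (eventually_ge_atTop (1 / ρ)))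
  refine ⟨L, fun l hl B d hw hB hre hd2 hF hFb hQ hdM => ?_⟩
  obtain ⟨hl1, hl2⟩ := hL l hl
  have hl0 : 0 < l := lt_of_lt_of_le (by positivity) hl2
  obtain ⟨ξ, c, hb4⟩ := hKB B d hw hB hre hd2 hdM hF
  set b : Fin 4 → E4 → ℍ[ℝ] := fun j x => B j x - c j • ξ
  set a : Fin 4 → ℍ[ℝ] := fun j => c j • ξ
  have hcurv : ∀ x, curvField a b d x = curvH (fun i => B i x) fun i j => d i j x := fun x => by
    simp only [curvField, a, b, add_sub_cancel]
  have hmeas : ∀ {ρ : ℝ}, ρ ≤ 1 → (volume : Measure E4).restrict (Metric.ball 0 ρ) ≤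
      volume.restrict B4 := fun h => Measure.restrict_mono (Metric.ball_subset_ball h) le_rfl
  have hbm : ∀ j, AEStronglyMeasurable (b j) (volume.restrict (Metric.ball 0 (1 / 2))) := fun j =>
    ((hB j).mono_measure (hmeas (by norm_num))).1.sub aestronglyMeasurable_const
  have hbmem : ∀ j, MemLp (b j) 4 (volume.restrict (Metric.ball 0 (1 / 2))) := fun j =>
    ⟨hbm j, (hb4 j).trans_lt hK.lt_top⟩
  have hbw : ∀ i j, HasWeakPartial i (b j) (d i j) := fun i j => by
    have := (hw i j).add (hasWeakPartial_of_contDiff (f := fun _ => -(c j • ξ)) contDiff_const)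
    simpa [b, sub_eq_add_neg] using this
  set β : E4 → ℝ := fun x => ∑ j, ‖b j x‖
  have hβ0 : ∀ x, 0 ≤ β x := fun x => Finset.sum_nonneg fun _ _ => norm_nonneg _
  obtain ⟨hβi, hβK⟩ := sum_norm_pow_four_integrable hK hbm hb4
  obtain ⟨n, hn, hnK⟩ := exists_annulus_lintegral_le hβK hN0
  set r : ℝ := (1 / 4) ^ (n + 2)
  have hr : 0 < r := by positivity
  have hρr : ρ ≤ r := pow_le_pow_of_le_one (by norm_num) (by norm_num) (by omega)
  have hr16 : r ≤ 1 / 16 := by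
    calc r ≤ (1 / 4) ^ 2 := pow_le_pow_of_le_one (by norm_num) (by norm_num) (by omega)
      _ = 1 / 16 := by norm_num
  have hann : annulus r ⊆ Metric.ball 0 (1 / 2) := fun x hx => by
    rw [mem_ball_zero_iff]; linarith [hx.2]
  set κ : ℝ := ∫ x in annulus r, β x ^ 4
  have hκ0 : 0 ≤ κ := setIntegral_nonneg (measurableSet_annulus r) fun x _ => by positivity
  have hκ : κ ≤ K' / N := by
    simp only [κ]
    rw [integral_eq_lintegral_of_nonneg_ae (Eventually.of_forall fun x => by positivity)
      (hβi.1.mono_measure (Measure.restrict_mono hann le_rfl))]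
    have := ENNReal.toReal_mono (ENNReal.div_ne_top (by finiteness)
      (by exact_mod_cast hN0.ne')) hnK
    rwa [ENNReal.toReal_div, ENNReal.toReal_natCast] at this
  obtain ⟨φ, hφ, hφs, hφ0, -, hφ1, hφd, hφa⟩ := hcut r hr
  have hφB : tsupport φ ⊆ Metric.ball 0 (1 / 4) := hφs.trans fun x hx => by
    rw [mem_ball_zero_iff]; linarith [mem_closedBall_zero_iff.1 hx]
  have hφc : HasCompactSupport φ :=
    (isCompact_closedBall (0 : E4) (2 * r)).of_isClosed_subset (isClosed_tsupport _) hφs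
  have hCS := integral_wedgeSq_of_hasWeakPartial (a := a) (r := 1 / 4) (R := 1 / 2) (by norm_num)
    (by norm_num) hbmem (fun i j => (hd2 i j).mono_measure (hmeas (by norm_num))) hbw
    (fun _ => rfl) hφ hφc hφB
  have hQ' : ∫ x in Metric.ball 0 (1 / 4), φ x * (wedgeSq (curvField a b d x)).re =
      -(12 * ∫ x in Metric.ball 0 (1 / 4), φ x * bubble l x ^ 2) := by
    rw [← integral_const_mul, ← integral_neg]
    refine integral_congr_ae ?_
    filter_upwards [ae_mono (hmeas (by norm_num)) hQ] with x hx
    rw [hcurv, hx]; ring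
  have hlow := le_integral_mul_bubble_sq hl0 (r := r) (by
    rw [div_le_iff₀ hl0]
    rw [div_le_iff₀ hρ] at hl2
    nlinarith) (by linarith) hφ.continuous hφ0 hφ1
  set δ : ℝ := 2 * (1 / (l ^ 2 * ρ ^ 4))
  have hδ0 : 0 ≤ δ := by positivity
  have hT : ∀ i j k, ∀ᵐ x ∂(volume.restrict (Metric.ball (0 : E4) (1 / 4))), x ∈ annulus r →
      ‖transField a b d i j k x‖ ≤ 3 * (β x * δ) + 2 * β x ^ 3 := by
    intro i j k
    have hall : ∀ᵐ x ∂(volume.restrict B4), ∀ i j,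
        ‖curvH (fun i => B i x) (fun i j => d i j x) i j‖ ≤ 2 * bubble l x :=
      ae_all_iff.2 fun i => ae_all_iff.2 fun j => hFb i j
    filter_upwards [ae_mono (hmeas (by norm_num)) hall] with x hx hxA
    refine norm_transgression_le (fun i j => ?_) (fun j => ?_) i j k
    · rw [hcurv]
      refine (hx i j).trans ?_
      have := bubble_le hl0 hρ (hρr.trans hxA.1)
      simp only [δ]; gcongr
    · exact Finset.single_le_sum (f := fun j => ‖b j x‖) (fun _ _ => norm_nonneg _)
        (Finset.mem_univ j)
  have hβ4 : IntegrableOn (fun x => β x ^ 4) (Metric.ball 0 (1 / 4)) :=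
    hβi.mono_measure (Measure.restrict_mono (Metric.ball_subset_ball (by norm_num)) le_rfl)
  have hs : 0 < t * r := by positivity
  have hbound := fun i j k l => abs_integral_fderiv_mul_re_le hr hr16 hD hδ0 hs hφd hφa hβ0 hβ4
    (hT i j k) l
  set E : ℝ := D / r * ((3 * δ + 2 * ((t * r) ^ 3)⁻¹) * (16 * r ^ 4 * v₀) + (3 * δ + 2 * (t * r)) * κ)
  -- The charge is at least `24 v₀ / 16 = 3 v₀ / 2`, whereas the estimates below bound the four
  -- boundary terms by less than `3 v₀ / 4`.
  have hE1 : 24 * (v₀ / 16) ≤ 4 * E := by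
    have b0 := abs_le.1 (hbound 1 2 3 0)
    have b1 := abs_le.1 (hbound 0 2 3 1)
    have b2 := abs_le.1 (hbound 0 1 3 2)
    have b3 := abs_le.1 (hbound 0 1 2 3)
    rw [hQ'] at hCS
    linarith [b0.1, b0.2, b1.1, b1.2, b2.1, b2.2, b3.1, b3.2]
  have hE2 : 4 * E = 4 * D * (3 * (16 * v₀ * r ^ 3 + κ / r)) * δ + 128 * D * (t ^ 3)⁻¹ * v₀
      + 8 * D * t * κ := by
    have : t ≠ 0 := by positivity
    simp only [E]
    field_simp
    ring
  have hE3 : 4 * D * (3 * (16 * v₀ * r ^ 3 + κ / r)) * δ ≤ G * δ := by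
    have h1 : r ^ 3 ≤ 1 := pow_le_one₀ hr.le (by linarith)
    have h2 : κ / r ≤ K' / ρ := by
      have : κ ≤ K' := hκ.trans (div_le_self hK'0 (by exact_mod_cast hN0))
      gcongr
    have h3 : 16 * v₀ * r ^ 3 ≤ 16 * v₀ := mul_le_of_le_one_right (by positivity) h1
    simp only [G]
    gcongr
  have hE4 : 8 * D * t * κ ≤ v₀ / 4 := by
    calc 8 * D * t * κ ≤ 8 * D * t * (K' / N) := by gcongr
      _ = (32 * D * t * K') / N / 4 := by ring
      _ ≤ v₀ / 4 := by
        gcongr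
        rw [div_le_iff₀ hNr]; linarith
  have hE5 : 128 * D * (t ^ 3)⁻¹ * v₀ ≤ 1 / 4 * v₀ := by gcongr
  linarith

end Core

attribute [local instance] Matrix.frobeniusNormedAddCommGroup Matrix.frobeniusNormedSpace

/-! ### Quaternions as complex matrices -/

section Quaternions

/-- The embedding of the quaternions into `2 × 2` matrices, as a linear map. -/
def toMatLin : ℍ[ℝ] →ₗ[ℝ] M2 where
  toFun y := !![⟨y.re, y.imI⟩, ⟨y.imJ, y.imK⟩; ⟨-y.imJ, y.imK⟩, ⟨y.re, -y.imI⟩]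
  map_add' x y := by
    ext i j; fin_cases i <;> fin_cases j <;> simp [Complex.ext_iff, add_comm]
  map_smul' c y := by
    ext i j; fin_cases i <;> fin_cases j <;> simp [Complex.ext_iff]

/-- The embedding of the quaternions into `2 × 2` matrices. -/
def toMat : ℍ[ℝ] →L[ℝ] M2 := LinearMap.toContinuousLinearMap toMatLin

theorem toMat_apply (y : ℍ[ℝ]) :
    toMat y = !![⟨y.re, y.imI⟩, ⟨y.imJ, y.imK⟩; ⟨-y.imJ, y.imK⟩, ⟨y.re, -y.imI⟩] := rfl

/-- A linear left inverse of `toMat`. -/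
def ofMatLin : M2 →ₗ[ℝ] ℍ[ℝ] where
  toFun M := ⟨(M 0 0).re, (M 0 0).im, (M 0 1).re, (M 0 1).im⟩
  map_add' x y := by ext <;> rfl
  map_smul' c y := by
    ext
    · exact Complex.smul_re c (y 0 0)
    · exact Complex.smul_im c (y 0 0)
    · exact Complex.smul_re c (y 0 1)
    · exact Complex.smul_im c (y 0 1)

/-- A continuous linear left inverse of `toMat`. -/
def ofMat : M2 →L[ℝ] ℍ[ℝ] := LinearMap.toContinuousLinearMap ofMatLin

theorem ofMat_apply (M : M2) : ofMat M = ⟨(M 0 0).re, (M 0 0).im, (M 0 1).re, (M 0 1).im⟩ := rfl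

theorem toMat_mul (x y : ℍ[ℝ]) : toMat (x * y) = toMat x * toMat y := by
  simp only [toMat_apply]
  ext i j
  fin_cases i <;> fin_cases j <;> simp [Matrix.mul_apply, Complex.ext_iff] <;> constructor <;> ring

theorem toMat_star (x : ℍ[ℝ]) : toMat (star x) = (toMat x)ᴴ := by
  simp only [toMat_apply]
  ext i j
  fin_cases i <;> fin_cases j <;> simp [Matrix.conjTranspose_apply, Complex.ext_iff]

theorem toMat_im (y : ℍ[ℝ]) : toMat y.im = imSU2 y := by
  rw [toMat_apply, imSU2]
  ext i j
  fin_cases i <;> fin_cases j <;> simp [Complex.ext_iff]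

theorem norm_sq_toMat (x : ℍ[ℝ]) : ‖toMat x‖ ^ 2 = 2 * ‖x‖ ^ 2 := by
  rw [Matrix.frobenius_norm_def, norm_sq_quaternion]
  simp only [Fin.sum_univ_two, toMat_apply]
  rw [← Real.rpow_natCast, ← Real.rpow_mul (by positivity)]
  norm_num [Complex.sq_norm, Complex.normSq_apply]
  ring

/-- In `SU(2)` the adjoint equals the adjugate, so the second row is determined by the first exactly
as in the matrix of a quaternion. -/
theorem toMat_ofMat_specialUnitary (g : SU2) : toMat (ofMat (g : M2)) = g := by
  obtain ⟨M, hM⟩ := g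
  rw [Matrix.mem_specialUnitaryGroup_iff] at hM
  obtain ⟨hU, hdet⟩ := hM
  have h1 : star M * M = 1 := Matrix.mem_unitaryGroup_iff'.1 hU
  have h2 : star M = M.adjugate := by
    calc star M = star M * (M * M.adjugate) := by rw [Matrix.mul_adjugate, hdet]; simp
      _ = M.adjugate := by rw [← mul_assoc, h1, one_mul]
  rw [Matrix.adjugate_fin_two] at h2
  have e00 := congrFun (congrFun h2 0) 0
  have e10 := congrFun (congrFun h2 1) 0
  simp [Matrix.star_apply, Complex.ext_iff] at e00 e10
  rw [toMat_apply, ofMat_apply]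
  ext i j
  fin_cases i <;> fin_cases j <;> simp [Complex.ext_iff]
  · constructor <;> linarith [e10.1, e10.2]
  · constructor <;> linarith [e00.1, e00.2]

theorem ofMat_toMat (x : ℍ[ℝ]) : ofMat (toMat x) = x := by
  rw [toMat_apply, ofMat_apply]; ext <;> simp

theorem star_mul_self_ofMat (g : SU2) : star (ofMat (g : M2)) * ofMat (g : M2) = 1 := by
  have h : toMat (star (ofMat (g : M2)) * ofMat (g : M2)) = toMat 1 := by
    rw [toMat_mul, toMat_star, toMat_ofMat_specialUnitary]
    have h1 : star (g : M2) * (g : M2) = 1 :=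
      Matrix.mem_unitaryGroup_iff'.1 (Matrix.mem_specialUnitaryGroup_iff.1 g.2).1
    rw [← Matrix.star_eq_conjTranspose, h1, toMat_apply]
    ext i j
    fin_cases i <;> fin_cases j <;> simp [Complex.ext_iff]
  have := congrArg ofMat h
  rwa [ofMat_toMat, ofMat_toMat] at this

/-- Coordinates of quaternions. -/
def coordL (m : Fin 4) : ℍ[ℝ] →L[ℝ] ℝ := LinearMap.toContinuousLinearMap
  { toFun := fun y => ![y.re, y.imI, y.imJ, y.imK] m
    map_add' := fun x y => by fin_cases m <;> simp
    map_smul' := fun c y => by fin_cases m <;> simp }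

/-- The basis `1, i, j, k` of the quaternions. -/
def basisH (m : Fin 4) : ℍ[ℝ] := ![⟨1, 0, 0, 0⟩, ⟨0, 1, 0, 0⟩, ⟨0, 0, 1, 0⟩, ⟨0, 0, 0, 1⟩] m

/-- Expanding the left factor in the basis `1, i, j, k` reduces the quaternionic Leibniz rule to the
one for real scalars, `HasWeakPartial.smul`. -/
theorem sum_coordL_smul_basisH_mul (x y : ℍ[ℝ]) :
    coordL 0 x • (basisH 0 * y) + coordL 1 x • (basisH 1 * y) + coordL 2 x • (basisH 2 * y)
      + coordL 3 x • (basisH 3 * y) = x * y := by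
  have h0 : coordL 0 x = x.re := rfl
  have h1 : coordL 1 x = x.imI := rfl
  have h2 : coordL 2 x = x.imJ := rfl
  have h3 : coordL 3 x = x.imK := rfl
  have key : x = x.re • basisH 0 + x.imI • basisH 1 + x.imJ • basisH 2 + x.imK • basisH 3 := by
    have hr (m : Fin 4) : (basisH m).re = ![1, 0, 0, 0] m := by fin_cases m <;> rfl
    have hi (m : Fin 4) : (basisH m).imI = ![0, 1, 0, 0] m := by fin_cases m <;> rfl
    have hj (m : Fin 4) : (basisH m).imJ = ![0, 0, 1, 0] m := by fin_cases m <;> rfl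
    have hk (m : Fin 4) : (basisH m).imK = ![0, 0, 0, 1] m := by fin_cases m <;> rfl
    ext <;> simp [hr, hi, hj, hk]
  rw [h0, h1, h2, h3]
  conv_rhs => rw [key]
  simp only [add_mul, smul_mul_assoc]

/-- The Leibniz rule for products of quaternion-valued functions in `W^{1,2}`. -/
theorem HasWeakPartial.mul {i : Fin 4} {u u' v v' : E4 → ℍ[ℝ]}
    (hu : HasWeakPartial i u u') (hv : HasWeakPartial i v v')
    (u2 : MemLp u 2 (volume.restrict B4)) (u2' : MemLp u' 2 (volume.restrict B4))
    (v2 : MemLp v 2 (volume.restrict B4)) (v2' : MemLp v' 2 (volume.restrict B4)) :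
    HasWeakPartial i (fun x => u x * v x) fun x => u' x * v x + u x * v' x := by
  have key : ∀ m, HasWeakPartial i (fun x => coordL m (u x) • (basisH m * v x))
      fun x => coordL m (u' x) • (basisH m * v x) + coordL m (u x) • (basisH m * v' x) := fun m =>
    (hu.clm_comp (coordL m)).smul (hv.clm_comp (ContinuousLinearMap.mul ℝ ℍ[ℝ] (basisH m)))
      ((coordL m).comp_memLp' u2) ((coordL m).comp_memLp' u2')
      ((ContinuousLinearMap.mul ℝ ℍ[ℝ] (basisH m)).comp_memLp' v2)
      ((ContinuousLinearMap.mul ℝ ℍ[ℝ] (basisH m)).comp_memLp' v2')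
  have h := (((key 0).add (key 1)).add (key 2)).add (key 3)
  refine h.congr (Eventually.of_forall fun x => ?_) (Eventually.of_forall fun x => ?_)
  · exact sum_coordL_smul_basisH_mul (u x) (v x)
  · simp only
    rw [← sum_coordL_smul_basisH_mul (u' x) (v x), ← sum_coordL_smul_basisH_mul (u x) (v' x)]
    abel

end Quaternions

/-! ### The instanton and its curvature -/

section Potential

@[simp] theorem re_quat (x : E4) : (quat x).re = x 0 := rfl

@[simp] theorem imI_quat (x : E4) : (quat x).imI = x 1 := rfl

@[simp] theorem imJ_quat (x : E4) : (quat x).imJ = x 2 := rfl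

@[simp] theorem imK_quat (x : E4) : (quat x).imK = x 3 := rfl

theorem quat_add (x y : E4) : quat (x + y) = quat x + quat y := by ext <;> rfl

theorem quat_smul (c : ℝ) (x : E4) : quat (c • x) = c • quat x := by ext <;> rfl

/-- The linear `1`-form `Im (x dx̄)`, in components. -/
def imForm (j : Fin 4) : E4 →L[ℝ] ℍ[ℝ] := LinearMap.toContinuousLinearMap
  { toFun := fun x => (quat x * star (quat (e j))).im
    map_add' := fun x y => by rw [quat_add, add_mul, Quaternion.im_add]
    map_smul' := fun c x => by rw [quat_smul, smul_mul_assoc, Quaternion.im_smul]; rfl }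

theorem imForm_apply (j : Fin 4) (x : E4) : imForm j x = (quat x * star (quat (e j))).im := rfl

theorem re_imForm (j : Fin 4) (x : E4) : (imForm j x).re = 0 := rfl

theorem imI_imForm (j : Fin 4) (x : E4) : (imForm j x).imI = ![x 1, -x 0, x 3, -x 2] j := by
  rw [imForm_apply]
  fin_cases j <;> simp [e, Quaternion.imI_mul]

theorem imJ_imForm (j : Fin 4) (x : E4) : (imForm j x).imJ = ![x 2, -x 3, -x 0, x 1] j := by
  rw [imForm_apply]
  fin_cases j <;> simp [e, Quaternion.imJ_mul]

theorem imK_imForm (j : Fin 4) (x : E4) : (imForm j x).imK = ![x 3, x 2, -x 1, -x 0] j := by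
  rw [imForm_apply]
  fin_cases j <;> simp [e, Quaternion.imK_mul]

/-- The constant `2`-form `dx ∧ dx̄`, in components. -/
def sdForm (i j : Fin 4) : ℍ[ℝ] := imForm j (e i) - imForm i (e j)

theorem norm_sdForm_le (i j : Fin 4) : ‖sdForm i j‖ ≤ 2 := by
  refine abs_le_of_sq_le_sq' ?_ (by norm_num) |>.2
  rw [norm_sq_quaternion, sdForm]
  simp only [Quaternion.re_sub, Quaternion.imI_sub, Quaternion.imJ_sub, Quaternion.imK_sub,
    re_imForm, imI_imForm, imJ_imForm, imK_imForm]
  fin_cases i <;> fin_cases j <;> simp [e] <;> norm_num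

/-- The form is self-dual: its components `01`, `02`, `03` are `-2i`, `-2j`, `-2k` and agree with
`23`, `31`, `12`. Each of the three products is therefore a square equal to `-4`. -/
theorem re_wedgeSq_sdForm : (wedgeSq sdForm).re = -12 := by
  simp only [wedgeSq, sdForm, Quaternion.re_add, Quaternion.re_sub, Quaternion.re_mul,
    Quaternion.imI_sub, Quaternion.imJ_sub, Quaternion.imK_sub,
    re_imForm, imI_imForm, imJ_imForm, imK_imForm]
  simp [e]
  norm_num

/-- With `f = l² / (1 + l² ‖x‖²)` one has `∂ᵢf = -2 f² xᵢ`. In the curvature of `f • imForm`, the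
first two terms here cancel those where `f` is differentiated, leaving the factor `f - f² ‖x‖²`,
which is `bubble l`. -/
theorem imForm_commutator (i j : Fin 4) (x : E4) :
    imForm i x * imForm j x - imForm j x * imForm i x
      = (2 * x i) • imForm j x - (2 * x j) • imForm i x - ‖x‖ ^ 2 • sdForm i j := by
  rw [sdForm, EuclideanSpace.real_norm_sq_eq, Fin.sum_univ_four]
  ext <;> simp only [Quaternion.re_sub, Quaternion.re_mul,
    Quaternion.imI_sub, Quaternion.imJ_sub, Quaternion.imK_sub, Quaternion.imI_mul,
    Quaternion.imJ_mul, Quaternion.imK_mul, Quaternion.re_smul, Quaternion.imI_smul,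
    Quaternion.imJ_smul, Quaternion.imK_smul,
    re_imForm, imI_imForm, imJ_imForm, imK_imForm]
  all_goals fin_cases i <;> fin_cases j <;> simp [e] <;> ring

/-- The quaternion-valued components of the rescaled instanton. -/
def potential (l : ℝ) (j : Fin 4) (x : E4) : ℍ[ℝ] :=
  (l ^ 2 / (1 + l ^ 2 * ‖x‖ ^ 2)) • imForm j x

/-- The partial derivatives of the rescaled instanton. -/
def potentialDeriv (l : ℝ) (i j : Fin 4) (x : E4) : ℍ[ℝ] :=
  (l ^ 2 / (1 + l ^ 2 * ‖x‖ ^ 2)) • imForm j (e i)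
    - (2 * (l ^ 2 / (1 + l ^ 2 * ‖x‖ ^ 2)) ^ 2 * x i) • imForm j x

theorem one_add_sq_mul_pos (l : ℝ) (x : E4) : 0 < 1 + l ^ 2 * ‖x‖ ^ 2 := by positivity

theorem toMat_potential (l : ℝ) (j : Fin 4) (x : E4) : toMat (potential l j x) = instanton l j x := by
  rw [potential, map_smul, imForm_apply, toMat_im]; rfl

theorem re_potential (l : ℝ) (j : Fin 4) (x : E4) : (potential l j x).re = 0 := by
  rw [potential, Quaternion.re_smul, re_imForm, smul_zero]

theorem contDiff_potential (l : ℝ) (j : Fin 4) : ContDiff ℝ 1 (potential l j) := by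
  refine ContDiff.smul (contDiff_const.div ?_ fun x => (one_add_sq_mul_pos l x).ne')
    (imForm j).contDiff
  exact contDiff_const.add (contDiff_const.mul (contDiff_norm_sq ℝ))

theorem continuous_potentialDeriv (l : ℝ) (i j : Fin 4) : Continuous (potentialDeriv l i j) := by
  have h : Continuous fun x : E4 => l ^ 2 / (1 + l ^ 2 * ‖x‖ ^ 2) :=
    continuous_const.div (by fun_prop) fun x => (one_add_sq_mul_pos l x).ne'
  unfold potentialDeriv
  fun_prop

theorem fderiv_potential (l : ℝ) (i j : Fin 4) (x : E4) :
    fderiv ℝ (potential l j) x (e i) = potentialDeriv l i j x := by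
  have h1 : HasFDerivAt (fun y : E4 => 1 + l ^ 2 * ‖y‖ ^ 2)
      (l ^ 2 • (2 • innerSL ℝ x)) x :=
    ((hasStrictFDerivAt_norm_sq x).hasFDerivAt.const_mul (l ^ 2)).const_add 1
  have h2 := (((hasDerivAt_inv (one_add_sq_mul_pos l x).ne').comp_hasFDerivAt x h1).const_mul
    (l ^ 2)).smul ((imForm j).hasFDerivAt (x := x))
  have h3 : HasFDerivAt (potential l j) _ x := h2
  rw [h3.fderiv, potentialDeriv]
  have hin : inner ℝ x (e i) = x i := by
    simp [e, EuclideanSpace.inner_single_right]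
  simp only [add_apply, smul_apply,
    ContinuousLinearMap.smulRight_apply, innerSL_apply_apply, hin, smul_eq_mul, nsmul_eq_mul]
  rw [sub_eq_add_neg, ← neg_smul]
  congr 2
  have := (one_add_sq_mul_pos l x).ne'
  push_cast
  field_simp

theorem hasWeakPartial_potential (l : ℝ) (i j : Fin 4) :
    HasWeakPartial i (potential l j) (potentialDeriv l i j) := by
  have h := hasWeakPartial_of_contDiff (i := i) (contDiff_potential l j)
  simpa only [fderiv_potential] using h

theorem curvH_potential (l : ℝ) (i j : Fin 4) (x : E4) :
    curvH (fun j => potential l j x) (fun i j => potentialDeriv l i j x) i j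
      = bubble l x • sdForm i j := by
  have hb : bubble l x = l ^ 2 / (1 + l ^ 2 * ‖x‖ ^ 2)
      - (l ^ 2 / (1 + l ^ 2 * ‖x‖ ^ 2)) ^ 2 * ‖x‖ ^ 2 := by
    have := (one_add_sq_mul_pos l x).ne'
    rw [bubble]; field_simp; ring
  simp only [curvH, potential, potentialDeriv]
  set f := l ^ 2 / (1 + l ^ 2 * ‖x‖ ^ 2)
  have h := imForm_commutator i j x
  have h2 : f • imForm i x * (f • imForm j x) - f • imForm j x * (f • imForm i x)
      = f ^ 2 • ((2 * x i) • imForm j x - (2 * x j) • imForm i x - ‖x‖ ^ 2 • sdForm i j) := by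
    rw [← h]; simp only [smul_mul_smul_comm, smul_sub, sq]
  rw [h2, hb, sdForm]
  module

end Potential

/-! ### Gauge transformations by unit quaternions -/

section Gauge

theorem fderiv_fderiv_apply_comm {φ : E4 → ℝ} (hφ : ContDiff ℝ ∞ φ) (v w x : E4) :
    fderiv ℝ (fun y => fderiv ℝ φ y v) x w = fderiv ℝ (fun y => fderiv ℝ φ y w) x v := by
  have hd : DifferentiableAt ℝ (fderiv ℝ φ) x :=
    ((hφ.fderiv_right (m := 1) (by norm_cast)).differentiable one_ne_zero).differentiableAt
  have hs : IsSymmSndFDerivAt ℝ φ x :=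
    hφ.contDiffAt.isSymmSndFDerivAt (by rw [minSmoothness_of_isRCLikeNormedField]; norm_cast)
  rw [fderiv_clm_apply hd (differentiableAt_const v), fderiv_clm_apply hd (differentiableAt_const w)]
  simpa using hs.eq w v

/-- Weak partial derivatives commute. -/
theorem HasWeakPartial.swap {F : Type*} [NormedAddCommGroup F] [NormedSpace ℝ F] {i j : Fin 4}
    {u ui uj w : E4 → F} (hi : HasWeakPartial i u ui) (hj : HasWeakPartial j u uj)
    (hw : HasWeakPartial j ui w) : HasWeakPartial i uj w := by
  refine ⟨hj.2.1, hw.2.1, fun φ h1 h2 h3 => ?_⟩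
  have hs (k : Fin 4) : tsupport (fun x => fderiv ℝ φ x (e k)) ⊆ B4 :=
    (tsupport_fderiv_apply_subset φ (e k)).trans h3
  have e1 := hj.2.2 _ (contDiff_fderiv_apply h1 (e i)) (hasCompactSupport_fderiv_apply h2 (e i)) (hs i)
  have e2 := hi.2.2 _ (contDiff_fderiv_apply h1 (e j)) (hasCompactSupport_fderiv_apply h2 (e j)) (hs j)
  have e3 := hw.2.2 φ h1 h2 h3
  simp only [fderiv_fderiv_apply_comm h1 (e i) (e j)] at e1
  rw [e1, e3, neg_neg] at e2
  exact neg_eq_iff_eq_neg.1 e2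

/-- `q` is a unit-quaternion-valued function in `W^{2,2}`, with first derivatives `q₁` and second
derivatives `q₂`. -/
structure IsUnitGauge (q : E4 → ℍ[ℝ]) (q₁ : Fin 4 → E4 → ℍ[ℝ])
    (q₂ : Fin 4 → Fin 4 → E4 → ℍ[ℝ]) : Prop where
  star_mul_self : ∀ x, star (q x) * q x = 1
  hasWeakPartial : ∀ i, HasWeakPartial i q (q₁ i)
  hasWeakPartial_snd : ∀ i j, HasWeakPartial i (q₁ j) (q₂ i j)
  memLp : MemLp q 2 (volume.restrict B4)
  memLp_fst : ∀ i, MemLp (q₁ i) 2 (volume.restrict B4)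
  memLp_snd : ∀ i j, MemLp (q₂ i j) 2 (volume.restrict B4)

/-- The gauge transform of `a` by `q`, in quaternions. -/
def gaugeH (a : Fin 4 → ℍ[ℝ]) (q : ℍ[ℝ]) (q₁ : Fin 4 → ℍ[ℝ]) (j : Fin 4) : ℍ[ℝ] :=
  star q * q₁ j + star q * (a j * q)

/-- The derivatives of the gauge transform of `a` by `q`, in quaternions. -/
def gaugeDerivH (a : Fin 4 → ℍ[ℝ]) (a₁ : Fin 4 → Fin 4 → ℍ[ℝ]) (q : ℍ[ℝ]) (q₁ : Fin 4 → ℍ[ℝ])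
    (q₂ : Fin 4 → Fin 4 → ℍ[ℝ]) (i j : Fin 4) : ℍ[ℝ] :=
  (star (q₁ i) * q₁ j + star q * q₂ i j)
    + (star (q₁ i) * (a j * q) + star q * (a₁ i j * q + a j * q₁ i))

theorem mul_star_self_of_star_mul_self {q : ℍ[ℝ]} (h : star q * q = 1) : q * star q = 1 :=
  mul_eq_one_comm.1 h

theorem re_mul_comm (x y : ℍ[ℝ]) : (x * y).re = (y * x).re := by
  simp only [Quaternion.re_mul]; ring

theorem re_eq_zero_of_star_add_self {x : ℍ[ℝ]} (h : star x + x = 0) : x.re = 0 := by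
  have := congrArg QuaternionAlgebra.re h
  rw [Quaternion.re_add, Quaternion.re_star, Quaternion.re_zero] at this
  linarith

section Pointwise

variable {a : Fin 4 → ℍ[ℝ]} {a₁ : Fin 4 → Fin 4 → ℍ[ℝ]} {q : ℍ[ℝ]} {q₁ : Fin 4 → ℍ[ℝ]}
  {q₂ : Fin 4 → Fin 4 → ℍ[ℝ]}

/-- The condition `h₁`, the derivative of `star q * q = 1`, says that `star q * q₁ j` is imaginary;
conjugation by a unit quaternion preserves the real part. -/
theorem re_gaugeH (hq : star q * q = 1) (h₁ : ∀ i, star (q₁ i) * q + star q * q₁ i = 0)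
    (ha : ∀ j, (a j).re = 0) (j : Fin 4) : (gaugeH a q q₁ j).re = 0 := by
  have e1 : (star q * q₁ j).re = 0 :=
    re_eq_zero_of_star_add_self (by rw [star_mul, star_star]; exact h₁ j)
  have e2 : (star q * (a j * q)).re = 0 := by
    rw [re_mul_comm, mul_assoc, mul_star_self_of_star_mul_self hq, mul_one, ha]
  rw [gaugeH, Quaternion.re_add, e1, e2, add_zero]

/-- Gauge covariance of the curvature. The relation `h₁` expresses `star (q₁ k)` through `q₁ k`, and
`h₂` removes the second derivatives; everything else cancels after multiplying out. -/
theorem curvH_gaugeH (hq : star q * q = 1) (h₁ : ∀ i, star (q₁ i) * q + star q * q₁ i = 0)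
    (h₂ : ∀ i j, q₂ i j = q₂ j i) (i j : Fin 4) :
    curvH (gaugeH a q q₁) (gaugeDerivH a a₁ q q₁ q₂) i j = star q * (curvH a a₁ i j * q) := by
  have hq' := mul_star_self_of_star_mul_self hq
  have hs (k : Fin 4) : star (q₁ k) = -(star q * (q₁ k * star q)) := by
    have h := congrArg (· * star q) (h₁ k)
    simp only [add_mul, mul_assoc, hq', mul_one, zero_mul] at h
    exact eq_neg_of_add_eq_zero_left h
  have hz (z : ℍ[ℝ]) : q * (star q * z) = z := by rw [← mul_assoc, hq', one_mul]
  simp only [curvH, gaugeH, gaugeDerivH, hs, h₂ i j, mul_add, add_mul, mul_assoc, neg_mul, hz,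
    mul_sub, sub_mul]
  abel

theorem norm_eq_one_of_star_mul_self (hq : star q * q = 1) : ‖q‖ = 1 := by
  have h := congrArg norm hq
  rw [norm_mul, Quaternion.norm_star, norm_one] at h
  nlinarith [norm_nonneg q]

theorem norm_star_mul_mul (hq : star q * q = 1) (x : ℍ[ℝ]) : ‖star q * (x * q)‖ = ‖x‖ := by
  rw [norm_mul, norm_mul, Quaternion.norm_star, norm_eq_one_of_star_mul_self hq, one_mul, mul_one]

theorem re_wedgeSq_conj (hq : star q * q = 1) (F : Fin 4 → Fin 4 → ℍ[ℝ]) :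
    (wedgeSq fun i j => star q * (F i j * q)).re = (wedgeSq F).re := by
  have hz (z : ℍ[ℝ]) : q * (star q * z) = z := by
    rw [← mul_assoc, mul_star_self_of_star_mul_self hq, one_mul]
  have h : (wedgeSq fun i j => star q * (F i j * q)) = star q * (wedgeSq F * q) := by
    simp only [wedgeSq, mul_add, add_mul, mul_sub, sub_mul, mul_assoc, hz]
  rw [h, re_mul_comm, mul_assoc, mul_star_self_of_star_mul_self hq, mul_one]

end Pointwise

section Almost

variable {q : E4 → ℍ[ℝ]} {q₁ : Fin 4 → E4 → ℍ[ℝ]} {q₂ : Fin 4 → Fin 4 → E4 → ℍ[ℝ]}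
  {a : Fin 4 → E4 → ℍ[ℝ]} {a₁ : Fin 4 → Fin 4 → E4 → ℍ[ℝ]}

/-- Conjugation of quaternions as a real linear map. -/
def starH : ℍ[ℝ] →L[ℝ] ℍ[ℝ] := LinearMap.toContinuousLinearMap
  { toFun := fun x => star x
    map_add' := star_add
    map_smul' := fun c x => Quaternion.star_smul c x }

theorem HasWeakPartial.star {i : Fin 4} {u v : E4 → ℍ[ℝ]} (h : HasWeakPartial i u v) :
    HasWeakPartial i (fun x => star (u x)) fun x => star (v x) :=
  h.clm_comp starH

theorem memLp_star {p : ℝ≥0∞} {μ : Measure E4} {u : E4 → ℍ[ℝ]} (h : MemLp u p μ) :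
    MemLp (fun x => star (u x)) p μ :=
  starH.comp_memLp' h

/-- The weak Leibniz rule differentiates the constant function `star q * q = 1`, and weak
derivatives are unique almost everywhere. -/
theorem IsUnitGauge.ae_add_eq_zero (h : IsUnitGauge q q₁ q₂) (i : Fin 4) :
    ∀ᵐ x ∂(volume.restrict B4), star (q₁ i x) * q x + star (q x) * q₁ i x = 0 := by
  have h1 := (h.hasWeakPartial i).star.mul (h.hasWeakPartial i) (memLp_star h.memLp)
    (memLp_star (h.memLp_fst i)) h.memLp (h.memLp_fst i)
  simp only [h.star_mul_self] at h1
  have h2 := hasWeakPartial_of_contDiff (i := i) (f := fun _ : E4 => (1 : ℍ[ℝ])) contDiff_const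
  filter_upwards [h1.ae_eq h2] with x hx
  simpa using hx

theorem IsUnitGauge.ae_snd_comm (h : IsUnitGauge q q₁ q₂) (i j : Fin 4) :
    ∀ᵐ x ∂(volume.restrict B4), q₂ i j x = q₂ j i x :=
  (h.hasWeakPartial_snd i j).ae_eq
    ((h.hasWeakPartial i).swap (h.hasWeakPartial j) (h.hasWeakPartial_snd j i))

theorem IsUnitGauge.memLp_top (h : IsUnitGauge q q₁ q₂) : MemLp q ⊤ (volume.restrict B4) :=
  memLp_top_of_bound h.memLp.1 1
    (Eventually.of_forall fun x => (norm_eq_one_of_star_mul_self (h.star_mul_self x)).le)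

theorem holderTriple_top_two_two : ENNReal.HolderTriple ⊤ 2 2 := inferInstance

theorem IsUnitGauge.memLp_gaugeH (h : IsUnitGauge q q₁ q₂)
    (ha : ∀ j, MemLp (a j) ⊤ (volume.restrict B4)) (j : Fin 4) :
    MemLp (fun x => gaugeH (fun j => a j x) (q x) (fun j => q₁ j x) j) 2 (volume.restrict B4) :=
  (memLp_mul_quaternion holderTriple_top_two_two (memLp_star h.memLp_top) (h.memLp_fst j)).add
    (memLp_mul_quaternion holderTriple_top_two_two (memLp_star h.memLp_top)
      (memLp_mul_quaternion holderTriple_top_two_two (ha j) h.memLp))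

/-- The Leibniz rule needs only `L²` factors with `L²` derivatives, so no Sobolev embedding for `q₁`
enters. The product terms are then known only to be locally integrable; square integrability comes
later from the assumed bound on the Dirichlet energy. -/
theorem IsUnitGauge.hasWeakPartial_gaugeH (h : IsUnitGauge q q₁ q₂)
    (ha : ∀ j, MemLp (a j) ⊤ (volume.restrict B4))
    (ha₁ : ∀ i j, MemLp (a₁ i j) ⊤ (volume.restrict B4))
    (hd : ∀ i j, HasWeakPartial i (a j) (a₁ i j)) (i j : Fin 4) :
    HasWeakPartial i (fun x => gaugeH (fun j => a j x) (q x) (fun j => q₁ j x) j)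
      fun x => gaugeDerivH (fun j => a j x) (fun i j => a₁ i j x) (q x) (fun j => q₁ j x)
        (fun i j => q₂ i j x) i j := by
  have hfin : IsFiniteMeasure ((volume : Measure E4).restrict B4) :=
    ⟨by rw [Measure.restrict_apply_univ]; exact measure_ball_lt_top⟩
  have haq : HasWeakPartial i (fun x => a j x * q x)
      fun x => a₁ i j x * q x + a j x * q₁ i x :=
    (hd i j).mul (h.hasWeakPartial i) ((ha j).mono_exponent le_top)
      ((ha₁ i j).mono_exponent le_top) h.memLp (h.memLp_fst i)
  have hm : MemLp (fun x => a j x * q x) 2 (volume.restrict B4) :=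
    memLp_mul_quaternion holderTriple_top_two_two (ha j) h.memLp
  have hm' : MemLp (fun x => a₁ i j x * q x + a j x * q₁ i x) 2 (volume.restrict B4) :=
    (memLp_mul_quaternion holderTriple_top_two_two (ha₁ i j) h.memLp).add
      (memLp_mul_quaternion holderTriple_top_two_two (ha j) (h.memLp_fst i))
  exact ((h.hasWeakPartial i).star.mul (h.hasWeakPartial_snd i j) (memLp_star h.memLp)
      (memLp_star (h.memLp_fst i)) (h.memLp_fst j) (h.memLp_snd i j)).add
    ((h.hasWeakPartial i).star.mul haq (memLp_star h.memLp) (memLp_star (h.memLp_fst i)) hm hm')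

end Almost

end Gauge

/-! ### Scale invariance and energy bounds -/

section Energy

theorem eLpNorm_two_sq {F : Type*} [NormedAddCommGroup F] (f : E4 → F) (μ : Measure E4) :
    eLpNorm f 2 μ ^ 2 = ∫⁻ x, ‖f x‖ₑ ^ 2 ∂μ := by
  have h := eLpNorm_nnreal_pow_eq_lintegral (f := f) (μ := μ) (p := 2) two_ne_zero
  have h2 (x : ℝ≥0∞) : x ^ ((2 : NNReal) : ℝ) = x ^ 2 := by
    rw [← ENNReal.rpow_natCast]; norm_num
  simp only [h2] at h
  exact h

/-- The scaling-invariant energy of the bubbles. -/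
def bubbleEnergy : ℝ≥0∞ := ∫⁻ x : E4, ‖bubble 1 x‖ₑ ^ 2

theorem bubbleEnergy_ne_top : bubbleEnergy ≠ ⊤ := by
  have h := (integrable_rpow_neg_one_add_norm_sq (E := E4) (μ := volume) (r := 8)
    (by rw [finrank_euclideanSpace]; norm_num)).2
  have hb : bubbleEnergy = ∫⁻ x : E4, ‖((1 : ℝ) + ‖x‖ ^ 2) ^ (-(8 : ℝ) / 2)‖ₑ := by
    refine lintegral_congr fun x => ?_
    rw [← enorm_pow, bubble, show (-(8 : ℝ) / 2) = -((4 : ℕ) : ℝ) by norm_num,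
      Real.rpow_neg (by positivity), Real.rpow_natCast]
    congr 1
    have : 0 < 1 + ‖x‖ ^ 2 := by positivity
    field_simp
  rw [hb]
  exact h.ne

/-- Since `bubble l x = l² bubble 1 (l x)`, the square gains `l⁴`, which the Jacobian `l⁻⁴`
compensates. -/
theorem lintegral_bubble_sq {l : ℝ} (hl : 0 < l) :
    ∫⁻ x : E4, ‖bubble l x‖ₑ ^ 2 = bubbleEnergy := by
  have h1 (x : E4) : ‖bubble l x‖ₑ ^ 2 = ENNReal.ofReal (l ^ 4) * ‖bubble 1 (l • x)‖ₑ ^ 2 := by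
    have : bubble l x = l ^ 2 * bubble 1 (l • x) := by
      rw [bubble, bubble, norm_smul, Real.norm_of_nonneg hl.le]; ring
    rw [this, enorm_mul, mul_pow, ← enorm_pow, Real.enorm_of_nonneg (by positivity)]
    ring_nf
  simp only [h1]
  rw [lintegral_const_mul' _ _ ENNReal.ofReal_ne_top]
  have hm : Measurable fun x : E4 => ‖bubble 1 x‖ₑ ^ 2 :=
    ((continuous_bubble 1).measurable.enorm).pow_const 2
  have h2 : ∫⁻ x : E4, ‖bubble 1 (l • x)‖ₑ ^ 2
      = ENNReal.ofReal |(l ^ 4)⁻¹| * bubbleEnergy := by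
    rw [← lintegral_map (f := fun x : E4 => ‖bubble 1 x‖ₑ ^ 2) (g := fun x => l • x) hm
      (measurable_const_smul l), Measure.map_addHaar_smul volume hl.ne', lintegral_smul_measure,
      finrank_euclideanSpace, Fintype.card_fin]
    rfl
  rw [h2, ← mul_assoc, abs_of_pos (by positivity), ← ENNReal.ofReal_mul (by positivity),
    mul_inv_cancel₀ (by positivity), ENNReal.ofReal_one, one_mul]

theorem eLpNorm_le_of_norm_le_bubble {F : Type*} [NormedAddCommGroup F] {f : E4 → F} {l : ℝ}
    (hl : 0 < l) (hf : ∀ᵐ x ∂(volume.restrict B4), ‖f x‖ ≤ 2 * bubble l x) :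
    eLpNorm f 2 (volume.restrict B4) ≤ (4 * bubbleEnergy) ^ (1 / 2 : ℝ) := by
  have h : eLpNorm f 2 (volume.restrict B4) ^ 2 ≤ 4 * bubbleEnergy := by
    rw [eLpNorm_two_sq, ← lintegral_bubble_sq hl, ← lintegral_const_mul' _ _ (by norm_num)]
    refine (lintegral_mono_ae ?_).trans (setLIntegral_le_lintegral B4 _)
    filter_upwards [hf] with x hx
    have h2 : ‖f x‖ₑ ≤ 2 * ‖bubble l x‖ₑ := by
      rw [← ofReal_norm, Real.enorm_of_nonneg (bubble_nonneg l x)]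
      refine (ENNReal.ofReal_le_ofReal hx).trans ?_
      rw [ENNReal.ofReal_mul zero_le_two, ENNReal.ofReal_ofNat]
    calc ‖f x‖ₑ ^ 2 ≤ (2 * ‖bubble l x‖ₑ) ^ 2 := by gcongr
      _ = 4 * ‖bubble l x‖ₑ ^ 2 := by ring
  rw [one_div, ENNReal.le_rpow_inv_iff two_pos, ENNReal.rpow_two]
  exact h

theorem curvature_instanton_ae (l : ℝ) (i j : Fin 4) :
    curvature (instanton l) i j =ᵐ[volume.restrict B4] fun x => toMat (bubble l x • sdForm i j) := by
  have hA (j : Fin 4) : instanton l j = fun x => toMat (potential l j x) :=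
    funext fun x => (toMat_potential l j x).symm
  have h (i j : Fin 4) : weakPartial i (instanton l j) =ᵐ[volume.restrict B4]
      fun x => toMat (potentialDeriv l i j x) := by
    rw [hA]
    exact ((hasWeakPartial_potential l i j).clm_comp toMat).weakPartial_ae_eq
  filter_upwards [h i j, h j i] with x h1 h2
  rw [curvature, h1, h2, ← curvH_potential, hA, hA, Ring.lie_def, curvH, map_add, map_sub, map_sub,
    toMat_mul, toMat_mul]

theorem enorm_toMat_sq (y : ℍ[ℝ]) : ‖toMat y‖ₑ ^ 2 = 2 * ‖y‖ₑ ^ 2 := by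
  have h := congrArg ENNReal.ofReal (norm_sq_toMat y)
  rwa [ENNReal.ofReal_mul zero_le_two, ENNReal.ofReal_pow (norm_nonneg _),
    ENNReal.ofReal_pow (norm_nonneg _), ofReal_norm, ofReal_norm, ENNReal.ofReal_ofNat] at h

/-- The constant is `48 = 6 · 2 · 2²`: six pairs `i < j`, the factor `2` of the matrix norm, and
`‖sdForm i j‖ ≤ 2`. -/
theorem ymEnergy_instanton_le {l : ℝ} (hl : 0 < l) :
    ymEnergy (instanton l) ≤ 48 * bubbleEnergy := by
  rw [← lintegral_bubble_sq hl, ← lintegral_const_mul' _ _ (by norm_num)]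
  refine (lintegral_mono_ae ?_).trans (setLIntegral_le_lintegral B4 _)
  have h : ∀ᵐ x ∂(volume.restrict B4), ∀ i j,
      curvature (instanton l) i j x = toMat (bubble l x • sdForm i j) :=
    ae_all_iff.2 fun i => ae_all_iff.2 fun j => curvature_instanton_ae l i j
  filter_upwards [h] with x hx
  have hs (i j : Fin 4) : ‖sdForm i j‖ₑ ≤ 2 := by
    rw [← ofReal_norm, ← ENNReal.ofReal_ofNat]
    exact ENNReal.ofReal_le_ofReal (norm_sdForm_le i j)
  calc ∑ i : Fin 4, ∑ j ∈ Finset.Ioi i, ‖curvature (instanton l) i j x‖ₑ ^ 2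
      ≤ ∑ i : Fin 4, ∑ j ∈ Finset.Ioi i, 8 * ‖bubble l x‖ₑ ^ 2 := by
        refine Finset.sum_le_sum fun i _ => Finset.sum_le_sum fun j _ => ?_
        rw [hx, enorm_toMat_sq, enorm_smul]
        calc 2 * (‖bubble l x‖ₑ * ‖sdForm i j‖ₑ) ^ 2 ≤ 2 * (‖bubble l x‖ₑ * 2) ^ 2 := by
              gcongr; exact hs i j
          _ = 8 * ‖bubble l x‖ₑ ^ 2 := by ring
    _ = 48 * ‖bubble l x‖ₑ ^ 2 := by
        have hc : ∑ i : Fin 4, (Finset.Ioi i).card = 6 := by decide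
        simp only [Finset.sum_const]
        rw [← Finset.sum_smul, hc, nsmul_eq_mul, ← mul_assoc]
        norm_num

end Energy

/-! ### Dirichlet energy of gauge-transformed instantons -/

section Main

theorem toMat_mem_su2 {y : ℍ[ℝ]} (hy : y.re = 0) : toMat y ∈ su2 := by
  refine ⟨?_, ?_⟩
  · rw [← toMat_star, ← map_neg, Quaternion.star_eq_neg.2 hy]
  · rw [toMat_apply, Matrix.trace_fin_two, hy]
    simp [Complex.ext_iff]

theorem isW12Connection_instanton (l : ℝ) : IsW12Connection (instanton l) := by
  intro j
  have hA : instanton l j = fun x => toMat (potential l j x) :=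
    funext fun x => (toMat_potential l j x).symm
  rw [hA]
  refine ⟨⟨?_, fun i => ⟨_, (hasWeakPartial_potential l i j).clm_comp toMat, ?_⟩⟩,
    fun x _ => toMat_mem_su2 (re_potential l j x)⟩
  · exact memLp_ball_of_continuous (toMat.continuous.comp (contDiff_potential l j).continuous) _ _
  · exact memLp_ball_of_continuous (toMat.continuous.comp (continuous_potentialDeriv l i j)) _ _

theorem IsW22Gauge.exists_isUnitGauge {g : E4 → SU2} (hg : IsW22Gauge g) :
    ∃ q₁ q₂, IsUnitGauge (fun x => ofMat (g x : M2)) q₁ q₂ := by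
  obtain ⟨h0, h⟩ := hg
  choose v hv hv2 using h
  have hv3 : ∀ i k, ∃ w, HasWeakPartial k (v i) w ∧ MemLp w 2 (volume.restrict B4) :=
    fun i k => (hv2 i).2 k
  choose w hw hw2 using hv3
  -- The indices are transposed: `w j i` is the `i`-th derivative of `v j`, which is what `q₂ i j`
  -- denotes.
  exact ⟨fun i x => ofMat (v i x), fun i j x => ofMat (w j i x),
    fun x => star_mul_self_ofMat (g x), fun i => (hv i).clm_comp ofMat,
    fun i j => (hw j i).clm_comp ofMat, ofMat.comp_memLp' h0,
    fun i => ofMat.comp_memLp' (hv2 i).1, fun i j => ofMat.comp_memLp' (hw2 j i)⟩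

theorem coe_inv_eq_toMat_star (g : SU2) : ((g⁻¹ : SU2) : M2) = toMat (star (ofMat (g : M2))) := by
  rw [toMat_star, toMat_ofMat_specialUnitary]
  rfl

theorem gaugeTransform_ae_eq {A : OneForm} {a : Fin 4 → E4 → ℍ[ℝ]}
    (hA : ∀ j x, toMat (a j x) = A j x) {g : E4 → SU2} {q₁ : Fin 4 → E4 → ℍ[ℝ]}
    {q₂ : Fin 4 → Fin 4 → E4 → ℍ[ℝ]} (h : IsUnitGauge (fun x => ofMat (g x : M2)) q₁ q₂)
    (j : Fin 4) : gaugeTransform A g j =ᵐ[volume.restrict B4] fun x =>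
      toMat (gaugeH (fun j => a j x) (ofMat (g x : M2)) (fun j => q₁ j x) j) := by
  have h1 : HasWeakPartial j (fun x => (g x : M2)) fun x => toMat (q₁ j x) :=
    ((h.hasWeakPartial j).clm_comp toMat).congr
      (Eventually.of_forall fun x => toMat_ofMat_specialUnitary (g x)) (EventuallyEq.refl _ _)
  filter_upwards [h1.weakPartial_ae_eq] with x hx
  rw [gaugeTransform, hx, coe_inv_eq_toMat_star, gaugeH, map_add, toMat_mul, toMat_mul, toMat_mul,
    toMat_ofMat_specialUnitary, hA, mul_assoc]

theorem sq_eLpNorm_le_dirichletEnergy {A : OneForm} {d : Fin 4 → Fin 4 → E4 → ℍ[ℝ]}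
    (h : ∀ i j, weakPartial i (A j) =ᵐ[volume.restrict B4] fun x => toMat (d i j x)) (i j : Fin 4) :
    eLpNorm (d i j) 2 (volume.restrict B4) ^ 2 ≤ dirichletEnergy A := by
  rw [eLpNorm_two_sq, dirichletEnergy]
  refine lintegral_mono_ae ?_
  filter_upwards [h i j] with x hx
  calc ‖d i j x‖ₑ ^ 2 ≤ 2 * ‖d i j x‖ₑ ^ 2 := le_mul_of_one_le_left' one_le_two
    _ = ‖weakPartial i (A j) x‖ₑ ^ 2 := by rw [hx, enorm_toMat_sq]
    _ ≤ ∑ j : Fin 4, ‖weakPartial i (A j) x‖ₑ ^ 2 :=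
      Finset.single_le_sum (f := fun j => ‖weakPartial i (A j) x‖ₑ ^ 2)
        (fun _ _ => zero_le) (Finset.mem_univ j)
    _ ≤ _ := Finset.single_le_sum (f := fun i => ∑ j : Fin 4, ‖weakPartial i (A j) x‖ₑ ^ 2)
        (fun _ _ => zero_le) (Finset.mem_univ i)

/-- Every gauge transform of a sufficiently concentrated instanton has large Dirichlet energy. -/
theorem exists_forall_le_dirichletEnergy {M : ℝ≥0∞} (hM : M ≠ ⊤) :
    ∃ L : ℝ, ∀ l, L ≤ l → ∀ g : E4 → SU2, IsW22Gauge g →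
      M ^ 2 ≤ dirichletEnergy (gaugeTransform (instanton l) g) := by
  obtain ⟨L, hL⟩ := exists_forall_not_eLpNorm_le (C₀ := (4 * bubbleEnergy) ^ (1 / 2 : ℝ)) hM
    (ENNReal.rpow_ne_top_of_nonneg (by norm_num)
      (ENNReal.mul_ne_top (by norm_num) bubbleEnergy_ne_top))
  refine ⟨max L 1, fun l hl g hg => ?_⟩
  have hl0 : 0 < l := lt_of_lt_of_le one_pos ((le_max_right L 1).trans hl)
  by_contra! hlt
  obtain ⟨q₁, q₂, h⟩ := hg.exists_isUnitGauge
  have ha : ∀ j, MemLp (potential l j) ⊤ (volume.restrict B4) := fun j =>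
    memLp_ball_of_continuous (contDiff_potential l j).continuous _ _
  have ha₁ : ∀ i j, MemLp (potentialDeriv l i j) ⊤ (volume.restrict B4) := fun i j =>
    memLp_ball_of_continuous (continuous_potentialDeriv l i j) _ _
  set B : Fin 4 → E4 → ℍ[ℝ] := fun j x =>
    gaugeH (fun j => potential l j x) (ofMat (g x : M2)) (fun j => q₁ j x) j with hB
  set d : Fin 4 → Fin 4 → E4 → ℍ[ℝ] := fun i j x =>
    gaugeDerivH (fun j => potential l j x) (fun i j => potentialDeriv l i j x) (ofMat (g x : M2))
      (fun j => q₁ j x) (fun i j => q₂ i j x) i j with hd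
  have hBd : ∀ i j, HasWeakPartial i (B j) (d i j) :=
    h.hasWeakPartial_gaugeH ha ha₁ (hasWeakPartial_potential l)
  -- `weakPartial` is `0` when no weak derivative exists, so a small Dirichlet energy says something
  -- only once the derivative is shown to exist, as `hBd` does.
  have hw : ∀ i j, weakPartial i (gaugeTransform (instanton l) g j) =ᵐ[volume.restrict B4]
      fun x => toMat (d i j x) := fun i j =>
    (((hBd i j).clm_comp toMat).congr (gaugeTransform_ae_eq (toMat_potential l) h j).symm
      (EventuallyEq.refl _ _)).weakPartial_ae_eq
  have hdM : ∀ i j, eLpNorm (d i j) 2 (volume.restrict B4) ≤ M := fun i j =>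
    (ENNReal.pow_le_pow_left_iff two_ne_zero).1
      ((sq_eLpNorm_le_dirichletEnergy hw i j).trans hlt.le)
  have h₁ : ∀ᵐ x ∂(volume.restrict B4), ∀ i,
      star (q₁ i x) * ofMat (g x : M2) + star (ofMat (g x : M2)) * q₁ i x = 0 :=
    ae_all_iff.2 h.ae_add_eq_zero
  have h₂ : ∀ᵐ x ∂(volume.restrict B4), ∀ i j, q₂ i j x = q₂ j i x :=
    ae_all_iff.2 fun i => ae_all_iff.2 (h.ae_snd_comm i)
  have hF : ∀ᵐ x ∂(volume.restrict B4), ∀ i j, curvH (fun i => B i x) (fun i j => d i j x) i j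
      = star (ofMat (g x : M2)) * (bubble l x • sdForm i j * ofMat (g x : M2)) := by
    filter_upwards [h₁, h₂] with x hx1 hx2 i j
    rw [← curvH_potential]
    exact curvH_gaugeH (h.star_mul_self x) hx1 hx2 i j
  have hFn : ∀ i j, ∀ᵐ x ∂(volume.restrict B4),
      ‖curvH (fun i => B i x) (fun i j => d i j x) i j‖ ≤ 2 * bubble l x := fun i j => by
    filter_upwards [hF] with x hx
    rw [hx, norm_star_mul_mul (h.star_mul_self x), norm_smul,
      Real.norm_of_nonneg (bubble_nonneg l x), mul_comm]
    exact mul_le_mul_of_nonneg_right (norm_sdForm_le i j) (bubble_nonneg l x)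
  -- Square integrability of `d i j` is read off from the contradiction hypothesis through `hdM`,
  -- with measurability from local integrability.
  refine hL l ((le_max_left L 1).trans hl) B d hBd (h.memLp_gaugeH ha) (fun j => ?_)
    (fun i j => ⟨?_, (hdM i j).trans_lt hM.lt_top⟩)
    (fun i j => eLpNorm_le_of_norm_le_bubble hl0 (hFn i j)) hFn ?_ hdM
  · filter_upwards [h₁] with x hx
    exact re_gaugeH (h.star_mul_self x) hx (fun j => re_potential l j x) j
  · exact (hBd i j).2.1.aestronglyMeasurable
  · filter_upwards [hF] with x hx
    have e1 : curvH (fun i => B i x) (fun i j => d i j x)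
        = fun i j => star (ofMat (g x : M2)) * (bubble l x • sdForm i j * ofMat (g x : M2)) :=
      funext fun i => funext fun j => hx i j
    have e2 : (wedgeSq fun i j => bubble l x • sdForm i j) = bubble l x ^ 2 • wedgeSq sdForm := by
      simp only [wedgeSq, smul_mul_smul_comm, smul_add, smul_sub, sq]
    rw [e1, re_wedgeSq_conj (h.star_mul_self x), e2, Quaternion.re_smul, re_wedgeSq_sdForm,
      smul_eq_mul]
    ring

end Main

end YangMills

end

theorem mainTheorem3 :
    ∃ A : ℕ → YangMills.OneForm,
      (∀ k, YangMills.IsW12Connection (A k)) ∧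
      limsup (fun k => YangMills.ymEnergy (A k)) atTop < ⊤ ∧
      liminf (fun k => ⨅ (g : YangMills.E4 → YangMills.SU2) (_ : YangMills.IsW22Gauge g),
        YangMills.dirichletEnergy (YangMills.gaugeTransform (A k) g)) atTop = ⊤ ∧
      (∃ l : ℕ → ℝ, (∀ k, 0 < l k) ∧ Tendsto l atTop atTop ∧
        ∀ k, A k = YangMills.instanton (l k)) := by
  have hl : Tendsto (fun k : ℕ => (k : ℝ) + 1) atTop atTop :=
    tendsto_atTop_add_const_right _ _ tendsto_natCast_atTop_atTop
  refine ⟨fun k => YangMills.instanton (k + 1), fun k => YangMills.isW12Connection_instanton _,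
    ?_, ?_, fun k => k + 1, fun k => k.cast_add_one_pos, hl, fun k => rfl⟩
  · refine lt_of_le_of_lt (limsup_le_of_le (h := Eventually.of_forall fun k : ℕ =>
      YangMills.ymEnergy_instanton_le k.cast_add_one_pos)) ?_
    exact ENNReal.mul_lt_top (by norm_num) YangMills.bubbleEnergy_ne_top.lt_top
  · refine ENNReal.eq_top_of_forall_nnreal_le fun r => ?_
    -- The lower bound is `M²`, so `M = √r` yields an arbitrary level `r`.
    obtain ⟨L, hL⟩ := YangMills.exists_forall_le_dirichletEnergy
      (M := (NNReal.sqrt r : ℝ≥0∞)) ENNReal.coe_ne_top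
    refine le_liminf_of_le (h := ?_)
    filter_upwards [hl.eventually_ge_atTop L] with k hk
    refine le_iInf₂ fun g hg => ?_
    have h := hL _ hk g hg
    rwa [← ENNReal.coe_pow, NNReal.sq_sqrt] at h
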